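/- An automaton is a triple $\mathcal A=(Q,\Sigma,\delta)$ with a finite set $Q$ of $n$ states, a finite alphabet $\Sigma$ and a transition function $\delta\colon Q\times\Sigma\to Q$, extended to words as usual. A set $S\subseteq Q$ is reachable if $S=\delta(Q,w)$ for some word $w\in\Sigma^*$; $\mathcal A$ is completely reachable if every non-empty $S\subseteq Q$ is reachable. A witness is a non-empty proper subset of $Q$ that is unreachable and has the maximal size of all unreachable subsets of $Q$. For a word $w$ write $\delta^{-1}(S,w)=\{q : \delta(q,w)\in S\}$; $\delta^{-1}(S,w)$ is a $w$-predecessor of $S$ if $\delta(\delta^{-1}(S,w),w)=S$. The recursive procedure $\mathrm{FindProperlyExtendingWord}(S)$ keeps a FIFO queue of pairs $(T,w)$ with $\delta(T,w)=S$, initially $(S,\varepsilon)$, and an array $\mathrm{Absent}$ indexed by $Q$, initially "none". It repeatedly pops a pair $(T,w)$. If $|T|>|S|$, it returns $w$. Otherwise, if $\mathrm{Absent}[q]=(T',w')$ is not "none" for some $q\notin T$, then it skips $(T,w)$ if $T'=T$, and else it calls itself on $T\cup T'$, asserts that this returns a word $u$, and returns $uw$ if $|\delta^{-1}(T,u)|>|T|$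 and $uw'$ otherwise. Otherwise it sets $\mathrm{Absent}[q]=(T,w)$ for all $q\notin T$ and pushes $(\delta^{-1}(T,a),aw)$ for every letter $a$ for which $\delta^{-1}(T,a)$ is an $a$-predecessor of $T$. When the queue is empty it returns "none". Words are represented by the transformations of $Q$ that they induce. The function $\mathrm{FindWitness}$ keeps a priority queue of sets, initially all $Q\setminus\{q\}$, $q\in Q$. While it is non-empty, it pops a largest set $S$ and calls $\mathrm{FindProperlyExtendingWord}(S)$; if the answer is "none", it returns $S$; if the answer is a word $w$, it pushes $S'=\{q\in S : |\delta^{-1}(\{q\},w)|=1\}$ unless $S'$ is empty or already in the queue. When the queue is empty it returns "none". Running time is the number of elementary operations of a random access machine (registers and two-dimensional arrays of natural numbers, successor and predecessor, comparisons, structured control with recursive procedures, unit cost); $\mathrm{FindWitness}$ is implemented on it with sets and transformations stored as rows of arrays, from the transition table of an automaton whose states and letters are numbered. **Claim.** (1) For every automaton with $n\ge 2$ states, $\mathrm{FindWitness}$ halts without a failed assertion, and either it returns "none", there is no witness and the automaton is completely reachable, or it returns a witness (so the automaton is not completely reachable). There is a constant $C$ such that for every automaton with $n\ge 2$ states and $|\Sigma|\ge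 1$ letters its running time is at most $C\, n^4\log n\cdot|\Sigma|$. (2) The problem Completely Reachable (given an automaton, described by a bit string that lists $n$, $|\Sigma|$ and the transition table in self-delimiting unary code, is it completely reachable?) is in P: some program of this machine model decides it, over all bit strings, in time polynomial in the length of the input. -/

import Mathlib

/-! ## Semi-automata, reachable sets, witnesses -/

namespace CompReach

/-- A deterministic complete semi-automaton with states `Q` and input alphabet `A`. -/
structure SemiAutomaton (Q A : Type*) where
  /-- the transition function -/
  step : Q → A → Q

namespace SemiAutomaton

variable {Q A : Type*}

/-- The transition function extended to words (read from left to right). -/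
def run (M : SemiAutomaton Q A) (q : Q) (w : List A) : Q :=
  w.foldl M.step q

/-- `δ(T, w)`, the image of a set of states under a word. -/
def image [DecidableEq Q] (M : SemiAutomaton Q A) (T : Finset Q) (w : List A) : Finset Q :=
  T.image fun q => M.run q w

/-- `S` is reachable if it is the image of the set of all states under some word. -/
def Reachable [Fintype Q] [DecidableEq Q] (M : SemiAutomaton Q A) (S : Finset Q) : Prop :=
  ∃ w : List A, M.image Finset.univ w = S

/-- Every non-empty set of states is reachable. -/
def CompletelyReachable [Fintype Q] [DecidableEq Q] (M : SemiAutomaton Q A) : Prop :=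
  ∀ S : Finset Q, S.Nonempty → M.Reachable S

/-- A witness: a non-empty proper subset of the states that is unreachable and has the maximal
size of all unreachable subsets. -/
def IsWitness [Fintype Q] [DecidableEq Q] (M : SemiAutomaton Q A) (S : Finset Q) : Prop :=
  S.Nonempty ∧ S ⊂ Finset.univ ∧ ¬ M.Reachable S ∧
    ∀ T : Finset Q, ¬ M.Reachable T → T.card ≤ S.card

end SemiAutomaton

/-! ## The machine model

A random access machine with finitely many registers and two-dimensional arrays that hold natural
numbers (a program mentions only finitely many names), controlled by a structured program with
parameterless, possibly recursive procedures.  The only arithmetic is successor and predecessor, so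
that after `t` steps no stored number exceeds the largest number of the input and of the program by
more than `t`.  Every elementary operation costs one unit of time. -/

/-- The memory: register `x` holds `reg x`, cell `(i, j)` of array `a` holds `mem a i j`. -/
@[ext]
structure State where
  reg : ℕ → ℕ
  mem : ℕ → ℕ → ℕ → ℕ

/-- Write `v` into register `x`. -/
def State.setReg (s : State) (x v : ℕ) : State :=
  { s with reg := fun y => if y = x then v else s.reg y }

/-- Write `v` into cell `(i, j)` of array `a`. -/
def State.setMem (s : State) (a i j v : ℕ) : State :=
  { s with mem := fun b p q => if b = a ∧ p = i ∧ q = j then v else s.mem b p q }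

inductive Expr where
  /-- a constant -/
  | lit (m : ℕ)
  /-- the content of a register -/
  | var (x : ℕ)
  /-- the content of cell `(i, j)` of array `a` -/
  | get (a : ℕ) (i j : Expr)
  | succ (e : Expr)
  | pred (e : Expr)

def Expr.eval (s : State) : Expr → ℕ
  | lit m => m
  | var x => s.reg x
  | get a i j => s.mem a (i.eval s) (j.eval s)
  | succ e => e.eval s + 1
  | pred e => e.eval s - 1

/-- The number of elementary operations in the evaluation of an expression. -/
def Expr.cost : Expr → ℕ
  | lit _ => 1
  | var _ => 1
  | get _ i j => i.cost + j.cost + 1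
  | succ e => e.cost + 1
  | pred e => e.cost + 1

inductive Cond where
  | lt (e f : Expr)
  | eq (e f : Expr)
  | not (b : Cond)
  | and (b c : Cond)

def Cond.Holds (s : State) : Cond → Prop
  | lt e f => e.eval s < f.eval s
  | eq e f => e.eval s = f.eval s
  | not b => ¬ b.Holds s
  | and b c => b.Holds s ∧ c.Holds s

/-- The number of elementary operations in the evaluation of a condition. -/
def Cond.cost : Cond → ℕ
  | lt e f => e.cost + f.cost + 1
  | eq e f => e.cost + f.cost + 1
  | not b => b.cost + 1
  | and b c => b.cost + c.cost + 1

inductive Stmt where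
  | skip
  /-- register `x` receives the value of `e` -/
  | set (x : ℕ) (e : Expr)
  /-- cell `(i, j)` of array `a` receives the value of `e` -/
  | put (a : ℕ) (i j : Expr) (e : Expr)
  | seq (c d : Stmt)
  | ite (b : Cond) (c d : Stmt)
  | while (b : Cond) (c : Stmt)
  /-- execute procedure number `p` -/
  | call (p : ℕ)

/-- `Exec procs c s t s'`: with the procedures `procs`, the statement `c` started in the memory
state `s` halts after exactly `t` units of time in the memory state `s'`. -/
inductive Exec (procs : List Stmt) : Stmt → State → ℕ → State → Prop where
  | skip (s : State) : Exec procs .skip s 1 s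
  | set (x : ℕ) (e : Expr) (s : State) :
      Exec procs (.set x e) s (e.cost + 1) (s.setReg x (e.eval s))
  | put (a : ℕ) (i j e : Expr) (s : State) :
      Exec procs (.put a i j e) s (i.cost + j.cost + e.cost + 1)
        (s.setMem a (i.eval s) (j.eval s) (e.eval s))
  | seq {c d : Stmt} {s s₁ s₂ : State} {t₁ t₂ : ℕ} :
      Exec procs c s t₁ s₁ → Exec procs d s₁ t₂ s₂ → Exec procs (.seq c d) s (t₁ + t₂) s₂
  | ite_true {b : Cond} {c d : Stmt} {s s' : State} {t : ℕ} :
      b.Holds s → Exec procs c s t s' → Exec procs (.ite b c d) s (b.cost + t + 1) s'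
  | ite_false {b : Cond} {c d : Stmt} {s s' : State} {t : ℕ} :
      ¬ b.Holds s → Exec procs d s t s' → Exec procs (.ite b c d) s (b.cost + t + 1) s'
  | while_false {b : Cond} {c : Stmt} {s : State} :
      ¬ b.Holds s → Exec procs (.while b c) s (b.cost + 1) s
  | while_true {b : Cond} {c : Stmt} {s s₁ s₂ : State} {t₁ t₂ : ℕ} :
      b.Holds s → Exec procs c s t₁ s₁ → Exec procs (.while b c) s₁ t₂ s₂ →
        Exec procs (.while b c) s (b.cost + t₁ + t₂ + 1) s₂
  | call {p : ℕ} {c : Stmt} {s s' : State} {t : ℕ} :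
      procs[p]? = some c → Exec procs c s t s' → Exec procs (.call p) s (t + 1) s'

/-- The machine is deterministic: running time and final state are determined by the start. -/
theorem Exec.unique {procs : List Stmt} {c : Stmt} {s : State} {t t' : ℕ} {s₁ s₂ : State}
    (h : Exec procs c s t s₁) (h' : Exec procs c s t' s₂) : t = t' ∧ s₁ = s₂ := by
  induction h generalizing t' s₂ with
  | skip | set | put => cases h'; exact ⟨rfl, rfl⟩
  | seq _ _ ih₁ ih₂ =>
    cases h' with
    | seq k₁ k₂ =>
      obtain ⟨rfl, rfl⟩ := ih₁ k₁
      obtain ⟨rfl, rfl⟩ := ih₂ k₂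
      exact ⟨rfl, rfl⟩
  | ite_true hb _ ih =>
    cases h' with
    | ite_true _ k => obtain ⟨rfl, rfl⟩ := ih k; exact ⟨rfl, rfl⟩
    | ite_false nb _ => exact absurd hb nb
  | ite_false nb _ ih =>
    cases h' with
    | ite_true hb _ => exact absurd hb nb
    | ite_false _ k => obtain ⟨rfl, rfl⟩ := ih k; exact ⟨rfl, rfl⟩
  | while_false nb =>
    cases h' with
    | while_false _ => exact ⟨rfl, rfl⟩
    | while_true hb _ _ => exact absurd hb nb
  | while_true hb _ _ ih₁ ih₂ =>
    cases h' with
    | while_false nb => exact absurd hb nb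
    | while_true _ k₁ k₂ =>
      obtain ⟨rfl, rfl⟩ := ih₁ k₁
      obtain ⟨rfl, rfl⟩ := ih₂ k₂
      exact ⟨rfl, rfl⟩
  | call hp _ ih =>
    cases h' with
    | call hq k =>
      rw [hp] at hq
      cases hq
      obtain ⟨rfl, rfl⟩ := ih k
      exact ⟨rfl, rfl⟩

/-- A program: a main statement and finitely many procedures. -/
structure Program where
  main : Stmt
  procs : List Stmt

/-- Started in `s`, the program halts after exactly `t` units of time in the state `s'`. -/
def Program.Runs (P : Program) (s : State) (t : ℕ) (s' : State) : Prop :=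
  Exec P.procs P.main s t s'

/-- Sequential composition of a list of statements. -/
def block : List Stmt → Stmt
  | [] => .skip
  | [c] => c
  | c :: d :: l => .seq c (block (d :: l))

/-- One-armed conditional. -/
def when (b : Cond) (c : Stmt) : Stmt :=
  .ite b c .skip

/-- `for x = 0, …, e - 1 do c`. -/
def for_ (x : ℕ) (e : Expr) (c : Stmt) : Stmt :=
  .seq (.set x (.lit 0)) (.while (.lt (.var x) e) (.seq c (.set x (.succ (.var x)))))

/-! ## Polynomial time -/

/-- The start state on a bit string `x`: register `0` holds the length of `x`, and the bits of `x`
are the cells `(0, 0), (0, 1), …` of array `0`; everything else is `0`. -/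
def bitInput (x : List Bool) : State where
  reg r := if r = 0 then x.length else 0
  mem a i j := if a = 0 ∧ i = 0 ∧ x[j]? = some true then 1 else 0

/-- The class P: languages decided by a program in time polynomial in the length of the input.
A program accepts by halting with `1` in register `0`. -/
def InP (L : Set (List Bool)) : Prop :=
  ∃ (P : Program) (p : Polynomial ℕ), ∀ x : List Bool, ∃ (t : ℕ) (s : State),
    P.Runs (bitInput x) t s ∧ t ≤ p.eval x.length ∧ (s.reg 0 = 1 ↔ x ∈ L)

/-- Self-delimiting unary code of a number. -/
def unary (m : ℕ) : List Bool :=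
  List.replicate m true ++ [false]

/-- The description of a semi-automaton by a bit string: the number of states, the number of
letters, and the transition table. -/
def encode {n k : ℕ} (M : SemiAutomaton (Fin n) (Fin k)) : List Bool :=
  unary n ++ unary k ++ (List.finRange n).flatMap fun q =>
    (List.finRange k).flatMap fun a => unary (M.step q a)

/-- The decision problem Completely Reachable: given an automaton, is it completely reachable? -/
def completelyReachableProblem : Set (List Bool) :=
  {x | ∃ (n k : ℕ) (M : SemiAutomaton (Fin n) (Fin k)), M.CompletelyReachable ∧ x = encode M}

/-! ## The algorithm FindWitness

Sets of states are stored as rows of zeros and ones.  A word is represented by the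
transformation of the states that it induces, stored as a row. -/

namespace FindWitness

/-! Registers. -/

/-- input: the number of states -/
abbrev n : ℕ := 0
/-- input: the number of letters -/
abbrev k : ℕ := 1
/-- output: `0` for "none", `1` for "witness found", `2` for a failed assertion -/
abbrev result : ℕ := 2
/-- the depth of the recursion of `findExtending` -/
abbrev depth : ℕ := 3
/-- the outcome of `findExtending`: `0` while it is running, `1` if a word is returned, `2` if
none is returned, `3` for a failed assertion -/
abbrev status : ℕ := 4
/-- the size of the set for which an extending word is sought -/
abbrev size : ℕ := 5
/-- the front of the FIFO queue -/
abbrev head : ℕ := 6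
/-- the rear of the FIFO queue -/
abbrev tail : ℕ := 7
/-- the entry of the FIFO queue that is being processed -/
abbrev cur : ℕ := 8
/-- an entry of the FIFO queue that was processed earlier, plus one; or `0` -/
abbrev hit : ℕ := 9
abbrev c₁ : ℕ := 10
abbrev c₂ : ℕ := 11
/-- a truth value -/
abbrev flag : ℕ := 12
/-- the number of sets in the priority queue -/
abbrev count : ℕ := 13
/-- the position of a largest set in the priority queue -/
abbrev best : ℕ := 14
/-- whether a set occurs in the priority queue -/
abbrev dup : ℕ := 15
/-- whether the main loop has to stop -/
abbrev done : ℕ := 16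
abbrev q : ℕ := 17
abbrev a : ℕ := 18
abbrev i : ℕ := 19

/-! Arrays. -/

/-- input: cell `(q, a)` holds `δ(q, a)` -/
abbrev delta : ℕ := 0
/-- output: row `0` is the witness -/
abbrev out : ℕ := 1
/-- row `d` is the argument of the call of `findExtending` at depth `d` -/
abbrev arg : ℕ := 2
/-- row `0` is (the transformation of) the word returned by `findExtending` -/
abbrev ret : ℕ := 3
/-- the FIFO queue of pairs `(T, w)`: the sets -/
abbrev queueT : ℕ := 4
/-- the FIFO queue of pairs `(T, w)`: the words -/
abbrev queueW : ℕ := 5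
/-- row `0`: for each state, a pointer (entry plus one) to the FIFO queue, or `0` for "none" -/
abbrev absent : ℕ := 6
/-- row `0`: for each state, a counter of its preimages -/
abbrev cnt : ℕ := 7
/-- row `d` of `setT`, `wordW`, `setT'`, `wordW'`: the pairs `(T, w)` and `(T', w')` of the call
of `findExtending` at depth `d` -/
abbrev setT : ℕ := 8
abbrev wordW : ℕ := 9
abbrev setT' : ℕ := 10
abbrev wordW' : ℕ := 11
/-- row `i` is the set number `i` of the priority queue -/
abbrev bag : ℕ := 12

/-- `for q ∈ Q do c` -/
def forStates (c : Stmt) : Stmt :=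
  for_ q (.var n) c

/-- `x := |row r of array b|` -/
def card (x b : ℕ) (r : Expr) : Stmt :=
  block [
    .set x (.lit 0),
    forStates (when (.eq (.get b r (.var q)) (.lit 1)) (.set x (.succ (.var x))))]

/-- row `r` of array `b` := row `r'` of array `b'` -/
def copy (b : ℕ) (r : Expr) (b' : ℕ) (r' : Expr) : Stmt :=
  forStates (.put b r (.var q) (.get b' r' (.var q)))

/-- `x := 1` if row `r` and row `r'` of array `b` agree, `x := 0` otherwise -/
def compare (x b : ℕ) (r r' : Expr) : Stmt :=
  block [
    .set x (.lit 1),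
    forStates (when (.not (.eq (.get b r (.var q)) (.get b r' (.var q)))) (.set x (.lit 0)))]

/-- `S` is the argument at the current depth; the FIFO queue becomes `[(S, ε)]`, and `absent[q]`
becomes "none" for every state `q`. -/
def start : Stmt :=
  block [
    card size arg (.var depth),
    copy queueT (.lit 0) arg (.var depth),
    forStates (.put queueW (.lit 0) (.var q) (.var q)),
    forStates (.put absent (.lit 0) (.var q) (.lit 0)),
    .set head (.lit 0),
    .set tail (.lit 1),
    .set status (.lit 0)]

/-- `hit` becomes `absent[q]` for some `q` outside `T` for which it is not "none"; or `0`. -/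
def lookup : Stmt :=
  block [
    .set hit (.lit 0),
    forStates (when (.and (.eq (.get queueT (.var cur) (.var q)) (.lit 0))
        (.not (.eq (.get absent (.lit 0) (.var q)) (.lit 0))))
      (.set hit (.get absent (.lit 0) (.var q))))]

/-- The recursive call for `T ∪ T'`: if it returns the word `u`, then the result is `uw` if
`|δ⁻¹(T, u)| > |T|` and `uw'` otherwise; if it returns "none", then the assertion fails. -/
def recurse : Stmt :=
  block [
    copy setT (.var depth) queueT (.var cur),
    copy wordW (.var depth) queueW (.var cur),
    copy setT' (.var depth) queueT (.pred (.var hit)),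
    copy wordW' (.var depth) queueW (.pred (.var hit)),
    forStates (.ite (.and (.eq (.get setT (.var depth) (.var q)) (.lit 0))
        (.eq (.get setT' (.var depth) (.var q)) (.lit 0)))
      (.put arg (.succ (.var depth)) (.var q) (.lit 0))
      (.put arg (.succ (.var depth)) (.var q) (.lit 1))),
    .set depth (.succ (.var depth)),
    .call 0,
    .set depth (.pred (.var depth)),
    .ite (.eq (.var status) (.lit 1))
      (block [
        .set c₁ (.lit 0),
        forStates (when (.eq (.get setT (.var depth) (.get ret (.lit 0) (.var q))) (.lit 1))
          (.set c₁ (.succ (.var c₁)))),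
        card c₂ setT (.var depth),
        .ite (.lt (.var c₂) (.var c₁))
          (forStates (.put ret (.lit 0) (.var q)
            (.get wordW (.var depth) (.get ret (.lit 0) (.var q)))))
          (forStates (.put ret (.lit 0) (.var q)
            (.get wordW' (.var depth) (.get ret (.lit 0) (.var q)))))])
      (.set status (.lit 3))]

/-- `absent[q]` becomes `(T, w)` for every `q` outside `T`; then for every letter `a` such that
`δ⁻¹(T, a)` is an `a`-predecessor of `T`, the pair `(δ⁻¹(T, a), aw)` is pushed. -/
def expand : Stmt :=
  block [
    forStates (when (.eq (.get queueT (.var cur) (.var q)) (.lit 0))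
      (.put absent (.lit 0) (.var q) (.succ (.var cur)))),
    for_ a (.var k) (block [
      forStates (.put cnt (.lit 0) (.var q) (.lit 0)),
      forStates (.put cnt (.lit 0) (.get delta (.var q) (.var a)) (.lit 1)),
      .set flag (.lit 1),
      forStates (when (.and (.eq (.get queueT (.var cur) (.var q)) (.lit 1))
          (.eq (.get cnt (.lit 0) (.var q)) (.lit 0)))
        (.set flag (.lit 0))),
      when (.eq (.var flag) (.lit 1)) (block [
        forStates (.put queueT (.var tail) (.var q)
          (.get queueT (.var cur) (.get delta (.var q) (.var a)))),
        forStates (.put queueW (.var tail) (.var q)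
          (.get queueW (.var cur) (.get delta (.var q) (.var a)))),
        .set tail (.succ (.var tail))])])]

/-- The recursive procedure FindProperlyExtendingWord (procedure number `0`). -/
def findExtending : Stmt :=
  block [
    start,
    .while (.and (.eq (.var status) (.lit 0)) (.lt (.var head) (.var tail))) (block [
      .set cur (.var head),
      .set head (.succ (.var head)),
      card c₁ queueT (.var cur),
      .ite (.lt (.var size) (.var c₁))
        (block [
          copy ret (.lit 0) queueW (.var cur),
          .set status (.lit 1)])
        (block [
          lookup,
          .ite (.eq (.var hit) (.lit 0))
            expand
            (block [
              compare flag queueT (.var cur) (.pred (.var hit)),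
              when (.eq (.var flag) (.lit 0)) recurse])])]),
    when (.eq (.var status) (.lit 0)) (.set status (.lit 2))]

/-- The priority queue becomes the sequence of the sets `Q \ {i}`. -/
def fillBag : Stmt :=
  block [
    for_ i (.var n) (forStates (.ite (.eq (.var q) (.var i))
      (.put bag (.var i) (.var q) (.lit 0))
      (.put bag (.var i) (.var q) (.lit 1)))),
    .set count (.var n)]

/-- Move a largest set of the priority queue into row `0` of `arg`. -/
def popLargest : Stmt :=
  block [
    .set best (.lit 0),
    .set c₂ (.lit 0),
    for_ i (.var count) (block [
      card c₁ bag (.var i),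
      when (.lt (.var c₂) (.var c₁)) (block [
        .set best (.var i),
        .set c₂ (.var c₁)])]),
    copy arg (.lit 0) bag (.var best),
    .set count (.pred (.var count)),
    copy bag (.var best) bag (.var count)]

/-- `S' := {q ∈ S : |δ⁻¹(q, w)| = 1}`, pushed if it is non-empty and not contained in the
priority queue. -/
def reduceAndPush : Stmt :=
  block [
    forStates (.put cnt (.lit 0) (.var q) (.lit 0)),
    forStates (.put cnt (.lit 0) (.get ret (.lit 0) (.var q))
      (.succ (.get cnt (.lit 0) (.get ret (.lit 0) (.var q))))),
    forStates (.ite (.and (.eq (.get arg (.lit 0) (.var q)) (.lit 1))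
        (.eq (.get cnt (.lit 0) (.var q)) (.lit 1)))
      (.put bag (.var count) (.var q) (.lit 1))
      (.put bag (.var count) (.var q) (.lit 0))),
    card c₁ bag (.var count),
    .set dup (.lit 0),
    for_ i (.var count) (block [
      compare flag bag (.var i) (.var count),
      when (.eq (.var flag) (.lit 1)) (.set dup (.lit 1))]),
    when (.and (.lt (.lit 0) (.var c₁)) (.eq (.var dup) (.lit 0)))
      (.set count (.succ (.var count)))]

/-- The main function FindWitness. -/
def main : Stmt :=
  block [
    fillBag,
    .set result (.lit 0),
    .set done (.lit 0),
    .while (.and (.eq (.var done) (.lit 0)) (.lt (.lit 0) (.var count))) (block [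
      popLargest,
      .set depth (.lit 0),
      .call 0,
      .ite (.eq (.var status) (.lit 1))
        reduceAndPush
        (block [
          .set done (.lit 1),
          .ite (.eq (.var status) (.lit 2))
            (block [
              copy out (.lit 0) arg (.lit 0),
              .set result (.lit 1)])
            (.set result (.lit 2))])])]

/-- The algorithm. -/
def program : Program where
  main := main
  procs := [findExtending]

/-- The start state: the input automaton is given by the number of its states, the number of its
letters, and its transition table; everything else is `0`. -/
def input {N K : ℕ} (M : SemiAutomaton (Fin N) (Fin K)) : State where
  reg r := if r = n then N else if r = k then K else 0
  mem b p l := if h : b = delta ∧ p < N ∧ l < K then M.step ⟨p, h.2.1⟩ ⟨l, h.2.2⟩ else 0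

/-- The algorithm returned "none". -/
def ReturnsNone (s : State) : Prop :=
  s.reg result = 0

/-- The algorithm returned the set `S`. -/
def Returns {N : ℕ} (s : State) (S : Finset (Fin N)) : Prop :=
  s.reg result = 1 ∧ ∀ p : Fin N, p ∈ S ↔ s.mem out 0 p = 1

end FindWitness

end CompReach

/-!
The algorithm is an imperative program, and everything that is claimed about it is derived in a
small calculus of total correctness: `Ends procs c s T P` says that the statement `c`, started in
the memory `s`, halts within `T` steps in a memory that satisfies `P`.  What a statement leaves
unchanged is read off from its text (`Unchanged`), and a recursive call is handled through the
relation `Frame`.  Numerical constants in the time bounds are generous.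

*Extending words.*  A transformation induced by a word *extends* `S` (`Extends`) if `S` lies in its
range and its preimage of `S` is larger than `S`.  A proper subset without extending words is
unreachable, since a word with image `S` extends `S` (`not_reachable_of_not_extendable`).  If all
proper subsets of size at least `|S|` have extending words, then `S` is reachable: pass to larger
and larger predecessors until the set of all states is attained (`reachable_of_extendable`).  So a
set without extending word is a witness if all larger proper subsets have extending words.

*The search.*  `findExtending` explores the predecessors of `S` of size `|S|` breadth first.  An
entry `T` of the queue is expanded only if its complement is disjoint from the complements of all
sets that were expanded before.  These complements have `n - |S|` elements each, so there are at
most `n / (n - |S|)` expansions (`Search.card_mul_le`).  If the complements of `T` and of an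
expanded set `T' ≠ T` meet, then `T ∪ T'` is a proper subset larger than `S`, and a word that
extends it extends `T` or `T'`, by inclusion and exclusion (`Extends.of_union`); so one recursive call
ends the search.  If the queue becomes empty, then the expanded sets are closed under predecessors with
respect to letters, all predecessors of `S` have the size of `S`, and there is no extending word
(`Search.not_extendable`).

*The running time of the search.*  A call takes `O(n k · n / (n - |S|))` steps, apart from the
recursive call, which concerns a larger set.  Hence the total is at most a multiple of `n² k` times
a partial sum of the harmonic series (`searchTime`), that is, `O(n² log n · k)`.

*The main loop.*  The invariant (`MainInv`) is that every non-empty proper subset without extending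
word is contained in a set of the priority queue.  It persists when `S` is replaced by the set of
its states with exactly one preimage: if `f` extends `S` but not `T ⊆ S`, then `f` is a bijection
from the preimage of `T` to `T` (`Extends.subset_reduct`).  As a largest set of the queue is popped,
all larger proper subsets have extending words.  For this reason the assertion never fails, and the
set for which the search fails is a witness.  The sum of the sizes of the sets in the queue is at
most `n²` and decreases in every round, so there are at most `n²` rounds.

*Membership in P.*  The program `decider` reads the unary code into the transition table, rejects
strings that are not the code of an automaton, accepts the automata with fewer than two states, and
otherwise runs the algorithm (`FindWitness.ends_decider`).
-/

namespace CompReach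

/-! ### Total correctness with a time bound -/

/-- Started in `s`, the statement `c` halts within time `T`, in a state that satisfies `P`. -/
def Ends (procs : List Stmt) (c : Stmt) (s : State) (T : ℕ) (P : State → Prop) : Prop :=
  ∃ t s', Exec procs c s t s' ∧ t ≤ T ∧ P s'

/-- The registers that a statement may write, calls not counted. -/
def Stmt.regs : Stmt → List ℕ
  | skip => []
  | set x _ => [x]
  | put _ _ _ _ => []
  | seq c d => c.regs ++ d.regs
  | ite _ c d => c.regs ++ d.regs
  | .while _ c => c.regs
  | call _ => []

/-- The arrays that a statement may write, calls not counted. -/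
def Stmt.arrays : Stmt → List ℕ
  | skip => []
  | set _ _ => []
  | put a _ _ _ => [a]
  | seq c d => c.arrays ++ d.arrays
  | ite _ c d => c.arrays ++ d.arrays
  | .while _ c => c.arrays
  | call _ => []

/-- Does the statement contain no call? -/
def Stmt.callFree : Stmt → Bool
  | seq c d => c.callFree && d.callFree
  | ite _ c d => c.callFree && d.callFree
  | .while _ c => c.callFree
  | call _ => false
  | _ => true

/-- `s'` agrees with `s` wherever the statement `c` does not write. -/
structure Unchanged (c : Stmt) (s s' : State) : Prop where
  reg : ∀ x, x ∉ c.regs → s'.reg x = s.reg x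
  mem : ∀ b, b ∉ c.arrays → s'.mem b = s.mem b

theorem Unchanged.refl (c : Stmt) (s : State) : Unchanged c s s :=
  ⟨fun _ _ => rfl, fun _ _ => rfl⟩

theorem Unchanged.trans {c : Stmt} {s₁ s₂ s₃ : State} (h : Unchanged c s₁ s₂)
    (h' : Unchanged c s₂ s₃) : Unchanged c s₁ s₃ :=
  ⟨fun x hx => (h'.reg x hx).trans (h.reg x hx), fun b hb => (h'.mem b hb).trans (h.mem b hb)⟩

theorem Unchanged.weaken {c d : Stmt} {s s' : State} (h : Unchanged c s s')
    (hr : c.regs ⊆ d.regs) (ha : c.arrays ⊆ d.arrays) : Unchanged d s s' :=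
  ⟨fun x hx => h.reg x fun hx' => hx (hr hx'), fun b hb => h.mem b fun hb' => hb (ha hb')⟩

theorem Exec.unchanged {procs : List Stmt} {c : Stmt} {s s' : State} {t : ℕ}
    (h : Exec procs c s t s') (hc : c.callFree = true) : Unchanged c s s' := by
  induction h with
  | skip | while_false => exact .refl _ _
  | set x e s =>
    refine ⟨fun y hy => ?_, fun _ _ => rfl⟩
    have : y ≠ x := by simpa [Stmt.regs] using hy
    simp [State.setReg, this]
  | put a i j e s =>
    refine ⟨fun _ _ => rfl, fun b hb => ?_⟩
    have : b ≠ a := by simpa [Stmt.arrays] using hb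
    funext p q
    simp [State.setMem, this]
  | seq _ _ ih₁ ih₂ =>
    simp only [Stmt.callFree, Bool.and_eq_true] at hc
    exact ((ih₁ hc.1).weaken (by simp [Stmt.regs]) (by simp [Stmt.arrays])).trans
      ((ih₂ hc.2).weaken (by simp [Stmt.regs]) (by simp [Stmt.arrays]))
  | ite_true _ _ ih =>
    simp only [Stmt.callFree, Bool.and_eq_true] at hc
    exact (ih hc.1).weaken (by simp [Stmt.regs]) (by simp [Stmt.arrays])
  | ite_false _ _ ih =>
    simp only [Stmt.callFree, Bool.and_eq_true] at hc
    exact (ih hc.2).weaken (by simp [Stmt.regs]) (by simp [Stmt.arrays])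
  | while_true _ _ _ ih₁ ih₂ =>
    exact ((ih₁ hc).weaken (d := .while _ _) (by simp [Stmt.regs]) (by simp [Stmt.arrays])).trans
      (ih₂ hc)
  | call => simp [Stmt.callFree] at hc

section Rules

variable {procs : List Stmt} {c d : Stmt} {s : State} {T T₁ T₂ : ℕ} {P Q : State → Prop}

theorem Ends.mono {T' : ℕ} {P' : State → Prop} (h : Ends procs c s T P) (hT : T ≤ T')
    (hP : ∀ s', P s' → P' s') : Ends procs c s T' P' := by
  obtain ⟨t, s', h₁, h₂, h₃⟩ := h
  exact ⟨t, s', h₁, h₂.trans hT, hP _ h₃⟩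

theorem Ends.le {T' : ℕ} (h : Ends procs c s T P) (hT : T ≤ T') : Ends procs c s T' P :=
  h.mono hT fun _ => id

/-- The frame rule. -/
theorem Ends.frame (h : Ends procs c s T P) (hc : c.callFree = true) :
    Ends procs c s T fun s' => P s' ∧ Unchanged c s s' := by
  obtain ⟨t, s', h₁, h₂, h₃⟩ := h
  exact ⟨t, s', h₁, h₂, h₃, h₁.unchanged hc⟩

theorem Ends.seq (h : Ends procs c s T₁ Q) (h' : ∀ s', Q s' → Ends procs d s' T₂ P) :
    Ends procs (.seq c d) s (T₁ + T₂) P := by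
  obtain ⟨t₁, s₁, h₁, h₂, h₃⟩ := h
  obtain ⟨t₂, s₂, k₁, k₂, k₃⟩ := h' _ h₃
  exact ⟨_, _, .seq h₁ k₁, by omega, k₃⟩

theorem Exec.pos {s' : State} {t : ℕ} (h : Exec procs c s t s') : 0 < t := by
  induction h <;> omega

/-- The rule for blocks, with the frame built in; the time left over is passed on. -/
theorem Ends.cons {l : List Stmt} (hc : c.callFree = true) (h : Ends procs c s T₁ Q)
    (h' : ∀ s', Q s' → Unchanged c s s' → Ends procs (block (d :: l)) s' (T - T₁) P) :
    Ends procs (block (c :: d :: l)) s T P := by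
  obtain ⟨t₁, s₁, ⟨h₁, h₂, h₃, h₄⟩⟩ := h.frame hc
  obtain ⟨t₂, s₂, k₁, k₂, k₃⟩ := h' s₁ h₃ h₄
  have := k₁.pos
  exact ⟨_, _, .seq h₁ k₁, by omega, k₃⟩

/-- The rule for blocks whose first statement may contain calls. -/
theorem Ends.cons_call {l : List Stmt} (h : Ends procs c s T₁ Q)
    (h' : ∀ s', Q s' → Ends procs (block (d :: l)) s' (T - T₁) P) :
    Ends procs (block (c :: d :: l)) s T P := by
  obtain ⟨t₁, s₁, h₁, h₂, h₃⟩ := h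
  obtain ⟨t₂, s₂, k₁, k₂, k₃⟩ := h' s₁ h₃
  have := k₁.pos
  exact ⟨_, _, .seq h₁ k₁, by omega, k₃⟩

theorem Ends.ite {b : Cond} (h : b.Holds s → Ends procs c s T P)
    (h' : ¬ b.Holds s → Ends procs d s T P) : Ends procs (.ite b c d) s (b.cost + T + 1) P := by
  by_cases hb : b.Holds s
  · obtain ⟨t, s', h₁, h₂, h₃⟩ := h hb
    exact ⟨_, _, .ite_true hb h₁, by omega, h₃⟩
  · obtain ⟨t, s', h₁, h₂, h₃⟩ := h' hb
    exact ⟨_, _, .ite_false hb h₁, by omega, h₃⟩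

theorem Ends.while_true {b : Cond} (hb : b.Holds s) (h : Ends procs c s T₁ Q)
    (h' : ∀ s', Q s' → Ends procs (.while b c) s' T₂ P) :
    Ends procs (.while b c) s (b.cost + T₁ + T₂ + 1) P := by
  obtain ⟨t₁, s₁, h₁, h₂, h₃⟩ := h
  obtain ⟨t₂, s₂, k₁, k₂, k₃⟩ := h' _ h₃
  exact ⟨_, _, .while_true hb h₁ k₁, by omega, k₃⟩

theorem Ends.while_false {b : Cond} (hb : ¬ b.Holds s) (h : P s) :
    Ends procs (.while b c) s (b.cost + 1) P :=
  ⟨_, _, .while_false hb, le_rfl, h⟩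

theorem Ends.skip (h : P s) : Ends procs .skip s 1 P :=
  ⟨_, _, .skip s, le_rfl, h⟩

theorem Ends.set (x : ℕ) (e : Expr) :
    Ends procs (.set x e) s (e.cost + 1) fun s' => s' = s.setReg x (e.eval s) :=
  ⟨_, _, .set x e s, le_rfl, rfl⟩

theorem Ends.set_reg (x : ℕ) (e : Expr) :
    Ends procs (.set x e) s (e.cost + 1) fun s' => s'.reg x = e.eval s :=
  ⟨_, _, .set x e s, le_rfl, by simp [State.setReg]⟩

theorem Ends.call {p : ℕ} (hp : procs[p]? = some c) (h : Ends procs c s T P) :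
    Ends procs (.call p) s (T + 1) P := by
  obtain ⟨t, s', h₁, h₂, h₃⟩ := h
  exact ⟨_, _, .call hp h₁, by omega, h₃⟩

/-- The rule for counting loops; `I m` holds after `m` rounds. -/
theorem Ends.for_ {x : ℕ} {e : Expr} (N : ℕ) (I : ℕ → State → Prop) (h0 : I 0 (s.setReg x 0))
    (he : ∀ m s', I m s' → e.eval s' = N) (hx : ∀ m s', I m s' → s'.reg x = m)
    (hstep : ∀ m < N, ∀ s', I m s' →
      Ends procs c s' T fun s'' => s''.reg x = m ∧ I (m + 1) (s''.setReg x (m + 1))) :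
    Ends procs (for_ x e c) s (N * (T + e.cost + 6) + e.cost + 5) (I N) := by
  have key : ∀ l m s', m + l = N → I m s' →
      Ends procs (.while (.lt (.var x) e) (.seq c (.set x (.succ (.var x))))) s'
        (l * (T + e.cost + 6) + e.cost + 3) (I N) := by
    intro l
    induction l with
    | zero =>
      intro m s' hm hI
      obtain rfl : m = N := by omega
      refine (Ends.while_false ?_ hI).le ?_
      · simp [Cond.Holds, Expr.eval, he _ _ hI, hx _ _ hI]
      · simp [Cond.cost, Expr.cost]; omega
    | succ l ih =>
      intro m s' hm hI
      have hb : (Cond.lt (.var x) e).Holds s' := by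
        simp [Cond.Holds, Expr.eval, he _ _ hI, hx _ _ hI]; omega
      refine (Ends.while_true hb ((hstep m (by omega) s' hI).seq (P := I (m + 1)) (T₂ := 3)
        fun s₁ h₁ => ?_) fun s₂ h₂ => ih (m + 1) s₂ (by omega) h₂).le ?_
      · refine (Ends.set x _).mono (by simp [Expr.cost]) ?_
        rintro _ rfl
        simpa [Expr.eval, h₁.1] using h₁.2
      · simp only [Cond.cost, Expr.cost]; ring_nf; omega
  refine ((Ends.set x (.lit 0)).seq (T₂ := N * (T + e.cost + 6) + e.cost + 3) ?_).le ?_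
  · rintro _ rfl
    exact key N 0 _ (by omega) h0
  · simp only [Expr.cost]; omega

/-- The rule for counting loops up to the content of a register, with the frame built in. -/
theorem Ends.for_var {x y : ℕ} (N : ℕ) (I : ℕ → State → Prop) (hc : c.callFree = true)
    (hx : x ∉ c.regs) (hy : y ∉ c.regs) (hxy : y ≠ x) (hN : s.reg y = N)
    (h0 : I 0 (s.setReg x 0))
    (hstep : ∀ m < N, ∀ s', s'.reg x = m → Unchanged (CompReach.for_ x (.var y) c) s s' → I m s' →
      Ends procs c s' T fun s'' => I (m + 1) (s''.setReg x (m + 1))) :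
    Ends procs (CompReach.for_ x (.var y) c) s (N * (T + 7) + 6) (I N) := by
  refine (Ends.for_ (T := T) N (fun m s' => I m s' ∧ s'.reg x = m ∧
    Unchanged (CompReach.for_ x (.var y) c) s s') ⟨h0, by simp [State.setReg], ?_⟩ ?_
    (fun _ _ h => h.2.1) ?_).mono (by simp [Expr.cost]) fun _ h => h.1
  · exact ⟨fun z hz => by
      have : z ≠ x := fun h => hz (by simp [CompReach.for_, Stmt.regs, h])
      simp [State.setReg, this], fun _ _ => rfl⟩
  · intro m s' h
    rw [Expr.eval, h.2.2.reg y (by simp [CompReach.for_, Stmt.regs, hxy, hy]), hN]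
  · intro m hm s' ⟨hI, hr, hu⟩
    refine ((hstep m hm s' hr hu hI).frame hc).mono le_rfl fun s'' h => ?_
    refine ⟨(h.2.reg x hx).trans hr, h.1, by simp [State.setReg],
      hu.trans ⟨fun z hz => ?_, fun b hb => ?_⟩⟩
    · simp only [CompReach.for_, Stmt.regs, List.mem_append, List.mem_singleton, not_or] at hz
      simp only [State.setReg, hz.1, if_false]
      exact h.2.reg z hz.2.1
    · exact h.2.mem b fun h => hb (by simp [CompReach.for_, Stmt.arrays, h])

end Rules

/-! ### Statements without loops and calls -/

/-- Is the statement free of loops and calls? -/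
def Stmt.simple : Stmt → Bool
  | seq c d => c.simple && d.simple
  | ite _ c d => c.simple && d.simple
  | .while _ _ => false
  | call _ => false
  | _ => true

open Classical in
/-- The effect of a statement that is free of loops and calls. -/
noncomputable def Stmt.eff : Stmt → State → State
  | set x e, s => s.setReg x (e.eval s)
  | put a i j e, s => s.setMem a (i.eval s) (j.eval s) (e.eval s)
  | seq c d, s => d.eff (c.eff s)
  | ite b c d, s => if b.Holds s then c.eff s else d.eff s
  | _, s => s

/-- A bound for the running time of a statement that is free of loops and calls. -/
def Stmt.bound : Stmt → ℕ
  | set _ e => e.cost + 1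
  | put _ i j e => i.cost + j.cost + e.cost + 1
  | seq c d => c.bound + d.bound
  | ite b c d => b.cost + max c.bound d.bound + 1
  | _ => 1

theorem Ends.of_simple {procs : List Stmt} {c : Stmt} (hc : c.simple = true) (s : State) :
    Ends procs c s c.bound fun s' => s' = c.eff s := by
  induction c generalizing s with
  | skip => exact Ends.skip rfl
  | set x e => exact Ends.set x e
  | put a i j e => exact ⟨_, _, .put a i j e s, le_rfl, rfl⟩
  | seq c d ih₁ ih₂ =>
    simp only [Stmt.simple, Bool.and_eq_true] at hc
    refine (ih₁ hc.1 s).seq ?_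
    rintro _ rfl
    exact ih₂ hc.2 _
  | ite b c d ih₁ ih₂ =>
    simp only [Stmt.simple, Bool.and_eq_true] at hc
    refine Ends.ite (fun hb => ?_) fun hb => ?_
    · exact (ih₁ hc.1 s).mono (le_max_left _ _) fun s' h => by simp [Stmt.eff, hb, h]
    · exact (ih₂ hc.2 s).mono (le_max_right _ _) fun s' h => by simp [Stmt.eff, hb, h]
  | _ => simp [Stmt.simple] at hc

theorem Stmt.callFree_of_simple {c : Stmt} (hc : c.simple = true) : c.callFree = true := by
  induction c with
  | seq c d ih₁ ih₂ | ite b c d ih₁ ih₂ =>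
    simp only [Stmt.simple, Bool.and_eq_true] at hc
    simp [Stmt.callFree, ih₁ hc.1, ih₂ hc.2]
  | skip | set | put => rfl
  | _ => simp [Stmt.simple] at hc

/-- The rule for counting loops with a body that is free of loops and calls. -/
theorem Ends.for_simple {procs : List Stmt} {c : Stmt} {s : State} {x y : ℕ} (N : ℕ)
    (I : ℕ → State → Prop) (hc : c.simple = true)
    (hx : x ∉ c.regs) (hy : y ∉ c.regs) (hxy : y ≠ x) (hN : s.reg y = N)
    (h0 : I 0 (s.setReg x 0))
    (hstep : ∀ m < N, ∀ s', s'.reg x = m → Unchanged (CompReach.for_ x (.var y) c) s s' → I m s' →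
      I (m + 1) ((c.eff s').setReg x (m + 1))) :
    Ends procs (CompReach.for_ x (.var y) c) s (N * (c.bound + 7) + 6) (I N) := by
  refine Ends.for_var N I (Stmt.callFree_of_simple hc) hx hy hxy hN h0 fun m hm s' h₁ h₂ h₃ => ?_
  refine (Ends.of_simple hc s').mono le_rfl ?_
  rintro _ rfl
  exact hstep m hm s' h₁ h₂ h₃

/-! ### Extending words -/

section Extending

variable {Q A : Type*} {M : SemiAutomaton Q A} {S T T' : Finset Q} {f g : Q → Q}

theorem SemiAutomaton.run_append (M : SemiAutomaton Q A) (q : Q) (v w : List A) :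
    M.run q (v ++ w) = M.run (M.run q v) w :=
  List.foldl_append

/-- The transformation `f` is induced by a word, and `S` is contained in its range, so that the
preimage of `S` under `f` is a predecessor of `S` with respect to that word. -/
structure IsPredecessor (M : SemiAutomaton Q A) (S : Finset Q) (f : Q → Q) : Prop where
  induced : ∃ w, ∀ q, f q = M.run q w
  surj : ∀ p ∈ S, ∃ q, f q = p

theorem IsPredecessor.id : IsPredecessor M S id :=
  ⟨⟨[], fun _ => rfl⟩, fun p _ => ⟨p, rfl⟩⟩

theorem IsPredecessor.subset (hf : IsPredecessor M S f) (h : T ⊆ S) : IsPredecessor M T f :=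
  ⟨hf.induced, fun p hp => hf.surj p (h hp)⟩

variable [Fintype Q] [DecidableEq Q]

/-- The preimage of a set of states under a transformation of the states. -/
def pre (f : Q → Q) (S : Finset Q) : Finset Q :=
  Finset.univ.filter fun q => f q ∈ S

@[simp] theorem mem_pre {q : Q} : q ∈ pre f S ↔ f q ∈ S := by
  simp [pre]

/-- The transformation `f` is induced by a properly extending word of `S`. -/
structure Extends (M : SemiAutomaton Q A) (S : Finset Q) (f : Q → Q) : Prop
    extends IsPredecessor M S f where
  card : S.card < (pre f S).card

/-- The set `S` has a properly extending word. -/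
def Extendable (M : SemiAutomaton Q A) (S : Finset Q) : Prop :=
  ∃ f, Extends M S f

theorem image_pre (h : ∀ p ∈ S, ∃ q, f q = p) : (pre f S).image f = S := by
  ext p
  simp only [Finset.mem_image, mem_pre]
  constructor
  · rintro ⟨q, hq, rfl⟩
    exact hq
  · intro hp
    obtain ⟨q, rfl⟩ := h p hp
    exact ⟨q, hp, rfl⟩

theorem card_le_card_pre (h : ∀ p ∈ S, ∃ q, f q = p) : S.card ≤ (pre f S).card := by
  conv_lhs => rw [← image_pre h]
  exact Finset.card_image_le

/-- If the preimage of a set in the range is not larger, then `f` is injective on it. -/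
theorem injOn_pre (h : ∀ p ∈ S, ∃ q, f q = p) (hc : (pre f S).card ≤ S.card) {q q' : Q}
    (hq : f q ∈ S) (hqq : f q = f q') : q = q' := by
  have : Set.InjOn f (pre f S) := Finset.card_image_iff.1 <| by
    rw [image_pre h]
    exact le_antisymm (card_le_card_pre h) hc
  exact this (by simpa using hq) (by simpa using hqq ▸ hq) hqq

theorem IsPredecessor.comp (hf : IsPredecessor M S f) (hg : IsPredecessor M (pre f S) g) :
    IsPredecessor M S (f ∘ g) := by
  obtain ⟨v, hv⟩ := hf.induced
  obtain ⟨w, hw⟩ := hg.induced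
  refine ⟨⟨w ++ v, fun q => ?_⟩, fun p hp => ?_⟩
  · rw [M.run_append, Function.comp, hv, hw]
  · obtain ⟨q, rfl⟩ := hf.surj p hp
    obtain ⟨r, rfl⟩ := hg.surj q (by simpa using hp)
    exact ⟨r, rfl⟩

theorem pre_comp : pre (f ∘ g) S = pre g (pre f S) := by
  ext; simp

/-- A word that extends a predecessor of `S`, followed by the word that leads from the predecessor
to `S`, extends `S`. -/
theorem IsPredecessor.extends_comp (hf : IsPredecessor M S f)
    (hg : Extends M (pre f S) g) : Extends M S (f ∘ g) :=
  ⟨hf.comp hg.1, (card_le_card_pre hf.surj).trans_lt (by rw [pre_comp]; exact hg.card)⟩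

/-- A word that properly extends a union properly extends one of the two sets: the preimages of the
two sets have a larger union, and their intersection is at least as large as that of the sets. -/
theorem Extends.of_union (h : Extends M (T ∪ T') f) :
    Extends M T f ∨ Extends M T' f := by
  by_cases h₁ : T.card < (pre f T).card
  · exact .inl ⟨h.subset Finset.subset_union_left, h₁⟩
  refine .inr ⟨h.subset Finset.subset_union_right, ?_⟩
  have h₂ := card_le_card_pre (h.subset
    ((Finset.inter_subset_left (s₁ := T) (s₂ := T')).trans Finset.subset_union_left)).surj
  have h₃ := Finset.card_union_add_card_inter T T'
  have h₄ := Finset.card_union_add_card_inter (pre f T) (pre f T')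
  have h₅ : pre f T ∪ pre f T' = pre f (T ∪ T') := by ext; simp
  have h₆ : pre f T ∩ pre f T' = pre f (T ∩ T') := by ext; simp
  rw [h₅, h₆] at h₄
  have := h.card
  omega

/-- A word with image `S ≠ univ` maps all states into `S`, so that it properly extends `S`. -/
theorem not_reachable_of_not_extendable (h : ¬ Extendable M S) (hS : S ≠ Finset.univ) :
    ¬ M.Reachable S := by
  rintro ⟨w, hw⟩
  refine h ⟨fun q => M.run q w, ⟨⟨w, fun _ => rfl⟩, fun p hp => ?_⟩, ?_⟩
  · rw [← hw] at hp
    simpa [SemiAutomaton.image] using hp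
  · refine Finset.card_lt_card ((Finset.ssubset_univ_iff.2 hS).trans_eq ?_)
    ext q
    simp [← hw, SemiAutomaton.image]

/-- If all proper sets that are not smaller than `S` are extendable, then `S` is reachable. -/
theorem reachable_of_extendable
    (h : ∀ T : Finset Q, T ≠ Finset.univ → S.card ≤ T.card → Extendable M T) :
    M.Reachable S := by
  -- Induction on the size of the complement, which is smaller for a properly extended predecessor.
  induction hm : Fintype.card Q - S.card using Nat.strong_induction_on generalizing S with
  | _ m ih =>
    by_cases hS : S = Finset.univ
    · exact ⟨[], by simp [hS, SemiAutomaton.image, SemiAutomaton.run]⟩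
    obtain ⟨f, hf⟩ := h S hS le_rfl
    obtain ⟨v, hv⟩ := hf.induced
    have h₁ := hf.card
    have h₂ := Finset.card_le_univ (pre f S)
    obtain ⟨w, hw⟩ := ih _ (by omega) (S := pre f S) (fun T hT hc => h T hT (by omega)) rfl
    refine ⟨w ++ v, ?_⟩
    rw [← image_pre hf.surj, ← hw]
    ext p
    simp [SemiAutomaton.image, M.run_append, hv]

/-- The states of `S` with exactly one preimage. -/
def reduct (S : Finset Q) (f : Q → Q) : Finset Q :=
  S.filter fun p => (Finset.univ.filter fun q => f q = p).card = 1

/-- If every state of `S` had exactly one preimage, then the preimage of `S` would not be larger. -/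
theorem Extends.card_reduct_lt (h : Extends M S f) : (reduct S f).card < S.card := by
  refine Finset.card_lt_card (Finset.filter_ssubset.2 ?_)
  by_contra! hc
  have h₁ : (pre f S).card = ∑ p ∈ S, (Finset.univ.filter fun q => f q = p).card := by
    rw [Finset.card_eq_sum_card_fiberwise (f := f) (t := S) (by intro q; simp)]
    refine Finset.sum_congr rfl fun p hp => congrArg _ ?_
    ext q
    simp only [Finset.mem_filter, mem_pre, Finset.mem_univ, true_and, and_iff_right_iff_imp]
    rintro rfl
    exact hp
  rw [Finset.sum_congr rfl hc] at h₁
  have := h.card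
  simp at h₁
  omega

/-- The sets without properly extending words survive the passage from `S` to its reduct. -/
theorem Extends.subset_reduct (h : Extends M S f) (hT : T ⊆ S) (hn : ¬ Extendable M T) :
    T ⊆ reduct S f := by
  intro p hp
  have h₁ := h.subset hT
  have h₂ : (pre f T).card ≤ T.card := by
    by_contra! hc
    exact hn ⟨f, h₁, hc⟩
  refine Finset.mem_filter.2 ⟨hT hp, Finset.card_eq_one.2 ?_⟩
  obtain ⟨q, rfl⟩ := h₁.surj p hp
  refine ⟨q, ?_⟩
  ext r
  simp only [Finset.mem_filter, Finset.mem_univ, true_and, Finset.mem_singleton]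
  exact ⟨fun hr => injOn_pre h₁.surj h₂ (hr ▸ hp) hr, fun hr => hr ▸ rfl⟩

end Extending

/-! ### The breadth first search -/

section Search

variable {Q A : Type*} [Fintype Q] [DecidableEq Q] [Fintype A]

/-- The invariant of the search for a properly extending word of `S`.  The entries `i < t` of the
FIFO queue are the words that induce `F i`, together with their predecessors `pre (F i) S` of `S`;
the entries `i < h` have been processed, and those in `E` have been expanded. -/
structure Search (M : SemiAutomaton Q A) (S : Finset Q) (F : ℕ → Q → Q) (E : Finset ℕ)
    (h t : ℕ) : Prop where
  pos : 0 < t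
  zero : F 0 = id
  predecessor : ∀ i < t, IsPredecessor M S (F i)
  lt : ∀ e ∈ E, e < h
  card : ∀ e ∈ E, (pre (F e) S).card = S.card
  disjoint : ∀ e ∈ E, ∀ e' ∈ E, e ≠ e' → ∀ q, q ∈ pre (F e) S ∨ q ∈ pre (F e') S
  cover : ∀ i < h, ∃ e ∈ E, pre (F i) S = pre (F e) S
  closed : ∀ e ∈ E, ∀ a, (∀ p ∈ pre (F e) S, ∃ q, M.step q a = p) →
    ∃ j < t, pre (F j) S = pre (fun q => M.step q a) (pre (F e) S)
  le : h ≤ t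
  tail_le : t ≤ 1 + Fintype.card A * E.card

variable {M : SemiAutomaton Q A} {S : Finset Q} {F F' : ℕ → Q → Q} {E : Finset ℕ} {h t t' : ℕ}

theorem Search.start (h0 : F 0 = id) : Search M S F ∅ 0 1 where
  pos := by simp
  zero := h0
  predecessor i hi := by
    obtain rfl : i = 0 := by omega
    exact h0 ▸ .id
  lt := by simp
  card := by simp
  disjoint := by simp
  cover := by simp
  closed := by simp
  le := by simp
  tail_le := by simp

/-- The complements of the expanded sets are disjoint and of the same size. -/
theorem Search.card_mul_le (H : Search M S F E h t) :
    E.card * (Fintype.card Q - S.card) ≤ Fintype.card Q := by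
  have h₁ : (E.biUnion fun e => (pre (F e) S)ᶜ).card = ∑ e ∈ E, ((pre (F e) S)ᶜ).card := by
    refine Finset.card_biUnion fun e he e' he' hne => ?_
    rw [Function.onFun, Finset.disjoint_left]
    intro q hq hq'
    rw [Finset.mem_compl] at hq hq'
    exact (H.disjoint e he e' he' hne q).elim hq hq'
  rw [Finset.sum_congr rfl fun e he => by rw [Finset.card_compl, H.card e he]] at h₁
  rw [Finset.sum_const, smul_eq_mul] at h₁
  rw [← h₁]
  exact Finset.card_le_univ _

/-- The entry at the front is skipped if the same set has been expanded before. -/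
theorem Search.skip (H : Search M S F E h t) (hlt : h < t)
    (he : ∃ e ∈ E, pre (F h) S = pre (F e) S) : Search M S F E (h + 1) t :=
  { H with
    lt := fun e he => (H.lt e he).trans (Nat.lt_succ_self _)
    cover := fun i hi => by
      rcases Nat.lt_succ_iff_lt_or_eq.1 hi with hi | rfl
      · exact H.cover i hi
      · exact he
    le := hlt }

/-- The entry at the front is expanded if its complement is disjoint from the complements of all
sets expanded before; `F'` and `t'` describe the queue after its predecessors have been pushed. -/
theorem Search.expand (H : Search M S F E h t) (hlt : h < t) (hc : (pre (F h) S).card = S.card)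
    (hd : ∀ e ∈ E, ∀ q, q ∈ pre (F e) S ∨ q ∈ pre (F h) S) (hF : ∀ i < t, F' i = F i)
    (htt : t ≤ t') (htt' : t' ≤ t + Fintype.card A)
    (hp : ∀ i < t', t ≤ i → IsPredecessor M S (F' i))
    (hcl : ∀ a, (∀ p ∈ pre (F h) S, ∃ q, M.step q a = p) →
      ∃ j < t', pre (F' j) S = pre (fun q => M.step q a) (pre (F h) S)) :
    Search M S F' (insert h E) (h + 1) t' := by
  have hE : ∀ e ∈ E, F' e = F e := fun e he => hF e ((H.lt e he).trans hlt)
  have hn : h ∉ E := fun hh => lt_irrefl _ (H.lt h hh)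
  have hh := hF h hlt
  refine ⟨by have := H.pos; omega, by rw [hF 0 H.pos, H.zero], fun i hi => ?_, ?_, ?_, ?_, ?_, ?_,
    by omega, ?_⟩
  · rcases lt_or_ge i t with hi' | hi'
    · exact hF i hi' ▸ H.predecessor i hi'
    · exact hp i hi hi'
  · simp only [Finset.mem_insert, forall_eq_or_imp]
    exact ⟨by omega, fun e he => (H.lt e he).trans (Nat.lt_succ_self _)⟩
  · simp only [Finset.mem_insert, forall_eq_or_imp, hh]
    exact ⟨hc, fun e he => by rw [hE e he]; exact H.card e he⟩
  · intro e he e' he' hne q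
    rcases Finset.mem_insert.1 he with rfl | h₁ <;> rcases Finset.mem_insert.1 he' with rfl | h₂
    · exact absurd rfl hne
    · rw [hh, hE e' h₂]
      exact (hd e' h₂ q).symm
    · rw [hh, hE e h₁]
      exact hd e h₁ q
    · rw [hE e h₁, hE e' h₂]
      exact H.disjoint e h₁ e' h₂ hne q
  · intro i hi
    rcases Nat.lt_succ_iff_lt_or_eq.1 hi with hi | rfl
    · obtain ⟨e, he, hee⟩ := H.cover i hi
      exact ⟨e, Finset.mem_insert_of_mem he, by rw [hF i (hi.trans hlt), hE e he, hee]⟩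
    · exact ⟨i, Finset.mem_insert_self _ _, rfl⟩
  · intro e he a ha
    rcases Finset.mem_insert.1 he with rfl | he
    · rw [hh] at ha ⊢
      exact hcl a ha
    · rw [hE e he] at ha ⊢
      obtain ⟨j, hj, hjj⟩ := H.closed e he a ha
      exact ⟨j, by omega, by rw [hF j hj, hjj]⟩
  · rw [Finset.card_insert_of_notMem hn]
    have := H.tail_le
    rw [Nat.mul_succ]
    omega

/-- If the queue becomes empty, then there is no properly extending word. -/
theorem Search.not_extendable (H : Search M S F E t t) : ¬ Extendable M S := by
  -- By induction on `w`, the preimage of `S` under `w` is one of the expanded sets.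
  have key : ∀ w : List A, (∀ p ∈ S, ∃ q, M.run q w = p) →
      ∃ e ∈ E, pre (fun q => M.run q w) S = pre (F e) S := by
    intro w
    induction w with
    | nil =>
      intro _
      obtain ⟨e, he, hee⟩ := H.cover 0 H.pos
      exact ⟨e, he, by rw [← hee, H.zero]; rfl⟩
    | cons a w ih =>
      intro hs
      have hw : ∀ p ∈ S, ∃ q, M.run q w = p := fun p hp => by
        obtain ⟨q, hq⟩ := hs p hp
        exact ⟨M.step q a, hq⟩
      obtain ⟨e, he, hee⟩ := ih hw
      have hc := H.card e he
      rw [← hee] at hc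
      -- A state of the predecessor is the only one that `w` maps to its image, and so it lies in
      -- the range of the letter `a`.
      obtain ⟨j, hj, hjj⟩ := H.closed e he a fun p hp => by
        rw [← hee, mem_pre] at hp
        obtain ⟨q, hq⟩ := hs _ hp
        refine ⟨q, injOn_pre (f := fun q => M.run q w) hw hc.le ?_ hq⟩
        change M.run q (a :: w) ∈ S
        rwa [hq]
      obtain ⟨e', he', hee'⟩ := H.cover j hj
      refine ⟨e', he', ?_⟩
      rw [← hee', hjj, ← hee, ← pre_comp]
      rfl
  rintro ⟨f, hf⟩
  obtain ⟨w, hw⟩ := hf.induced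
  obtain rfl : f = fun q => M.run q w := funext hw
  obtain ⟨e, he, hee⟩ := key w hf.surj
  have := hf.card
  rw [hee, H.card e he] at this
  exact lt_irrefl _ this

end Search

/-! ### Sets and transformations as rows of arrays -/

/-- Row `r` of array `b` is the characteristic function of the set `T`. -/
def IsSet {N : ℕ} (s : State) (b r : ℕ) (T : Finset (Fin N)) : Prop :=
  ∀ p : Fin N, s.mem b r p = if p ∈ T then 1 else 0

/-- Row `r` of array `b` lists the values of the transformation `f`. -/
def IsMap {N : ℕ} (s : State) (b r : ℕ) (f : Fin N → Fin N) : Prop :=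
  ∀ p : Fin N, s.mem b r p = f p

theorem card_filter_range {N : ℕ} {P : ℕ → Prop} [DecidablePred P] {T : Finset (Fin N)}
    (h : ∀ p : Fin N, P p ↔ p ∈ T) : ((Finset.range N).filter P).card = T.card := by
  rw [← Finset.card_map Fin.valEmbedding]
  congr 1
  ext j
  simp only [Finset.mem_filter, Finset.mem_range, Finset.mem_map, Fin.valEmbedding_apply]
  constructor
  · rintro ⟨hj, hP⟩
    exact ⟨⟨j, hj⟩, (h ⟨j, hj⟩).1 hP, rfl⟩
  · rintro ⟨p, hp, rfl⟩
    exact ⟨p.2, (h p).2 hp⟩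

theorem card_filter_range_succ (P : ℕ → Prop) [DecidablePred P] (m : ℕ) :
    ((Finset.range (m + 1)).filter P).card =
      ((Finset.range m).filter P).card + if P m then 1 else 0 := by
  rw [Finset.range_add_one, Finset.filter_insert]
  split_ifs
  · rw [Finset.card_insert_of_notMem (by simp)]
  · rfl

namespace FindWitness

variable {procs : List Stmt} {N K : ℕ} {s : State}

/-- The rule for the loops over all states that fill a row of an array. -/
theorem ends_fill {c : Stmt} (b r : ℕ) (v : ℕ → ℕ) (hc : c.simple = true)
    (hq : q ∉ c.regs) (hn : n ∉ c.regs) (hN : s.reg n = N)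
    (h : ∀ m < N, ∀ s', s'.reg q = m → Unchanged (forStates c) s s' →
      (∀ i j, s'.mem b i j = if i = r ∧ j < m then v j else s.mem b i j) →
      ∀ i j, (c.eff s').mem b i j = if i = r ∧ j = m then v m else s'.mem b i j) :
    Ends procs (forStates c) s (N * (c.bound + 7) + 6) fun s' =>
      ∀ i j, s'.mem b i j = if i = r ∧ j < N then v j else s.mem b i j := by
  refine Ends.for_simple N
    (fun m s' => ∀ i j, s'.mem b i j = if i = r ∧ j < m then v j else s.mem b i j)
    hc hq hn (by decide) hN (by simp [State.setReg]) fun m hm s' h₁ h₂ h₃ i j => ?_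
  simp only [State.setReg, h m hm s' h₁ h₂ h₃ i j, h₃ i j]
  by_cases hi : i = r <;> by_cases hj : j = m <;> simp [hi, hj, le_iff_lt_or_eq]

/-- The rule for the loops over all states that count in register `x`. -/
theorem ends_count {e : Cond} (x : ℕ) (P : ℕ → Prop) [DecidablePred P] (hxq : x ≠ q) (hxn : x ≠ n)
    (hN : s.reg n = N) (hx : s.reg x = 0)
    (h : ∀ m < N, ∀ s', s'.reg q = m →
      Unchanged (forStates (when e (.set x (.succ (.var x))))) s s' → (e.Holds s' ↔ P m)) :
    Ends procs (forStates (when e (.set x (.succ (.var x))))) s (N * (e.cost + 11) + 6) fun s' =>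
      s'.reg x = ((Finset.range N).filter P).card := by
  refine (Ends.for_simple N (fun m s' => s'.reg x = ((Finset.range m).filter P).card)
    rfl (by simpa [when, Stmt.regs] using hxq.symm) (by simpa [when, Stmt.regs] using hxn.symm)
    (by decide) hN (by simp [State.setReg, hxq, hx]) fun m hm s' h₁ h₂ h₃ => ?_).le
    (by simp [when, Stmt.bound, Expr.cost])
  rw [card_filter_range_succ]
  simp only [when, Stmt.eff, h m hm s' h₁ h₂]
  split_ifs with hP <;> simp [State.setReg, hxq, h₃, Expr.eval]

/-- The rule for the loops over all states that turn register `x` from `1` to `0`. -/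
theorem ends_flag {e : Cond} (x : ℕ) (P : ℕ → Prop) (hxq : x ≠ q) (hxn : x ≠ n)
    (hN : s.reg n = N) (hx : s.reg x = 1)
    (h : ∀ m < N, ∀ s', s'.reg q = m →
      Unchanged (forStates (when e (.set x (.lit 0)))) s s' → (e.Holds s' ↔ ¬ P m)) :
    Ends procs (forStates (when e (.set x (.lit 0)))) s (N * (e.cost + 10) + 6) fun s' =>
      ((∀ m < N, P m) ∧ s'.reg x = 1) ∨ ((¬ ∀ m < N, P m) ∧ s'.reg x = 0) := by
  refine (Ends.for_simple N
    (fun l s' => ((∀ m < l, P m) ∧ s'.reg x = 1) ∨ ((¬ ∀ m < l, P m) ∧ s'.reg x = 0))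
    rfl (by simpa [when, Stmt.regs] using hxq.symm) (by simpa [when, Stmt.regs] using hxn.symm)
    (by decide) hN (by simp [State.setReg, hxq, hx]) fun m hm s' h₁ h₂ h₃ => ?_).le
    (by simp [when, Stmt.bound, Expr.cost])
  have he := h m hm s' h₁ h₂
  by_cases hP : P m
  · have he : ¬ e.Holds s' := by simpa [hP] using he
    have : (∀ l < m + 1, P l) ↔ ∀ l < m, P l :=
      ⟨fun h l hl => h l (by omega), fun h l hl => (Nat.lt_succ_iff_lt_or_eq.1 hl).elim (h l)
        fun hl => hl ▸ hP⟩
    rw [this]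
    simpa only [when, Stmt.eff, he, if_false, State.setReg, hxq] using h₃
  · have he : e.Holds s' := he.2 hP
    right
    refine ⟨fun h => hP (h m (Nat.lt_succ_self m)), ?_⟩
    simp only [when, Stmt.eff, he, if_true, State.setReg, hxq, if_false, Expr.eval]

theorem ends_card {T : Finset (Fin N)} (x b r : ℕ) (e : Expr) (hxq : x ≠ q) (hxn : x ≠ n)
    (hN : s.reg n = N) (hT : IsSet s b r T)
    (he : ∀ s', Unchanged (card x b e) s s' → e.eval s' = r) :
    Ends procs (card x b e) s (N * (e.cost + 15) + 8) fun s' => s'.reg x = T.card := by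
  refine Ends.cons rfl (Ends.set_reg x _) fun s₁ h₁ u₁ => ?_
  refine (ends_count (N := N) x (fun m => s.mem b r m = 1) hxq hxn ?_
    (by simpa [Expr.eval] using h₁) fun m hm s' h₂ u₂ => ?_).mono
    (by simp [Cond.cost, Expr.cost]) fun s' h₃ => ?_
  · rw [u₁.reg n (by simpa [Stmt.regs] using hxn.symm), hN]
  · have u : Unchanged (card x b e) s s' := (u₁.weaken (by simp [card, block, Stmt.regs])
      (by simp [Stmt.arrays])).trans
      (u₂.weaken (by simp [card, block, Stmt.regs]) (by simp [card, block, Stmt.arrays]))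
    simp only [Cond.Holds, Expr.eval, he s' u, h₂]
    rw [u.mem b (by simp [card, block, Stmt.arrays, forStates, for_, when])]
  · rw [h₃]
    exact card_filter_range fun p => by simp [hT p]

theorem ends_copy (b r b' r' : ℕ) (e e' : Expr) (hN : s.reg n = N)
    (he : ∀ s', Unchanged (copy b e b' e') s s' → e.eval s' = r)
    (he' : ∀ s', Unchanged (copy b e b' e') s s' → e'.eval s' = r') :
    Ends procs (copy b e b' e') s (N * (e.cost + e'.cost + 11) + 6) fun s' =>
      ∀ i j, s'.mem b i j = if i = r ∧ j < N then s.mem b' r' j else s.mem b i j := by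
  refine (ends_fill b r (fun j => s.mem b' r' j) rfl (by simp [Stmt.regs]) (by simp [Stmt.regs])
    hN fun m hm s' h₁ u h₃ i j => ?_).le (by simp [Stmt.bound, Expr.cost]; ring_nf; omega)
  have : s'.mem b' r' m = s.mem b' r' m := by
    by_cases hb : b' = b
    · subst hb
      simp [h₃]
    · rw [u.mem b' (by simpa [forStates, for_, Stmt.arrays] using hb)]
  simp [Stmt.eff, Expr.eval, he s' u, he' s' u, h₁, State.setMem, this]

theorem ends_compare {T T' : Finset (Fin N)} (x b r r' : ℕ) (e e' : Expr) (hxq : x ≠ q)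
    (hxn : x ≠ n) (hN : s.reg n = N) (hT : IsSet s b r T) (hT' : IsSet s b r' T')
    (he : ∀ s', Unchanged (compare x b e e') s s' → e.eval s' = r)
    (he' : ∀ s', Unchanged (compare x b e e') s s' → e'.eval s' = r') :
    Ends procs (compare x b e e') s (N * (e.cost + e'.cost + 16) + 8) fun s' =>
      (T = T' ∧ s'.reg x = 1) ∨ (T ≠ T' ∧ s'.reg x = 0) := by
  refine Ends.cons rfl (Ends.set_reg x _) fun s₁ h₁ u₁ => ?_
  refine (ends_flag (N := N) x (fun m => s.mem b r m = s.mem b r' m) hxq hxn ?_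
    (by simpa [Expr.eval] using h₁)
    fun m hm s' h₂ u₂ => ?_).mono (by simp [Cond.cost, Expr.cost]; ring_nf; omega) fun s' h₃ => ?_
  · rw [u₁.reg n (by simpa [Stmt.regs] using hxn.symm), hN]
  · have u : Unchanged (compare x b e e') s s' := (u₁.weaken (by simp [compare, block, Stmt.regs])
      (by simp [Stmt.arrays])).trans
      (u₂.weaken (by simp [compare, block, Stmt.regs]) (by simp [compare, block, Stmt.arrays]))
    simp only [Cond.Holds, Expr.eval, he s' u, he' s' u, h₂]
    rw [u.mem b (by simp [compare, block, Stmt.arrays, forStates, for_, when])]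
  · have : (∀ m < N, s.mem b r m = s.mem b r' m) ↔ T = T' := by
      constructor
      · intro h
        ext p
        have := h p p.2
        rw [hT p, hT' p] at this
        by_cases h₁ : p ∈ T <;> by_cases h₂ : p ∈ T' <;> simp_all
      · rintro rfl m hm
        exact (hT ⟨m, hm⟩).trans (hT' ⟨m, hm⟩).symm
    rwa [this] at h₃

/-! ### The steps of the search without recursion -/

/-- The input of the algorithm is in place. -/
structure Context (M : SemiAutomaton (Fin N) (Fin K)) (s : State) : Prop where
  n : s.reg n = N
  k : s.reg k = K
  delta : ∀ (p : Fin N) (l : Fin K), s.mem delta p l = M.step p l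

theorem Context.of_unchanged {M : SemiAutomaton (Fin N) (Fin K)} {c : Stmt} {s' : State}
    (h : Context M s) (u : Unchanged c s s') (hn : FindWitness.n ∉ c.regs)
    (hk : FindWitness.k ∉ c.regs) (hd : FindWitness.delta ∉ c.arrays) : Context M s' :=
  ⟨by rw [u.reg _ hn, h.n], by rw [u.reg _ hk, h.k], fun p l => by rw [u.mem _ hd, h.delta]⟩

/-- The queue is initialized with the pair of `S` and the empty word. -/
theorem ends_start {S : Finset (Fin N)} {d : ℕ} (hN : s.reg n = N) (hd : s.reg depth = d)
    (hS : IsSet s arg d S) :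
    Ends procs start s (N * 100 + 100) fun s' => s'.reg size = S.card ∧ IsSet s' queueT 0 S ∧
      IsMap (N := N) s' queueW 0 id ∧ (∀ p : Fin N, s'.mem absent 0 p = 0) ∧ s'.reg head = 0 ∧
      s'.reg tail = 1 ∧ s'.reg status = 0 := by
  refine (Ends.cons rfl (ends_card size arg d _ (by decide) (by decide) hN hS
    fun s' u => (u.reg depth (by decide)).trans hd) fun s₁ h₁ u₁ => ?_)
  · refine Ends.cons rfl (ends_copy (N := N) queueT 0 arg d (.lit 0) (.var depth) ?_
      (fun _ _ => rfl) fun s' u => ?_) fun s₂ h₂ u₂ => ?_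
    · simp (disch := decide) only [u₁.reg, hN]
    · simp (disch := decide) only [Expr.eval, u₁.reg, u.reg, hd]
    refine Ends.cons rfl (ends_fill (N := N) queueW 0 (fun j => j) rfl (by decide) (by decide) ?_
      fun m hm s' h u h' i j => ?_) fun s₃ h₃ u₃ => ?_
    · simp (disch := decide) only [u₁.reg, u₂.reg, hN]
    · simp [Stmt.eff, State.setMem, Expr.eval, h]
    refine Ends.cons rfl (ends_fill (N := N) absent 0 (fun j => 0) rfl (by decide) (by decide) ?_
      fun m hm s' h u h' i j => ?_) fun s₄ h₄ u₄ => ?_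
    · simp (disch := decide) only [u₁.reg, u₂.reg, u₃.reg, hN]
    · simp [Stmt.eff, State.setMem, Expr.eval, h]
    refine Ends.cons rfl (Ends.set_reg _ _) fun s₅ h₅ u₅ => ?_
    refine Ends.cons rfl (Ends.set_reg _ _) fun s₆ h₆ u₆ => ?_
    refine ((Ends.set_reg _ _).frame rfl).mono (by simp only [Stmt.bound, Expr.cost]; omega)
      fun s₇ ⟨h₇, u₇⟩ => ?_
    refine ⟨?_, fun p => ?_, fun p => ?_, fun p => ?_, ?_, ?_, h₇⟩
    · simp (disch := decide) only [u₂.reg, u₃.reg, u₄.reg, u₅.reg, u₆.reg, u₇.reg, h₁]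
    · simp (disch := decide) only [u₃.mem, u₄.mem, u₅.mem, u₆.mem, u₇.mem, h₂, u₁.mem]
      simp [hS p]
    · simp (disch := decide) only [u₄.mem, u₅.mem, u₆.mem, u₇.mem, h₃]
      simp
    · simp (disch := decide) only [u₅.mem, u₆.mem, u₇.mem, h₄]
      simp
    · simp (disch := decide) only [u₆.reg, u₇.reg, h₅]
      simp [Expr.eval]
    · simp (disch := decide) only [u₇.reg, h₆]
      simp [Expr.eval]

/-- `hit` becomes an entry of `absent` outside `T` that is not zero, if there is one. -/
theorem ends_lookup {T : Finset (Fin N)} {c : ℕ} (hN : s.reg n = N) (hc : s.reg cur = c)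
    (hT : IsSet s queueT c T) :
    Ends procs lookup s (N * 100 + 100) fun s' =>
      (s'.reg hit = 0 ∧ ∀ p, p ∉ T → s.mem absent 0 p = 0) ∨
      ∃ p, p ∉ T ∧ s.mem absent 0 p ≠ 0 ∧ s'.reg hit = s.mem absent 0 p := by
  refine (Ends.cons rfl (Ends.set_reg _ _) fun s₁ h₁ u₁ => ?_)
  · refine (Ends.for_simple N (fun m s' =>
      (s'.reg hit = 0 ∧ ∀ p : Fin N, p.1 < m → p ∉ T → s.mem absent 0 p = 0) ∨
      ∃ p : Fin N, p ∉ T ∧ s.mem absent 0 p ≠ 0 ∧ s'.reg hit = s.mem absent 0 p)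
      rfl (by decide) (by decide) (by decide) ?_ ?_ ?_).mono
      (by simp [Stmt.bound, when, Cond.cost, Expr.cost]; omega) ?_
    · simp (disch := decide) only [u₁.reg, hN]
    · left
      simpa [State.setReg, Expr.eval] using h₁
    · intro m hm s' h u h'
      have hc' : s'.reg cur = c := by simp (disch := decide) only [u.reg, u₁.reg, hc]
      have hq : s'.mem queueT = s.mem queueT := by simp (disch := decide) only [u.mem, u₁.mem]
      have ha : s'.mem absent = s.mem absent := by simp (disch := decide) only [u.mem, u₁.mem]
      have hTm := hT ⟨m, hm⟩
      simp only at hTm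
      by_cases hm' : ⟨m, hm⟩ ∉ T ∧ s.mem absent 0 m ≠ 0
      · right
        refine ⟨⟨m, hm⟩, hm'.1, hm'.2, ?_⟩
        simp [Stmt.eff, when, Cond.Holds, Expr.eval, h, hc', hq, ha, hTm, hm'.1, hm'.2,
          State.setReg]
      · have : ¬ (s.mem queueT c m = 0 ∧ ¬ s.mem absent 0 m = 0) := by
          rw [hTm]
          by_cases hmT : (⟨m, hm⟩ : Fin N) ∈ T <;> simp_all
        have he : (((when (.and (.eq (.get queueT (.var cur) (.var q)) (.lit 0))
          (.not (.eq (.get absent (.lit 0) (.var q)) (.lit 0))))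
          (.set hit (.get absent (.lit 0) (.var q)))).eff s').setReg q (m + 1)).reg hit
            = s'.reg hit := by
          simp [Stmt.eff, when, Cond.Holds, Expr.eval, h, hc', hq, ha, this, State.setReg]
        rw [he]
        rcases h' with ⟨h₂, h₃⟩ | h₂
        · refine .inl ⟨h₂, fun p hp hpT => ?_⟩
          rcases Nat.lt_succ_iff_lt_or_eq.1 hp with hp | rfl
          · exact h₃ p hp hpT
          · by_contra hne
            exact hm' ⟨hpT, hne⟩
        · exact .inr h₂
    · rintro s' (⟨h₂, h₃⟩ | h₂)
      · exact .inl ⟨h₂, fun p => h₃ p p.2⟩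
      · exact .inr h₂

/-- The part of `expand` that deals with one letter. -/
abbrev expandLetter : Stmt :=
  block [
    forStates (.put cnt (.lit 0) (.var q) (.lit 0)),
    forStates (.put cnt (.lit 0) (.get delta (.var q) (.var a)) (.lit 1)),
    .set flag (.lit 1),
    forStates (when (.and (.eq (.get queueT (.var cur) (.var q)) (.lit 1))
        (.eq (.get cnt (.lit 0) (.var q)) (.lit 0)))
      (.set flag (.lit 0))),
    when (.eq (.var flag) (.lit 1)) (block [
      forStates (.put queueT (.var tail) (.var q)
        (.get queueT (.var cur) (.get delta (.var q) (.var a)))),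
      forStates (.put queueW (.var tail) (.var q)
        (.get queueW (.var cur) (.get delta (.var q) (.var a)))),
      .set tail (.succ (.var tail))])]

/-- The predecessor of `T` with respect to the letter `l` is pushed, provided that it is one. -/
theorem ends_expandLetter {M : SemiAutomaton (Fin N) (Fin K)} {T : Finset (Fin N)}
    {f : Fin N → Fin N} {c t : ℕ} (l : Fin K) (hM : Context M s) (hc : s.reg cur = c)
    (ht : s.reg tail = t) (hct : c < t) (hl : s.reg a = l) (hT : IsSet s queueT c T)
    (hf : IsMap s queueW c f) :
    Ends procs expandLetter s (N * 100 + 100) fun s' =>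
      (∀ i < t, s'.mem queueT i = s.mem queueT i ∧ s'.mem queueW i = s.mem queueW i) ∧
      (((∀ p ∈ T, ∃ q, M.step q l = p) ∧ s'.reg tail = t + 1 ∧
          IsSet s' queueT t (pre (fun q => M.step q l) T) ∧
          IsMap s' queueW t (fun q => f (M.step q l))) ∨
        ((¬ ∀ p ∈ T, ∃ q, M.step q l = p) ∧ s'.reg tail = t)) := by
  refine (Ends.cons rfl (ends_fill (N := N) cnt 0 (fun j => 0) rfl (by decide) (by decide) hM.n
    fun m hm s' h u h' i j => ?_) fun s₁ h₁ u₁ => ?_)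
  · simp [Stmt.eff, State.setMem, Expr.eval, h]
  have hd : ∀ m (hm : m < N), s.mem delta m l = M.step ⟨m, hm⟩ l := fun m hm => hM.delta ⟨m, hm⟩ l
  refine Ends.cons rfl (Ends.for_simple N (fun m s' => ∀ p : Fin N, s'.mem cnt 0 p =
    if ∃ q : Fin N, q.1 < m ∧ M.step q l = p then 1 else 0) rfl (by decide) (by decide)
    (by decide) ?_ ?_ fun m hm s' h u h' p => ?_) fun s₂ h₂ u₂ => ?_
  · simp (disch := decide) only [u₁.reg, hM.n]
  · intro p
    simp [State.setReg, h₁]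
  · have hd' : s'.mem delta = s.mem delta := by simp (disch := decide) only [u.mem, u₁.mem]
    have hl' : s'.reg a = l := by simp (disch := decide) only [u.reg, u₁.reg, hl]
    have he : (∃ q : Fin N, q.1 < m + 1 ∧ M.step q l = p) ↔
        (p = M.step ⟨m, hm⟩ l ∨ ∃ q : Fin N, q.1 < m ∧ M.step q l = p) := by
      constructor
      · rintro ⟨q, hq, rfl⟩
        rcases Nat.lt_succ_iff_lt_or_eq.1 hq with hq | rfl
        · exact .inr ⟨q, hq, rfl⟩
        · exact .inl rfl
      · rintro (rfl | ⟨q, hq, rfl⟩)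
        · exact ⟨_, Nat.lt_succ_self m, rfl⟩
        · exact ⟨q, hq.trans (Nat.lt_succ_self m), rfl⟩
    simp only [Stmt.eff, Expr.eval, State.setReg, State.setMem, h, hd', hl', hd m hm, he, h' p,
      true_and, ← Fin.ext_iff]
    by_cases hp : p = M.step ⟨m, hm⟩ l <;> simp [hp]
  refine Ends.cons rfl (Ends.set_reg _ _) fun s₃ h₃ u₃ => ?_
  have hq₃ : s₃.mem queueT = s.mem queueT := by
    simp (disch := decide) only [u₃.mem, u₂.mem, u₁.mem]
  refine Ends.cons rfl (ends_flag (N := N) flag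
    (fun m => ¬ (s.mem queueT c m = 1 ∧ s₃.mem cnt 0 m = 0))
    (by decide) (by decide) ?_ (by simpa [Expr.eval] using h₃) fun m hm s' h u => ?_)
    fun s₄ h₄ u₄ => ?_
  · simp (disch := decide) only [u₃.reg, u₂.reg, u₁.reg, hM.n]
  · have hc' : s'.reg cur = c := by simp (disch := decide) only [u.reg, u₃.reg, u₂.reg, u₁.reg, hc]
    simp (disch := decide) only [Cond.Holds, Expr.eval, h, hc', u.mem, hq₃, not_not]
  have hiff : (∀ m < N, ¬ (s.mem queueT c m = 1 ∧ s₃.mem cnt 0 m = 0)) ↔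
      ∀ p ∈ T, ∃ q, M.step q l = p := by
    have hcnt : s₃.mem cnt = s₂.mem cnt := by simp (disch := decide) only [u₃.mem]
    rw [hcnt]
    constructor
    · intro h p hp
      by_contra hne
      refine h p p.2 ⟨by simp [hT p, hp], ?_⟩
      rw [h₂ p, if_neg]
      rintro ⟨q, -, hq⟩
      exact hne ⟨q, hq⟩
    · rintro h m hm ⟨hm₁, hm₂⟩
      have hm₃ := h₂ ⟨m, hm⟩
      have hm₄ := hT ⟨m, hm⟩
      simp only at hm₃ hm₄
      have hmT : (⟨m, hm⟩ : Fin N) ∈ T := by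
        by_contra hne
        simp [hm₁, hne] at hm₄
      obtain ⟨q, hq⟩ := h _ hmT
      rw [hm₂, if_pos ⟨q, q.2, hq⟩] at hm₃
      exact absurd hm₃ (by simp)
  rw [hiff] at h₄
  have hq₄ : s₄.mem queueT = s.mem queueT := by simp (disch := decide) only [u₄.mem, hq₃]
  have hw₄ : s₄.mem queueW = s.mem queueW := by
    simp (disch := decide) only [u₄.mem, u₃.mem, u₂.mem, u₁.mem]
  have hd₄ : s₄.mem delta = s.mem delta := by
    simp (disch := decide) only [u₄.mem, u₃.mem, u₂.mem, u₁.mem]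
  have hr₄ : ∀ x, x ∉ [q, flag] → s₄.reg x = s.reg x := fun x hx => by
    simp only [List.mem_cons, List.not_mem_nil, or_false, not_or] at hx
    rw [u₄.reg x, u₃.reg x, u₂.reg x, u₁.reg x] <;>
      simp [forStates, for_, when, Stmt.regs, hx.1, hx.2]
  refine (Ends.ite (T := N * 50 + 50) (fun hb => ?_) fun hb => ?_).le ?_
  · have hflag : s₄.reg flag = 1 := by simpa [Cond.Holds, Expr.eval] using hb
    have hs : ∀ p ∈ T, ∃ q, M.step q l = p := by
      rcases h₄ with h₄ | h₄
      · exact h₄.1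
      · rw [h₄.2] at hflag
        exact absurd hflag (by simp)
    refine Ends.cons rfl (ends_fill (N := N) queueT t
      (fun m => if h : m < N then s.mem queueT c (M.step ⟨m, h⟩ l) else 0) rfl (by decide)
      (by decide) ?_ fun m hm s' h u h' i j => ?_) fun s₅ h₅ u₅ => ?_
    · rw [hr₄ _ (by decide), hM.n]
    · simp (disch := decide) only [Stmt.eff, State.setMem, Expr.eval, u.reg, hr₄, ht, hl, hc, u.mem,
        hd₄, h, hd m hm, h', hct.ne, false_and, if_false, hq₄, hm, dif_pos, true_and]
    refine Ends.cons rfl (ends_fill (N := N) queueW t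
      (fun m => if h : m < N then s.mem queueW c (M.step ⟨m, h⟩ l) else 0) rfl (by decide)
      (by decide) ?_ fun m hm s' h u h' i j => ?_) fun s₆ h₆ u₆ => ?_
    · rw [u₅.reg _ (by decide), hr₄ _ (by decide), hM.n]
    · simp (disch := decide) only [Stmt.eff, State.setMem, Expr.eval, u.reg, u₅.reg, hr₄, ht, hl,
        hc, u.mem, u₅.mem, hd₄, h, hd m hm, h', hct.ne, false_and, if_false, hw₄, hm, dif_pos,
        true_and]
    refine ((Ends.set_reg _ _).frame rfl).mono ?_ fun s₇ ⟨h₇, u₇⟩ => ?_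
    · simp [Stmt.bound, Expr.cost]
      omega
    · have e₁ : s₇.mem queueT = s₅.mem queueT := by simp (disch := decide) only [u₇.mem, u₆.mem]
      have e₂ : s₇.mem queueW = s₆.mem queueW := by simp (disch := decide) only [u₇.mem]
      have e₃ : s₅.mem queueW = s₄.mem queueW := by simp (disch := decide) only [u₅.mem]
      refine ⟨fun i hi => ⟨?_, ?_⟩, .inl ⟨hs, ?_, fun p => ?_, fun p => ?_⟩⟩
      · funext j
        simp [e₁, h₅, hi.ne, hq₄]
      · funext j
        simp [e₂, h₆, e₃, hi.ne, hw₄]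
      · simp (disch := decide) only [h₇, Expr.eval, u₆.reg, u₅.reg, hr₄, ht]
      · simp [e₁, h₅, hT _]
      · simp [e₂, h₆, hf _]
  · refine (Ends.skip ?_).le (by omega)
    refine ⟨fun i hi => by rw [hq₄, hw₄]; exact ⟨rfl, rfl⟩, .inr ⟨?_, ?_⟩⟩
    · rcases h₄ with h₄ | h₄
      · exact absurd h₄.2 hb
      · exact h₄.1
    · rw [hr₄ _ (by decide), ht]
  · simp [Stmt.bound, Cond.cost, Expr.cost]
    omega

/-- The entry `c` of the queue, with the set `T`, is expanded: the new entries from `t` on are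
its predecessors with respect to letters, the letter that leads to entry `i` inducing `L i`. -/
theorem ends_expand {M : SemiAutomaton (Fin N) (Fin K)} {T : Finset (Fin N)}
    {f : Fin N → Fin N} {c t : ℕ} (hM : Context M s) (hc : s.reg cur = c)
    (ht : s.reg tail = t) (hct : c < t) (hT : IsSet s queueT c T) (hf : IsMap s queueW c f) :
    Ends procs expand s (N * 20 + 20 + K * (N * 100 + 107)) fun s' =>
      (∀ p : Fin N, s'.mem absent 0 p = if p ∈ T then s.mem absent 0 p else c + 1) ∧
      (∀ i < t, s'.mem queueT i = s.mem queueT i ∧ s'.mem queueW i = s.mem queueW i) ∧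
      t ≤ s'.reg tail ∧ s'.reg tail ≤ t + K ∧
      ∃ L : ℕ → Fin N → Fin N,
        (∀ i < s'.reg tail, t ≤ i → (∃ l, L i = fun q => M.step q l) ∧
          (∀ p ∈ T, ∃ q, L i q = p) ∧ IsSet s' queueT i (pre (L i) T) ∧
          IsMap s' queueW i (f ∘ L i)) ∧
        ∀ l, (∀ p ∈ T, ∃ q, M.step q l = p) →
          ∃ i < s'.reg tail, t ≤ i ∧ L i = fun q => M.step q l := by
  refine Ends.cons rfl (ends_fill (N := N) absent 0
    (fun j => if s.mem queueT c j = 0 then c + 1 else s.mem absent 0 j) rfl (by decide) (by decide)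
    hM.n fun m hm s' h u h' i j => ?_) fun s₁ h₁ u₁ => ?_
  · have hc' : s'.reg cur = c := by simp (disch := decide) only [u.reg, hc]
    have hq : s'.mem queueT = s.mem queueT := by simp (disch := decide) only [u.mem]
    simp only [Stmt.eff, when, Cond.Holds, Expr.eval, h, hc', hq]
    split_ifs with h₁ h₂ h₂
    · simp [State.setMem, h₂]
    · simp [State.setMem, h₂]
    · simp [h₂, h']
    · rfl
  have hq₁ : s₁.mem queueT = s.mem queueT := by simp (disch := decide) only [u₁.mem]
  have hw₁ : s₁.mem queueW = s.mem queueW := by simp (disch := decide) only [u₁.mem]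
  have hc₁ : s₁.reg cur = c := by simp (disch := decide) only [u₁.reg, hc]
  have hM₁ := hM.of_unchanged u₁ (by decide) (by decide) (by decide)
  refine ((Ends.for_var (T := N * 100 + 100) K (fun m s' =>
      (∀ i < t, s'.mem queueT i = s.mem queueT i ∧ s'.mem queueW i = s.mem queueW i) ∧
      t ≤ s'.reg tail ∧ s'.reg tail ≤ t + m ∧
      ∃ L : ℕ → Fin N → Fin N,
        (∀ i < s'.reg tail, t ≤ i → (∃ l, L i = fun q => M.step q l) ∧
          (∀ p ∈ T, ∃ q, L i q = p) ∧ IsSet s' queueT i (pre (L i) T) ∧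
          IsMap s' queueW i (f ∘ L i)) ∧
        ∀ l : Fin K, l.1 < m → (∀ p ∈ T, ∃ q, M.step q l = p) →
          ∃ i < s'.reg tail, t ≤ i ∧ L i = fun q => M.step q l)
    rfl (by decide) (by decide) (by decide) ?_ ?_ ?_).frame rfl).mono ?_ ?_
  · exact hM₁.k
  · refine ⟨fun i _ => ?_, ?_, ?_, fun _ => id, fun i hi hi' => ?_, ?_⟩
    · rw [← hq₁, ← hw₁]
      exact ⟨rfl, rfl⟩
    · simp (disch := decide) only [State.setReg, u₁.reg, ht]
      simp
    · simp (disch := decide) only [State.setReg, u₁.reg, ht]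
      simp
    · simp (disch := decide) only [State.setReg, u₁.reg, ht] at hi
      simp at hi
      omega
    · simp
  · rintro m hm s' h u ⟨g₁, g₂, g₃, L, g₄, g₅⟩
    refine (ends_expandLetter (T := T) (f := f) (c := c) (t := s'.reg tail) ⟨m, hm⟩
      (hM₁.of_unchanged u (by decide) (by decide) (by decide)) ?_ rfl (by omega) h
      ?_ ?_).mono le_rfl ?_
    · simp (disch := decide) only [u.reg, hc₁]
    · intro p
      rw [(g₁ c hct).1, hT p]
    · intro p
      rw [(g₁ c hct).2, hf p]
    rintro s₂ ⟨k₁, k₂⟩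
    have ha : ∀ v, (s₂.setReg a v).reg tail = s₂.reg tail := fun v => by simp [State.setReg]
    have ha' : ∀ v, (s₂.setReg a v).mem = s₂.mem := fun v => rfl
    simp only [IsSet, IsMap, ha, ha'] at g₄ k₂ ⊢
    refine ⟨fun i hi => ?_, ?_, ?_, ?_⟩
    · rw [(k₁ i (by omega)).1, (k₁ i (by omega)).2]
      exact g₁ i hi
    · rcases k₂ with k₂ | k₂ <;> omega
    · rcases k₂ with k₂ | k₂ <;> omega
    · rcases k₂ with ⟨k₂, k₃, k₄, k₅⟩ | ⟨k₂, k₃⟩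
      · refine ⟨Function.update L (s'.reg tail) fun q => M.step q ⟨m, hm⟩, fun i hi hi' => ?_,
          fun l hl hs => ?_⟩
        · rcases (show i < s'.reg tail ∨ i = s'.reg tail by omega) with hi | rfl
          · rw [Function.update_of_ne hi.ne, (k₁ i hi).1, (k₁ i hi).2]
            exact g₄ i hi hi'
          · rw [Function.update_self]
            exact ⟨⟨_, rfl⟩, k₂, k₄, k₅⟩
        · rcases Nat.lt_succ_iff_lt_or_eq.1 hl with hl | hl
          · obtain ⟨i, hi, hi', hL⟩ := g₅ l hl hs
            exact ⟨i, by omega, hi', by rw [Function.update_of_ne hi.ne, hL]⟩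
          · obtain rfl : l = ⟨m, hm⟩ := Fin.ext hl
            exact ⟨_, by omega, g₂, by rw [Function.update_self]⟩
      · refine ⟨L, fun i hi hi' => ?_, fun l hl hs => ?_⟩
        · rw [k₃] at hi
          rw [(k₁ i hi).1, (k₁ i hi).2]
          exact g₄ i hi hi'
        · rcases Nat.lt_succ_iff_lt_or_eq.1 hl with hl | hl
          · rw [k₃]
            exact g₅ l hl hs
          · obtain rfl : l = ⟨m, hm⟩ := Fin.ext hl
            exact absurd hs k₂
  · simp [Stmt.bound, when, Cond.cost, Expr.cost]
    generalize K * _ = x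
    omega
  · rintro s₂ ⟨⟨g₁, g₂, g₃, L, g₄, g₅⟩, u₂⟩
    refine ⟨fun p => ?_, g₁, g₂, g₃, L, g₄, fun l => g₅ l l.2⟩
    rw [u₂.mem absent (by decide), h₁]
    by_cases hp : p ∈ T <;> simp [hT p, hp]

/-! ### The recursive step of the search -/

/-- What a call of `findExtending` at depth `d` leaves unchanged. -/
structure Frame (d : ℕ) (s s' : State) : Prop where
  depth : s'.reg depth = s.reg depth
  reg : ∀ x ∈ [n, k, count, done, result], s'.reg x = s.reg x
  mem : ∀ b ∈ [delta, out, bag], s'.mem b = s.mem b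
  arg : ∀ i ≤ d, s'.mem arg i = s.mem arg i
  saved : ∀ b ∈ [setT, wordW, setT', wordW'], ∀ i < d, s'.mem b i = s.mem b i

theorem Frame.trans {d : ℕ} {s₁ s₂ s₃ : State} (h : Frame d s₁ s₂) (h' : Frame d s₂ s₃) :
    Frame d s₁ s₃ where
  depth := h'.depth.trans h.depth
  reg x hx := (h'.reg x hx).trans (h.reg x hx)
  mem b hb := (h'.mem b hb).trans (h.mem b hb)
  arg i hi := (h'.arg i hi).trans (h.arg i hi)
  saved b hb i hi := (h'.saved b hb i hi).trans (h.saved b hb i hi)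

theorem Frame.of_unchanged {d : ℕ} {c : Stmt} {s' : State} (u : Unchanged c s s')
    (hr : ∀ x ∈ [FindWitness.depth, n, k, count, done, result], x ∉ c.regs)
    (ha : ∀ b ∈ [delta, out, bag, FindWitness.arg, setT, wordW, setT', wordW'], b ∉ c.arrays) :
    Frame d s s' where
  depth := u.reg _ (hr _ (by simp))
  reg x hx := u.reg x (hr x (List.mem_cons_of_mem _ hx))
  mem b hb := u.mem b (ha b (by simp at hb ⊢; tauto))
  arg i _ := by rw [u.mem _ (ha _ (by simp))]
  saved b hb i _ := by rw [u.mem b (ha b (by simp at hb ⊢; tauto))]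

theorem Context.of_frame {M : SemiAutomaton (Fin N) (Fin K)} {d : ℕ} {s' : State}
    (h : Context M s) (u : Frame d s s') : Context M s' :=
  ⟨by rw [u.reg _ (by decide), h.n], by rw [u.reg _ (by decide), h.k],
    fun p l => by rw [u.mem _ (by decide), h.delta]⟩

/-- The recursive call for `T ∪ T'`, under the assumption that it returns a word `u`.  Note that
the pairs of depth `d` survive it, as they are kept in row `d` of their arrays. -/
theorem ends_recurse {M : SemiAutomaton (Fin N) (Fin K)} {T T' : Finset (Fin N)}
    {f f' : Fin N → Fin N} {c d e R : ℕ} (hM : Context M s) (hd : s.reg depth = d)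
    (hc : s.reg cur = c) (he : s.reg hit = e + 1) (hT : IsSet s queueT c T)
    (hf : IsMap s queueW c f) (hT' : IsSet s queueT e T') (hf' : IsMap s queueW e f')
    (hp : procs[0]? = some findExtending)
    (hrec : ∀ s', Context M s' → s'.reg depth = d + 1 → IsSet s' arg (d + 1) (T ∪ T') →
      Ends procs findExtending s' R fun s'' => Frame (d + 1) s' s'' ∧ s''.reg status = 1 ∧
        ∃ u, IsMap s'' ret 0 u ∧ Extends M (T ∪ T') u) :
    Ends procs recurse s (N * 200 + 200 + R) fun s' => Frame d s s' ∧ s'.reg status = 1 ∧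
      ∃ u, Extends M (T ∪ T') u ∧ ((T.card < (pre u T).card ∧ IsMap s' ret 0 (f ∘ u)) ∨
        (¬ T.card < (pre u T).card ∧ IsMap s' ret 0 (f' ∘ u))) := by
  refine Ends.cons rfl (ends_copy (N := N) setT d queueT c (.var depth) (.var cur) hM.n
    (fun s' u => ?_) fun s' u => ?_) fun s₁ h₁ u₁ => ?_
  · simp (disch := decide) only [Expr.eval, u.reg, hd]
  · simp (disch := decide) only [Expr.eval, u.reg, hc]
  refine Ends.cons rfl (ends_copy (N := N) wordW d queueW c (.var depth) (.var cur) ?_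
    (fun s' u => ?_) fun s' u => ?_) fun s₂ h₂ u₂ => ?_
  · simp (disch := decide) only [u₁.reg, hM.n]
  · simp (disch := decide) only [Expr.eval, u.reg, u₁.reg, hd]
  · simp (disch := decide) only [Expr.eval, u.reg, u₁.reg, hc]
  refine Ends.cons rfl (ends_copy (N := N) setT' d queueT e (.var depth) (.pred (.var hit)) ?_
    (fun s' u => ?_) fun s' u => ?_) fun s₃ h₃ u₃ => ?_
  · simp (disch := decide) only [u₁.reg, u₂.reg, hM.n]
  · simp (disch := decide) only [Expr.eval, u.reg, u₁.reg, u₂.reg, hd]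
  · simp (disch := decide) only [Expr.eval, u.reg, u₁.reg, u₂.reg, he]
    rfl
  refine Ends.cons rfl (ends_copy (N := N) wordW' d queueW e (.var depth) (.pred (.var hit)) ?_
    (fun s' u => ?_) fun s' u => ?_) fun s₄ h₄ u₄ => ?_
  · simp (disch := decide) only [u₁.reg, u₂.reg, u₃.reg, hM.n]
  · simp (disch := decide) only [Expr.eval, u.reg, u₁.reg, u₂.reg, u₃.reg, hd]
  · simp (disch := decide) only [Expr.eval, u.reg, u₁.reg, u₂.reg, u₃.reg, he]
    rfl
  have eT : ∀ p : Fin N, s₄.mem setT d p = if p ∈ T then 1 else 0 := fun p => by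
    simp (disch := decide) only [u₄.mem, u₃.mem, u₂.mem, h₁]
    simp [hT p]
  have eT' : ∀ p : Fin N, s₄.mem setT' d p = if p ∈ T' then 1 else 0 := fun p => by
    simp (disch := decide) only [u₄.mem, h₃, u₂.mem, u₁.mem]
    simp [hT' p]
  have ef : ∀ p : Fin N, s₄.mem wordW d p = f p := fun p => by
    simp (disch := decide) only [u₄.mem, u₃.mem, h₂, u₁.mem]
    simp [hf p]
  have ef' : ∀ p : Fin N, s₄.mem wordW' d p = f' p := fun p => by
    simp (disch := decide) only [h₄, u₃.mem, u₂.mem, u₁.mem]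
    simp [hf' p]
  refine Ends.cons rfl (ends_fill (N := N) arg (d + 1)
    (fun j => if s₄.mem setT d j = 0 ∧ s₄.mem setT' d j = 0 then 0 else 1) rfl (by decide)
    (by decide) ?_ fun m hm s' h u h' i j => ?_) fun s₅ h₅ u₅ => ?_
  · simp (disch := decide) only [u₁.reg, u₂.reg, u₃.reg, u₄.reg, hM.n]
  · have hd' : s'.reg depth = d := by
      simp (disch := decide) only [u.reg, u₁.reg, u₂.reg, u₃.reg, u₄.reg, hd]
    have e₁ : s'.mem setT = s₄.mem setT := by simp (disch := decide) only [u.mem]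
    have e₂ : s'.mem setT' = s₄.mem setT' := by simp (disch := decide) only [u.mem]
    simp only [Stmt.eff, Cond.Holds, Expr.eval, h, hd', e₁, e₂]
    by_cases g₁ : s₄.mem setT d m = 0 ∧ s₄.mem setT' d m = 0 <;>
    by_cases g₂ : i = d + 1 ∧ j = m <;> simp [State.setMem, g₁, g₂]
  refine Ends.cons rfl (Ends.set_reg _ _) fun s₆ h₆ u₆ => ?_
  have hd₆ : s₆.reg depth = d + 1 := by
    simp (disch := decide) only [h₆, Expr.eval, u₁.reg, u₂.reg, u₃.reg, u₄.reg, u₅.reg, hd]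
  have hM₆ : Context M s₆ := ((((((hM.of_unchanged
    u₁ (by decide) (by decide) (by decide)).of_unchanged
    u₂ (by decide) (by decide) (by decide)).of_unchanged
    u₃ (by decide) (by decide) (by decide)).of_unchanged
    u₄ (by decide) (by decide) (by decide)).of_unchanged
    u₅ (by decide) (by decide) (by decide)).of_unchanged
    u₆ (by decide) (by decide) (by decide))
  have hU : IsSet s₆ arg (d + 1) (T ∪ T') := fun p => by
    simp (disch := decide) only [u₆.mem, h₅]
    simp only [eT p, eT' p]
    by_cases h : p ∈ T <;> by_cases h' : p ∈ T' <;> simp [h, h']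
  refine Ends.cons_call (Ends.call hp (hrec s₆ hM₆ hd₆ hU)) ?_
  rintro s₇ ⟨F, hst, u, hu, hE⟩
  refine Ends.cons rfl (Ends.set_reg _ _) fun s₈ h₈ u₈ => ?_
  have hd₈ : s₈.reg depth = d := by
    simp only [h₈, Expr.eval, F.depth, hd₆]
    rfl
  have hN₈ : s₈.reg n = N := by rw [u₈.reg _ (by decide), F.reg _ (by decide), hM₆.n]
  have hst₈ : s₈.reg status = 1 := by rw [u₈.reg _ (by decide), hst]
  have hu₈ : ∀ p : Fin N, s₈.mem ret 0 p = u p := fun p => by rw [u₈.mem _ (by decide), hu p]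
  have eT₈ : IsSet s₈ setT d T := fun p => by
    rw [u₈.mem _ (by decide), F.saved _ (by decide) d (by omega), u₆.mem _ (by decide),
      u₅.mem _ (by decide), eT p]
  have ef₈ : IsMap s₈ wordW d f := fun p => by
    rw [u₈.mem _ (by decide), F.saved _ (by decide) d (by omega), u₆.mem _ (by decide),
      u₅.mem _ (by decide), ef p]
  have ef'₈ : IsMap s₈ wordW' d f' := fun p => by
    rw [u₈.mem _ (by decide), F.saved _ (by decide) d (by omega), u₆.mem _ (by decide),
      u₅.mem _ (by decide), ef' p]
  have fr : Frame d s s₈ := by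
    refine ⟨hd₈.trans hd.symm, fun x hx => ?_, fun b hb => ?_, fun i hi => ?_, fun b hb i hi => ?_⟩
    · simp only [List.mem_cons, List.not_mem_nil, or_false] at hx
      rcases hx with rfl | rfl | rfl | rfl | rfl <;>
      rw [u₈.reg _ (by decide), F.reg _ (by decide), u₆.reg _ (by decide), u₅.reg _ (by decide),
        u₄.reg _ (by decide), u₃.reg _ (by decide), u₂.reg _ (by decide), u₁.reg _ (by decide)]
    · simp only [List.mem_cons, List.not_mem_nil, or_false] at hb
      rcases hb with rfl | rfl | rfl <;>
      rw [u₈.mem _ (by decide), F.mem _ (by decide), u₆.mem _ (by decide), u₅.mem _ (by decide),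
        u₄.mem _ (by decide), u₃.mem _ (by decide), u₂.mem _ (by decide), u₁.mem _ (by decide)]
    · rw [u₈.mem _ (by decide), F.arg _ (by omega), u₆.mem _ (by decide)]
      funext j
      rw [h₅, if_neg (by omega), u₄.mem _ (by decide), u₃.mem _ (by decide),
        u₂.mem _ (by decide), u₁.mem _ (by decide)]
    · rw [u₈.mem _ (by simp only [List.mem_cons, List.not_mem_nil, or_false] at hb
                       rcases hb with rfl | rfl | rfl | rfl <;> decide),
        F.saved _ hb i (by omega)]
      simp only [List.mem_cons, List.not_mem_nil, or_false] at hb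
      funext j
      rcases hb with rfl | rfl | rfl | rfl <;>
      simp (disch := decide) only [u₆.mem, u₅.mem, u₄.mem, u₃.mem, u₂.mem, u₁.mem, h₁, h₂, h₃, h₄,
        hi.ne, false_and, if_false]
  clear h₁ h₂ h₃ h₄ h₅ h₆ u₁ u₂ u₃ u₄ u₅ u₆ u₈ eT eT' ef ef'
  refine (Ends.ite (T := N * 80 + 80) (fun _ => ?_) fun hb => ?_).le ?_
  · refine Ends.cons rfl (Ends.set_reg _ _) fun s₉ h₉ u₉ => ?_
    refine Ends.cons rfl (ends_count (N := N) c₁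
      (fun m => s₈.mem setT d (s₈.mem ret 0 m) = 1) (by decide) (by decide) ?_
      (by rw [h₉]; rfl) fun m hm s' h u => ?_) fun s₁₀ h₁₀ u₁₀ => ?_
    · simp (disch := decide) only [u₉.reg, hN₈]
    · simp (disch := decide) only [Cond.Holds, Expr.eval, h, u.reg, u₉.reg, hd₈, u.mem, u₉.mem]
    rw [card_filter_range (T := pre u T) fun p => by rw [hu₈ p, eT₈ (u p)]; simp] at h₁₀
    refine Ends.cons rfl (ends_card (N := N) (T := T) c₂ setT d _ (by decide) (by decide) ?_ ?_
      fun s' u => ?_) fun s₁₁ h₁₁ u₁₁ => ?_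
    · simp (disch := decide) only [u₁₀.reg, u₉.reg, hN₈]
    · intro p
      simp (disch := decide) only [u₁₀.mem, u₉.mem, eT₈ p]
    · simp (disch := decide) only [Expr.eval, u.reg, u₁₀.reg, u₉.reg, hd₈]
    have e₁ : s₁₁.reg c₁ = (pre u T).card := by simp (disch := decide) only [u₁₁.reg, h₁₀]
    have e₂ : s₁₁.reg n = N := by simp (disch := decide) only [u₁₁.reg, u₁₀.reg, u₉.reg, hN₈]
    have e₃ : s₁₁.reg depth = d := by simp (disch := decide) only [u₁₁.reg, u₁₀.reg, u₉.reg, hd₈]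
    have e₄ : s₁₁.mem ret = s₈.mem ret := by
      simp (disch := decide) only [u₁₁.mem, u₁₀.mem, u₉.mem]
    have fr₁₁ : Frame d s s₁₁ := ((fr.trans (.of_unchanged u₉ (by decide) (by decide))).trans
      (.of_unchanged u₁₀ (by decide) (by decide))).trans (.of_unchanged u₁₁ (by decide) (by decide))
    have hst₁₁ : s₁₁.reg status = 1 := by
      simp (disch := decide) only [u₁₁.reg, u₁₀.reg, u₉.reg, hst₈]
    refine (Ends.ite (T := N * 20 + 20) (fun hb => ?_) fun hb => ?_).le ?_
    · have e₅ : s₁₁.mem wordW = s₈.mem wordW := by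
        simp (disch := decide) only [u₁₁.mem, u₁₀.mem, u₉.mem]
      refine ((ends_fill (N := N) ret 0 (fun m => s₈.mem wordW d (s₈.mem ret 0 m)) rfl
        (by decide) (by decide) e₂ fun m hm s' h u h' i j => ?_).frame rfl).mono ?_
        fun s₁₂ ⟨h₁₂, u₁₂⟩ => ⟨fr₁₁.trans (.of_unchanged u₁₂ (by decide) (by decide)), ?_,
          u, hE, .inl ⟨?_, fun p => ?_⟩⟩
      · simp (disch := decide) only [Stmt.eff, State.setMem, Expr.eval, h, u.reg, e₃, u.mem, e₅, h',
          e₄, lt_irrefl, and_false, if_false, true_and]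
      · simp [Stmt.bound, Expr.cost]
        omega
      · rw [u₁₂.reg _ (by decide), hst₁₁]
      · simpa [Cond.Holds, Expr.eval, h₁₁, e₁] using hb
      · simp only [h₁₂, p.2, and_self, if_true]
        rw [hu₈, ef₈ (u p)]
        rfl
    · have e₅ : s₁₁.mem wordW' = s₈.mem wordW' := by
        simp (disch := decide) only [u₁₁.mem, u₁₀.mem, u₉.mem]
      refine ((ends_fill (N := N) ret 0 (fun m => s₈.mem wordW' d (s₈.mem ret 0 m)) rfl
        (by decide) (by decide) e₂ fun m hm s' h u h' i j => ?_).frame rfl).mono ?_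
        fun s₁₂ ⟨h₁₂, u₁₂⟩ => ⟨fr₁₁.trans (.of_unchanged u₁₂ (by decide) (by decide)), ?_,
          u, hE, .inr ⟨?_, fun p => ?_⟩⟩
      · simp (disch := decide) only [Stmt.eff, State.setMem, Expr.eval, h, u.reg, e₃, u.mem, e₅, h',
          e₄, lt_irrefl, and_false, if_false, true_and]
      · simp [Stmt.bound, Expr.cost]
        omega
      · rw [u₁₂.reg _ (by decide), hst₁₁]
      · simpa [Cond.Holds, Expr.eval, h₁₁, e₁] using hb
      · simp only [h₁₂, p.2, and_self, if_true]
        rw [hu₈, ef'₈ (u p)]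
        rfl
    · simp [Cond.cost, Expr.cost]
      omega
  · exact absurd hst₈ hb
  · simp [Stmt.bound, Cond.cost, Expr.cost]
    omega

/-! ### One round of the search -/

/-- The invariant of the main loop of `findExtending`, called at depth `d` for the set `S` in the
state `s₀`.  The entries of `absent` other than zero point to expanded sets, and a state for which
the entry is zero belongs to all expanded sets. -/
structure LoopInv (M : SemiAutomaton (Fin N) (Fin K)) (S : Finset (Fin N)) (d : ℕ) (s₀ : State)
    (F : ℕ → Fin N → Fin N) (E : Finset ℕ) (s : State) : Prop where
  frame : Frame d s₀ s
  size : s.reg size = S.card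
  status : s.reg status = 0
  search : Search M S F E (s.reg head) (s.reg tail)
  sets : ∀ i < s.reg tail, IsSet s queueT i (pre (F i) S)
  maps : ∀ i < s.reg tail, IsMap s queueW i (F i)
  absent : ∀ p : Fin N, (∃ e ∈ E, p ∉ pre (F e) S ∧ s.mem absent 0 p = e + 1) ∨
    (s.mem FindWitness.absent 0 p = 0 ∧ ∀ e ∈ E, p ∈ pre (F e) S)

/-- The call of `findExtending` at depth `d` for the set `S` in the state `s₀` has returned a
word in the state `s`. -/
def Returned (M : SemiAutomaton (Fin N) (Fin K)) (S : Finset (Fin N)) (d : ℕ) (s₀ s : State) :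
    Prop :=
  Frame d s₀ s ∧ s.reg status = 1 ∧ ∃ f, IsMap s ret 0 f ∧ Extends M S f

/-- The body of the main loop of `findExtending`. -/
abbrev searchBody : Stmt :=
  block [
    .set cur (.var head),
    .set head (.succ (.var head)),
    card c₁ queueT (.var cur),
    .ite (.lt (.var size) (.var c₁))
      (block [
        copy ret (.lit 0) queueW (.var cur),
        .set status (.lit 1)])
      (block [
        lookup,
        .ite (.eq (.var hit) (.lit 0))
          expand
          (block [
            compare flag queueT (.var cur) (.pred (.var hit)),
            when (.eq (.var flag) (.lit 0)) recurse])])]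

theorem LoopInv.skip {M : SemiAutomaton (Fin N) (Fin K)} {S : Finset (Fin N)} {d : ℕ}
    {s₀ s' : State} {F : ℕ → Fin N → Fin N} {E : Finset ℕ} (H : LoopInv M S d s₀ F E s)
    (fr : Frame d s s') (hr : ∀ x ∈ [FindWitness.size, FindWitness.status, tail],
      s'.reg x = s.reg x)
    (hm : ∀ b ∈ [queueT, queueW, FindWitness.absent], s'.mem b = s.mem b)
    (hs : Search M S F E (s'.reg head) (s.reg tail)) : LoopInv M S d s₀ F E s' where
  frame := H.frame.trans fr
  size := (hr _ (by decide)).trans H.size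
  status := (hr _ (by decide)).trans H.status
  search := by rwa [hr tail (by decide)]
  sets i hi p := by
    rw [hm _ (by decide)]
    exact H.sets i (by rwa [← hr tail (by decide)]) p
  maps i hi p := by
    rw [hm _ (by decide)]
    exact H.maps i (by rwa [← hr tail (by decide)]) p
  absent p := by
    rw [hm _ (by decide)]
    exact H.absent p

/-- One round of the main loop skips an entry of the queue, or expands it, or returns a word. -/
theorem exec_searchBody {M : SemiAutomaton (Fin N) (Fin K)} {S : Finset (Fin N)} {d R : ℕ}
    {s₀ : State} {F : ℕ → Fin N → Fin N} {E : Finset ℕ} (hM : Context M s₀)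
    (hd : s₀.reg depth = d) (H : LoopInv M S d s₀ F E s) (hlt : s.reg head < s.reg tail)
    (hp : procs[0]? = some findExtending)
    (hrec : ∀ s' U, S.card < U.card → U ≠ Finset.univ → Context M s' → s'.reg depth = d + 1 →
      IsSet s' arg (d + 1) U → Ends procs findExtending s' R (Returned M U (d + 1) s')) :
    ∃ t s', Exec procs searchBody s t s' ∧
      ((t ≤ N * 300 + 300 ∧ LoopInv M S d s₀ F E s' ∧ s'.reg head = s.reg head + 1) ∨
      (t ≤ N * 300 + 300 + K * (N * 100 + 107) ∧ ∃ F' E', LoopInv M S d s₀ F' E' s' ∧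
        E'.card = E.card + 1 ∧ s'.reg head = s.reg head + 1) ∨
      (t ≤ N * 1000 + 1000 + R ∧ Returned M S d s₀ s')) := by
  have hMs : Context M s := hM.of_frame H.frame
  obtain ⟨t₁, s₁, x₁, b₁, h₁, u₁⟩ :=
    (Ends.set_reg (procs := procs) (s := s) cur (.var head)).frame rfl
  obtain ⟨t₂, s₂, x₂, b₂, h₂, u₂⟩ :=
    (Ends.set_reg (procs := procs) (s := s₁) head (.succ (.var head))).frame rfl
  generalize hh : s.reg head = h at *
  generalize ht : s.reg tail = t at *
  have hc₂ : s₂.reg cur = h := by simp (disch := decide) only [u₂.reg, h₁, Expr.eval, hh]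
  obtain ⟨t₃, s₃, x₃, b₃, h₃, u₃⟩ := (ends_card (procs := procs) (s := s₂) (N := N)
    (T := pre (F h) S) c₁ queueT h (.var cur) (by decide) (by decide)
    (by simp (disch := decide) only [u₂.reg, u₁.reg, hMs.n])
    (by
      intro p
      simp (disch := decide) only [u₂.mem, u₁.mem]
      exact H.sets h (by omega) p)
    (fun s' u => by simp (disch := decide) only [u.reg, hc₂, Expr.eval])).frame rfl
  have hh₃ : s₃.reg head = h + 1 := by
    simp (disch := decide) only [u₃.reg, h₂, Expr.eval, u₁.reg, hh]
  have hc₃ : s₃.reg cur = h := by simp (disch := decide) only [u₃.reg, hc₂]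
  have hr₃ : ∀ x ∈ [size, status, tail], s₃.reg x = s.reg x := by
    intro x hx
    simp only [List.mem_cons, List.not_mem_nil, or_false] at hx
    rcases hx with rfl | rfl | rfl <;> simp (disch := decide) only [u₃.reg, u₂.reg, u₁.reg]
  have hm₃ : s₃.mem = s.mem := by
    funext b
    rw [u₃.mem b (List.not_mem_nil), u₂.mem b (List.not_mem_nil), u₁.mem b (List.not_mem_nil)]
  have fr₃ : Frame d s s₃ := ((Frame.of_unchanged u₁ (by decide) (by decide)).trans
    (.of_unchanged u₂ (by decide) (by decide))).trans (.of_unchanged u₃ (by decide) (by decide))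
  have hM₃ := hMs.of_frame fr₃
  have hT₃ : ∀ i < t, IsSet s₃ queueT i (pre (F i) S) := fun i hi p => by
    rw [hm₃]
    exact H.sets i (by omega) p
  have hf₃ : ∀ i < t, IsMap s₃ queueW i (F i) := fun i hi p => by
    rw [hm₃]
    exact H.maps i (by omega) p
  have hS := H.search
  rw [hh, ht] at hS
  have hpred : ∀ i < t, IsPredecessor M S (F i) := hS.predecessor
  clear h₁ h₂ u₁ u₂ u₃ hc₂
  simp only [Expr.cost] at b₁ b₂ b₃
  by_cases hsize : S.card < (pre (F h) S).card
  · obtain ⟨t₄, s₄, x₄, b₄, h₄, u₄⟩ : Ends procs (block [copy ret (.lit 0) queueW (.var cur),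
        .set status (.lit 1)]) s₃ (N * 20 + 20) fun s' =>
        (s'.reg status = 1 ∧ IsMap s' ret 0 (F h)) ∧ Unchanged (block
        [copy ret (.lit 0) queueW (.var cur), .set status (.lit 1)]) s₃ s' := by
      refine Ends.frame ?_ rfl
      refine Ends.cons rfl (ends_copy (N := N) ret 0 queueW h _ _ hM₃.n (fun _ _ => rfl)
        fun s' u => ?_) fun s₄ h₄ u₄ => ?_
      · simp (disch := decide) only [Expr.eval, u.reg, hc₃]
      · refine ((Ends.set_reg _ _).frame rfl).mono ?_ fun s₅ ⟨h₅, u₅⟩ => ⟨h₅, fun p => ?_⟩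
        · simp only [Expr.cost]
          omega
        · simp (disch := decide) only [u₅.mem, h₄]
          simpa using hf₃ h hlt p
    refine ⟨_, s₄, .seq x₁ (.seq x₂ (.seq x₃ (.ite_true ?_ x₄))), .inr (.inr ⟨?_, ?_, ?_⟩)⟩
    · simpa [Cond.Holds, Expr.eval, h₃, hr₃, H.size] using hsize
    · simp [Cond.cost, Expr.cost]
      omega
    · exact (H.frame.trans fr₃).trans (.of_unchanged u₄ (by decide) (by decide))
    · exact ⟨h₄.1, F h, h₄.2, hpred h hlt, hsize⟩
  have hcard : (pre (F h) S).card = S.card :=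
    le_antisymm (not_lt.1 hsize) (card_le_card_pre (hpred h hlt).surj)
  obtain ⟨t₄, s₄, x₄, b₄, h₄, u₄⟩ := (ends_lookup (procs := procs) (s := s₃) hM₃.n hc₃
    (hT₃ h hlt)).frame rfl
  have hab : s₃.mem absent = s.mem absent := by rw [hm₃]
  rw [hab] at h₄
  have fr₄ : Frame d s s₄ := fr₃.trans (.of_unchanged u₄ (by decide) (by decide))
  have hM₄ := hMs.of_frame fr₄
  have hm₄ : s₄.mem = s.mem := by
    funext b
    rw [u₄.mem b (List.not_mem_nil), hm₃]
  have hc₄ : s₄.reg cur = h := by simp (disch := decide) only [u₄.reg, hc₃]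
  have hh₄ : s₄.reg head = h + 1 := by simp (disch := decide) only [u₄.reg, hh₃]
  have hr₄ : ∀ x ∈ [size, status, tail], s₄.reg x = s.reg x := by
    intro x hx
    rw [← hr₃ x hx]
    simp only [List.mem_cons, List.not_mem_nil, or_false] at hx
    rcases hx with rfl | rfl | rfl <;> simp (disch := decide) only [u₄.reg]
  have hT₄ : ∀ i < t, IsSet s₄ queueT i (pre (F i) S) := fun i hi p => by
    rw [hm₄]
    exact H.sets i (by omega) p
  have hf₄ : ∀ i < t, IsMap s₄ queueW i (F i) := fun i hi p => by
    rw [hm₄]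
    exact H.maps i (by omega) p
  have hcond : ¬ (Cond.lt (.var size) (.var c₁)).Holds s₃ := by
    simpa [Cond.Holds, Expr.eval, h₃, hr₃, H.size] using hsize
  rcases h₄ with ⟨hhit, hnone⟩ | ⟨p, hpT, hp0, hhit⟩
  · -- All states outside the set belong to all expanded sets, and it is expanded.
    obtain ⟨t₅, s₅, x₅, b₅, ⟨g₁, g₂, g₃, g₄, L, g₅, g₆⟩, u₅⟩ := (ends_expand (procs := procs)
      (t := t) hM₄ hc₄ (by rw [hr₄ _ (by decide), ht]) hlt (hT₄ h hlt) (hf₄ h hlt)).frame rfl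
    refine ⟨_, s₅, .seq x₁ (.seq x₂ (.seq x₃ (.ite_false hcond (.seq x₄ (.ite_true ?_ x₅))))),
      .inr (.inl ⟨?_, fun i => if i < t then F i else F h ∘ L i, insert h E, ⟨?_, ?_, ?_, ?_, ?_,
        ?_, ?_⟩, ?_, ?_⟩)⟩
    · simpa [Cond.Holds, Expr.eval] using hhit
    · simp [Cond.cost, Expr.cost]
      omega
    · exact (H.frame.trans fr₄).trans (.of_unchanged u₅ (by decide) (by decide))
    · rw [u₅.reg _ (by decide), hr₄ _ (by decide), H.size]
    · rw [u₅.reg _ (by decide), hr₄ _ (by decide), H.status]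
    · rw [u₅.reg head (by decide), hh₄]
      refine hS.expand hlt hcard (fun e he q => ?_) (fun i hi => if_pos hi) g₃
        (by rwa [Fintype.card_fin]) (fun i hi hi' => ?_) fun l hl => ?_
      · by_cases hq : q ∈ pre (F h) S
        · exact .inr hq
        · left
          rcases H.absent q with ⟨e, -, -, he⟩ | ⟨-, he⟩
          · rw [hnone q hq] at he
            exact absurd he (by simp)
          · exact he _ ‹_›
      · simp only [if_neg (not_lt.2 hi')]
        obtain ⟨⟨l, hl⟩, hs, -, -⟩ := g₅ i hi hi'
        exact (hpred h hlt).comp ⟨⟨[l], fun q => by rw [hl]; rfl⟩, hs⟩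
      · obtain ⟨j, hj, hj', hL⟩ := g₆ l hl
        exact ⟨j, hj, by simp only [if_neg (not_lt.2 hj'), pre_comp, hL]⟩
    · intro i hi
      by_cases hi' : i < t
      · intro p
        simp only [if_pos hi', (g₂ i hi').1]
        exact hT₄ i hi' p
      · simp only [if_neg hi', pre_comp]
        exact (g₅ i hi (not_lt.1 hi')).2.2.1
    · intro i hi
      by_cases hi' : i < t
      · intro p
        simp only [if_pos hi', (g₂ i hi').2]
        exact hf₄ i hi' p
      · simp only [if_neg hi']
        exact (g₅ i hi (not_lt.1 hi')).2.2.2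
    · intro p
      simp only [Finset.mem_insert]
      rw [g₁ p, hm₄]
      by_cases hpT : p ∈ pre (F h) S
      · rw [if_pos hpT]
        rcases H.absent p with ⟨e, he, he', he''⟩ | ⟨he, he'⟩
        · exact .inl ⟨e, .inr he, by rwa [if_pos ((hS.lt e he).trans hlt)], he''⟩
        · refine .inr ⟨he, ?_⟩
          rintro e (rfl | h)
          · rwa [if_pos hlt]
          · rw [if_pos ((hS.lt e h).trans hlt)]
            exact he' e h
      · exact .inl ⟨h, .inl rfl, by rwa [if_pos hlt], by rw [if_neg hpT]⟩
    · exact Finset.card_insert_of_notMem fun hh => lt_irrefl _ (hS.lt h hh)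
    · rw [u₅.reg head (by decide), hh₄]
  · obtain ⟨e, he, hpe, hpe'⟩ : ∃ e ∈ E, p ∉ pre (F e) S ∧ s.mem absent 0 p = e + 1 :=
      (H.absent p).resolve_right fun hr => hp0 hr.1
    rw [hpe'] at hhit
    have het : e < t := (hS.lt e he).trans hlt
    have hcond' : ¬ (Cond.eq (.var hit) (.lit 0)).Holds s₄ := by
      simp [Cond.Holds, Expr.eval, hhit]
    obtain ⟨t₅, s₅, x₅, b₅, h₅, u₅⟩ := (ends_compare (procs := procs) (N := N) (s := s₄) flag queueT
      h e (.var cur) (.pred (.var hit)) (by decide) (by decide) hM₄.n (hT₄ h hlt) (hT₄ e het)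
      (fun s' u => by simp (disch := decide) only [Expr.eval, u.reg, hc₄])
      (fun s' u => by simp (disch := decide) only [Expr.eval, u.reg, hhit]; rfl)).frame rfl
    simp only [Expr.cost] at b₅
    have hm₅ : s₅.mem = s.mem := by
      funext b
      rw [u₅.mem b (List.not_mem_nil), hm₄]
    have fr₅ : Frame d s s₅ := fr₄.trans (.of_unchanged u₅ (by decide) (by decide))
    have hM₅ := hMs.of_frame fr₅
    have hh₅ : s₅.reg head = h + 1 := by simp (disch := decide) only [u₅.reg, hh₄]
    rcases h₅ with ⟨hTT, hflag⟩ | ⟨hTT, hflag⟩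
    · refine ⟨_, s₅, .seq x₁ (.seq x₂ (.seq x₃ (.ite_false hcond (.seq x₄ (.ite_false hcond'
        (.seq x₅ (.ite_false ?_ (.skip _)))))))), .inl ⟨?_, H.skip fr₅ ?_ ?_ ?_, hh₅⟩⟩
      · simp [Cond.Holds, Expr.eval, hflag]
      · simp [Cond.cost, Expr.cost]
        omega
      · intro x hx
        rw [← hr₄ x hx]
        simp only [List.mem_cons, List.not_mem_nil, or_false] at hx
        rcases hx with rfl | rfl | rfl <;> simp (disch := decide) only [u₅.reg]
      · intro b _
        rw [hm₅]
      · rw [hh₅, ht]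
        exact hS.skip hlt ⟨e, he, hTT⟩
    · -- The two sets have the same size, and so their union is larger.
      have hU : S.card < (pre (F h) S ∪ pre (F e) S).card := by
        rw [← hcard]
        refine Finset.card_lt_card (Finset.ssubset_iff_subset_ne.2
          ⟨Finset.subset_union_left, fun hEq => hTT ?_⟩)
        refine (Finset.eq_of_subset_of_card_le ?_ ?_).symm
        · rw [hEq]
          exact Finset.subset_union_right
        · rw [hcard, hS.card e he]
      have hU' : pre (F h) S ∪ pre (F e) S ≠ Finset.univ := fun hEq => by
        have := Finset.mem_univ p
        rw [← hEq, Finset.mem_union] at this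
        exact this.elim hpT hpe
      obtain ⟨t₆, s₆, x₆, b₆, fr₆, hst, u, hu, hres⟩ := ends_recurse (procs := procs) (s := s₅)
        (T := pre (F h) S) (T' := pre (F e) S) (f := F h) (f' := F e) (c := h) (d := d) (e := e)
        (R := R) hM₅ (by rw [fr₅.depth, H.frame.depth, hd])
        (by simp (disch := decide) only [u₅.reg, hc₄])
        (by simp (disch := decide) only [u₅.reg, hhit])
        (fun p => by rw [hm₅]; exact H.sets h (by omega) p)
        (fun p => by rw [hm₅]; exact H.maps h (by omega) p)
        (fun p => by rw [hm₅]; exact H.sets e (by omega) p)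
        (fun p => by rw [hm₅]; exact H.maps e (by omega) p) hp
        (fun s' k₁ k₂ k₃ => hrec s' _ hU hU' k₁ k₂ k₃)
      refine ⟨_, s₆, .seq x₁ (.seq x₂ (.seq x₃ (.ite_false hcond (.seq x₄ (.ite_false hcond'
        (.seq x₅ (.ite_true ?_ x₆))))))), .inr (.inr ⟨?_, (H.frame.trans fr₅).trans fr₆, hst, ?_⟩)⟩
      · simp [Cond.Holds, Expr.eval, hflag]
      · simp [Cond.cost, Expr.cost]
        omega
      · rcases hres with ⟨hlarge, hmap⟩ | ⟨hlarge, hmap⟩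
        · exact ⟨_, hmap, (hpred h hlt).extends_comp
            ⟨hu.subset Finset.subset_union_left, hlarge⟩⟩
        · exact ⟨_, hmap, (hpred e het).extends_comp
            (hu.of_union.resolve_left fun hn => hlarge hn.card)⟩

/-! ### The search -/

/-- The main loop of `findExtending`, when at most `l` rounds are left: there are at most
`N / (N - |S|)` expansions, and so at most `1 + K * (N / (N - |S|))` entries.  Only a round that
returns a word calls the procedure recursively. -/
theorem ends_searchLoop {M : SemiAutomaton (Fin N) (Fin K)} {S : Finset (Fin N)} {d R : ℕ}
    {s₀ : State} (hM : Context M s₀) (hd : s₀.reg depth = d) (hS : S ≠ Finset.univ)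
    (hp : procs[0]? = some findExtending)
    (hrec : ∀ s' U, S.card < U.card → U ≠ Finset.univ → Context M s' → s'.reg depth = d + 1 →
      IsSet s' arg (d + 1) U → Ends procs findExtending s' R (Returned M U (d + 1) s')) (l : ℕ)
    {F : ℕ → Fin N → Fin N} {E : Finset ℕ} (H : LoopInv M S d s₀ F E s)
    (hl : 1 + K * (N / (N - S.card)) ≤ s.reg head + l) :
    Ends procs (.while (.and (.eq (.var status) (.lit 0)) (.lt (.var head) (.var tail))) searchBody)
      s (l * (N * 300 + 310) + (N / (N - S.card) - E.card) * (K * (N * 100 + 107)) +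
        (N * 1000 + 1020 + R))
      fun s' => Returned M S d s₀ s' ∨ (Frame d s₀ s' ∧ s'.reg status = 0 ∧ ¬ Extendable M S) := by
  have hpos : 0 < N - S.card := by
    have := Finset.card_lt_card (Finset.ssubset_univ_iff.2 hS)
    simp only [Finset.card_univ, Fintype.card_fin] at this
    omega
  have hE : ∀ {s F E}, LoopInv M S d s₀ F E s → E.card ≤ N / (N - S.card) := fun H => by
    rw [Nat.le_div_iff_mul_le hpos]
    simpa using H.search.card_mul_le
  generalize N / (N - S.card) = B at *
  induction l generalizing s F E with
  | zero =>
    have h₁ := H.search.tail_le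
    have h₂ := Nat.mul_le_mul_left K (hE H)
    rw [Fintype.card_fin] at h₁
    have h₃ : s.reg head = s.reg tail := le_antisymm H.search.le (by omega)
    refine (Ends.while_false ?_ (.inr ⟨H.frame, H.status, ?_⟩)).le ?_
    · simp [Cond.Holds, Expr.eval, h₃]
    · simp [Cond.cost, Expr.cost]
      omega
    · have := H.search
      rw [h₃] at this
      exact this.not_extendable
  | succ l ih =>
    by_cases hlt : s.reg head < s.reg tail
    · have hb : (Cond.and (.eq (.var status) (.lit 0)) (.lt (.var head) (.var tail))).Holds s := by
        simp [Cond.Holds, Expr.eval, H.status, hlt]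
      obtain ⟨t, s₁, x, ⟨ht, H₁, hh⟩ | ⟨ht, F', E', H₁, hE', hh⟩ | ⟨ht, hret⟩⟩ :=
        exec_searchBody hM hd H hlt hp hrec
      · obtain ⟨t', s₂, x', ht', h₂⟩ := ih H₁ (by omega)
        refine ⟨_, s₂, .while_true hb x x', ?_, h₂⟩
        simp only [Cond.cost, Expr.cost, Nat.succ_mul]
        omega
      · obtain ⟨t', s₂, x', ht', h₂⟩ := ih H₁ (by omega)
        refine ⟨_, s₂, .while_true hb x x', ?_, h₂⟩
        have h₃ := hE H₁
        rw [show B - E.card = (B - E'.card) + 1 by omega]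
        simp only [Cond.cost, Expr.cost, Nat.succ_mul]
        omega
      · refine ⟨_, s₁, .while_true hb x (.while_false ?_), ?_, .inl hret⟩
        · simp [Cond.Holds, Expr.eval, hret.2.1]
        · simp only [Cond.cost, Expr.cost, Nat.succ_mul]
          omega
    · have h₃ : s.reg head = s.reg tail := le_antisymm H.search.le (by omega)
      refine (Ends.while_false ?_ (.inr ⟨H.frame, H.status, ?_⟩)).le ?_
      · simp [Cond.Holds, Expr.eval, h₃]
      · simp [Cond.cost, Expr.cost]
        omega
      · have := H.search
        rw [h₃] at this
        exact this.not_extendable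

/-- A bound for the running time of `findExtending` for a set with `m` states in its
complement: the summand for `j` covers one call for a set with `j` states in its complement, and the
complements become smaller from call to call. -/
def searchTime (N K m : ℕ) : ℕ :=
  ∑ j ∈ Finset.Icc 1 m, 4000 * N * (K + 1) * (N / j)

theorem searchTime_mono {m m' : ℕ} (h : m ≤ m') : searchTime N K m ≤ searchTime N K m' :=
  Finset.sum_le_sum_of_subset (Finset.Icc_subset_Icc_right h)

theorem searchTime_pred {m : ℕ} (h : 0 < m) :
    searchTime N K (m - 1) + 4000 * N * (K + 1) * (N / m) = searchTime N K m := by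
  obtain ⟨m, rfl⟩ := Nat.exists_eq_succ_of_ne_zero h.ne'
  rw [searchTime, searchTime, Finset.sum_Icc_succ_top (by omega)]
  rfl

/-- Correctness of `findExtending`.  Since the larger sets have properly extending words, the
assertion does not fail. -/
theorem ends_findExtending {M : SemiAutomaton (Fin N) (Fin K)} {S : Finset (Fin N)} {d : ℕ}
    (hp : procs[0]? = some findExtending) (hM : Context M s)
    (hd : s.reg depth = d) (harg : IsSet s arg d S) (hS : S ≠ Finset.univ)
    (hlarge : ∀ U : Finset (Fin N), S.card < U.card → U ≠ Finset.univ → Extendable M U) :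
    Ends procs findExtending s (searchTime N K (N - S.card)) fun s' =>
      Returned M S d s s' ∨ (Frame d s s' ∧ s'.reg status = 2 ∧ ¬ Extendable M S) := by
  induction hm : N - S.card using Nat.strong_induction_on generalizing S d s with
  | _ m ih =>
  have hcard := Finset.card_lt_card (Finset.ssubset_univ_iff.2 hS)
  rw [Finset.card_univ, Fintype.card_fin] at hcard
  have hm0 : 0 < m := by omega
  have hrec : ∀ s' U, S.card < U.card → U ≠ Finset.univ → Context M s' → s'.reg depth = d + 1 →
      IsSet s' arg (d + 1) U → Ends procs findExtending s' (searchTime N K (m - 1))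
        (Returned M U (d + 1) s') := by
    intro s' U hSU hU h₁ h₂ h₃
    refine (ih (N - U.card) (by omega) h₁ h₂ h₃ hU
      (fun V hV => hlarge V (hSU.trans hV)) rfl).mono (searchTime_mono (by omega)) ?_
    rintro s'' (h | h)
    · exact h
    · exact absurd (hlarge U hSU hU) h.2.2
  refine Ends.cons rfl (ends_start hM.n hd harg) fun s₁ h₁ u₁ => ?_
  obtain ⟨g₁, g₂, g₃, g₄, g₅, g₆, g₇⟩ := h₁
  have fr₁ : Frame d s s₁ := .of_unchanged u₁ (by decide) (by decide)
  have H : LoopInv M S d s (fun _ => id) ∅ s₁ := by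
    refine ⟨fr₁, g₁, g₇, ?_, fun i hi => ?_, fun i hi => ?_, fun p => .inr ⟨g₄ p, by simp⟩⟩
    · rw [g₅, g₆]
      exact Search.start rfl
    · obtain rfl : i = 0 := by omega
      intro p
      simpa using g₂ p
    · obtain rfl : i = 0 := by omega
      exact g₃
  refine Ends.cons_call (ends_searchLoop hM hd hS hp hrec (1 + K * (N / (N - S.card))) H
    (by omega)) fun s₂ h₂ => ?_
  refine (Ends.ite (T := 3) (fun hb => ?_) fun hb => ?_).le ?_
  · have hb' : s₂.reg status = 0 := by simpa [Cond.Holds, Expr.eval] using hb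
    rcases h₂ with h₂ | ⟨fr₂, -, hn⟩
    · rw [h₂.2.1] at hb'
      exact absurd hb' (by simp)
    · refine ((Ends.set_reg _ _).frame rfl).mono (by simp [Expr.cost]) fun s₃ ⟨h₃, u₃⟩ => ?_
      exact .inr ⟨fr₂.trans (.of_unchanged u₃ (by decide) (by decide)), h₃, hn⟩
  · refine (Ends.skip ?_).le (by omega)
    rcases h₂ with h₂ | ⟨-, h₂, -⟩
    · exact .inl h₂
    · exact absurd h₂ (by simpa [Cond.Holds, Expr.eval] using hb)
  · rw [hm]
    have hB : 1 ≤ N / m := (Nat.one_le_div_iff hm0).2 (by omega)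
    rw [← searchTime_pred hm0]
    generalize N / m = B at *
    simp only [Cond.cost, Expr.cost, Finset.card_empty, Nat.sub_zero]
    have h1 : 1 ≤ N := by omega
    have h2 : N * 100 + 100 + ((1 + K * B) * (N * 300 + 310) + B * (K * (N * 100 + 107)) +
        (N * 1000 + 1020)) + 10 ≤ 4000 * N * (K + 1) * B := by
      have e₁ : N ≤ N * B := Nat.le_mul_of_pos_right _ hB
      have e₂ : K * B ≤ K * B * N := Nat.le_mul_of_pos_right _ h1
      have e₃ : 1 + K * B ≤ B + K * B := by omega
      ring_nf at *
      omega
    omega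

/-! ### The steps of the main loop -/

theorem ends_fillBag (hN : s.reg n = N) :
    Ends procs fillBag s (N * (N * 20 + 20) + 20) fun s' =>
      s'.reg count = N ∧ ∀ p : Fin N, IsSet s' bag p (Finset.univ.erase p) := by
  refine Ends.cons rfl (Ends.for_var (T := N * 20 + 12) N
    (fun m s' => ∀ p : Fin N, p.1 < m → IsSet s' bag p (Finset.univ.erase p)) rfl
    (by decide) (by decide) (by decide) hN (by simp) fun m hm s' h u h' => ?_) fun s₁ h₁ u₁ => ?_
  · refine (ends_fill (N := N) bag m (fun j => if j = m then 0 else 1) rfl (by decide) (by decide)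
      ?_ fun l hl s'' k v k' i j => ?_).mono ?_ fun s'' k p hp r => ?_
    · simp (disch := decide) only [u.reg, hN]
    · have hi : s''.reg FindWitness.i = m := by simp (disch := decide) only [v.reg, h]
      simp only [Stmt.eff, Cond.Holds, Expr.eval, k, hi]
      by_cases g₁ : l = m <;> by_cases g₂ : i = m ∧ j = l <;> simp [State.setMem, g₁, g₂]
    · simp [Stmt.bound, Cond.cost, Expr.cost]
      omega
    · change s''.mem bag p r = _
      rcases Nat.lt_succ_iff_lt_or_eq.1 hp with hp | hp
      · rw [k, if_neg (by omega)]
        exact h' p hp r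
      · rw [k, if_pos ⟨hp, r.2⟩, ← hp]
        simp only [Finset.mem_erase, Finset.mem_univ, and_true, ← Fin.ext_iff]
        split_ifs <;> simp_all
  · refine ((Ends.set_reg _ _).frame rfl).mono ?_ fun s₂ ⟨h₂, u₂⟩ => ⟨?_, fun p r => ?_⟩
    · simp only [Expr.cost]
      have : N * (N * 20 + 12 + 7) ≤ N * (N * 20 + 20) := Nat.mul_le_mul_left _ (by omega)
      generalize N * (N * 20 + 20) = y at *
      omega
    · simp (disch := decide) only [h₂, Expr.eval, u₁.reg, hN]
    · rw [u₂.mem _ (by decide)]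
      exact h₁ p p.2 r

/-- A largest set `B b` is moved to `arg`, and the last set of the queue takes its place. -/
theorem ends_popLargest {B : ℕ → Finset (Fin N)} {c : ℕ} (hN : s.reg n = N)
    (hc : s.reg count = c) (hc0 : 0 < c) (hcN : c ≤ N) (hB : ∀ i < c, IsSet s bag i (B i)) :
    Ends procs popLargest s (N * (N * 20 + 30) + N * 40 + 50) fun s' =>
      ∃ b < c, (∀ j < c, (B j).card ≤ (B b).card) ∧ s'.reg count = c - 1 ∧
        IsSet s' arg 0 (B b) ∧
        ∀ i < c - 1, IsSet s' bag i (if i = b then B (c - 1) else B i) := by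
  refine Ends.cons rfl (Ends.set_reg _ _) fun s₁ h₁ u₁ => ?_
  refine Ends.cons rfl (Ends.set_reg _ _) fun s₂ h₂ u₂ => ?_
  refine Ends.cons rfl (Ends.for_var (T := N * 16 + 23) c (fun m s' => s'.reg best < c ∧
    s'.reg c₂ ≤ (B (s'.reg best)).card ∧ ∀ j < m, (B j).card ≤ s'.reg c₂) rfl
    (by decide) (by decide) (by decide) ?_ ?_ fun m hm s' h u ⟨g₁, g₂, g₃⟩ => ?_) fun s₃ h₃ u₃ => ?_
  · simp (disch := decide) only [u₂.reg, u₁.reg, hc]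
  · have e₁ : (s₂.setReg i 0).reg best = 0 := by
      change s₂.reg best = 0
      simp (disch := decide) only [u₂.reg, h₁, Expr.eval]
    have e₂ : (s₂.setReg i 0).reg c₂ = 0 := h₂
    rw [e₁, e₂]
    exact ⟨hc0, Nat.zero_le _, by simp⟩
  · refine Ends.cons rfl (ends_card (N := N) (T := B m) c₁ bag m _ (by decide) (by decide)
      ?_ ?_ fun s'' v => ?_) fun s₃ h₃ u₃ => ?_
    · simp (disch := decide) only [u.reg, u₂.reg, u₁.reg, hN]
    · intro p
      simp (disch := decide) only [u.mem, u₂.mem, u₁.mem]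
      exact hB m hm p
    · simp (disch := decide) only [Expr.eval, v.reg, h]
    have e₁ : s₃.reg best = s'.reg best := by simp (disch := decide) only [u₃.reg]
    have e₂ : s₃.reg c₂ = s'.reg c₂ := by simp (disch := decide) only [u₃.reg]
    have e₃ : s₃.reg i = m := by simp (disch := decide) only [u₃.reg, h]
    refine (Ends.ite (T := 6) (fun hb => ?_) fun hb => ?_).le ?_
    · have hb' : s'.reg c₂ < (B m).card := by simpa [Cond.Holds, Expr.eval, h₃, e₂] using hb
      refine Ends.cons rfl (Ends.set_reg _ _) fun s₄ h₄ u₄ => ?_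
      refine ((Ends.set_reg _ _).frame rfl).mono (by simp [Expr.cost]) fun s₅ ⟨h₅, u₅⟩ => ?_
      have e₄ : (s₅.setReg i (m + 1)).reg best = m := by
        change s₅.reg best = m
        simp (disch := decide) only [u₅.reg, h₄, Expr.eval, e₃]
      have e₅ : (s₅.setReg i (m + 1)).reg c₂ = (B m).card := by
        change s₅.reg c₂ = _
        simp (disch := decide) only [h₅, Expr.eval, u₄.reg, h₃]
      rw [e₄, e₅]
      refine ⟨hm, le_rfl, fun j hj => ?_⟩
      rcases Nat.lt_succ_iff_lt_or_eq.1 hj with hj | rfl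
      · exact (g₃ j hj).trans hb'.le
      · exact le_rfl
    · have hb' : (B m).card ≤ s'.reg c₂ := by simpa [Cond.Holds, Expr.eval, h₃, e₂] using hb
      refine (Ends.skip ?_).le (by omega)
      have e₄ : (s₃.setReg i (m + 1)).reg best = s'.reg best := e₁
      have e₅ : (s₃.setReg i (m + 1)).reg c₂ = s'.reg c₂ := e₂
      rw [e₄, e₅]
      refine ⟨g₁, g₂, fun j hj => ?_⟩
      rcases Nat.lt_succ_iff_lt_or_eq.1 hj with hj | rfl
      · exact g₃ j hj
      · exact hb'
    · simp only [Cond.cost, Expr.cost]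
      omega
  obtain ⟨g₁, g₂, g₃⟩ := h₃
  generalize hb : s₃.reg best = b at *
  have hN₃ : s₃.reg n = N := by simp (disch := decide) only [u₃.reg, u₂.reg, u₁.reg, hN]
  have hc₃ : s₃.reg count = c := by simp (disch := decide) only [u₃.reg, u₂.reg, u₁.reg, hc]
  have hB₃ : s₃.mem bag = s.mem bag := by simp (disch := decide) only [u₃.mem, u₂.mem, u₁.mem]
  refine Ends.cons rfl (ends_copy (N := N) arg 0 bag b _ _ hN₃ (fun _ _ => rfl) fun s' u => ?_)
    fun s₄ h₄ u₄ => ?_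
  · simp (disch := decide) only [Expr.eval, u.reg, hb]
  refine Ends.cons rfl (Ends.set_reg _ _) fun s₅ h₅ u₅ => ?_
  have hc₅ : s₅.reg count = c - 1 := by
    simp (disch := decide) only [h₅, Expr.eval, u₄.reg, hc₃]
  refine ((ends_copy (N := N) bag b bag (c - 1) _ _ ?_ (fun s' u => ?_) fun s' u => ?_).frame
    rfl).mono ?_ fun s₆ ⟨h₆, u₆⟩ => ⟨b, g₁, fun j hj => (g₃ j hj).trans g₂, ?_, fun p => ?_,
      fun i hi p => ?_⟩
  · simp (disch := decide) only [u₅.reg, u₄.reg, hN₃]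
  · simp (disch := decide) only [Expr.eval, u.reg, u₅.reg, u₄.reg, hb]
  · simp (disch := decide) only [Expr.eval, u.reg, hc₅]
  · simp only [Expr.cost]
    have : c * (N * 16 + 23 + 7) ≤ N * (N * 20 + 30) := Nat.mul_le_mul hcN (by omega)
    generalize c * _ = x at *
    generalize N * (N * 20 + 30) = y at *
    omega
  · simp (disch := decide) only [u₆.reg, hc₅]
  · simp (disch := decide) only [u₆.mem, u₅.mem, h₄]
    simpa [hB₃] using hB b g₁ p
  · have hB₅ : s₅.mem bag = s.mem bag := by simp (disch := decide) only [u₅.mem, u₄.mem, hB₃]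
    rw [h₆, hB₅]
    by_cases hib : i = b
    · rw [if_pos ⟨hib, p.2⟩, if_pos hib]
      exact hB (c - 1) (by omega) p
    · rw [if_neg fun h => hib h.1, if_neg hib]
      exact hB i (by omega) p

theorem ends_reduceAndPush {B : ℕ → Finset (Fin N)} {c : ℕ} {S : Finset (Fin N)}
    {f : Fin N → Fin N} (hN : s.reg n = N) (hc : s.reg count = c) (hcN : c ≤ N)
    (hB : ∀ i < c, IsSet s bag i (B i)) (hS : IsSet s arg 0 S) (hf : IsMap s ret 0 f) :
    Ends procs reduceAndPush s (N * (N * 20 + 50) + N * 100 + 100) fun s' =>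
      (∀ i < c, IsSet s' bag i (B i)) ∧
      ((s'.reg count = c + 1 ∧ (reduct S f).Nonempty ∧ IsSet s' bag c (reduct S f)) ∨
        (s'.reg count = c ∧ (reduct S f = ∅ ∨ ∃ i < c, B i = reduct S f))) := by
  refine Ends.cons rfl (ends_fill (N := N) cnt 0 (fun _ => 0) rfl (by decide) (by decide) hN
    fun m hm s' h u h' i j => ?_) fun s₁ h₁ u₁ => ?_
  · simp [Stmt.eff, State.setMem, Expr.eval, h]
  refine Ends.cons rfl (Ends.for_simple N (fun m s' => ∀ p : Fin N, s'.mem cnt 0 p =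
    ((Finset.range m).filter fun j => s.mem ret 0 j = p).card) rfl (by decide) (by decide)
    (by decide) ?_ ?_ fun m hm s' h u h' p => ?_) fun s₂ h₂ u₂ => ?_
  · simp (disch := decide) only [u₁.reg, hN]
  · intro p
    simp [State.setReg, h₁]
  · have hr : s'.mem ret = s.mem ret := by simp (disch := decide) only [u.mem, u₁.mem]
    have hm' : s.mem ret 0 m = f ⟨m, hm⟩ := hf ⟨m, hm⟩
    rw [card_filter_range_succ]
    simp only [Stmt.eff, Expr.eval, State.setReg, State.setMem, h, hr, hm', h', true_and,
      ← Fin.ext_iff, eq_comm (a := f ⟨m, hm⟩)]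
    by_cases hp : p = f ⟨m, hm⟩ <;> simp [hp]
  have hcnt : ∀ p : Fin N,
      s₂.mem cnt 0 p = (Finset.univ.filter fun q => f q = p).card := fun p => by
    rw [h₂ p]
    exact card_filter_range fun r => by simp [hf r, Fin.ext_iff]
  have hc₂ : s₂.reg count = c := by simp (disch := decide) only [u₂.reg, u₁.reg, hc]
  have hN₂ : s₂.reg n = N := by simp (disch := decide) only [u₂.reg, u₁.reg, hN]
  have hb₂ : s₂.mem bag = s.mem bag := by simp (disch := decide) only [u₂.mem, u₁.mem]
  have ha₂ : s₂.mem arg = s.mem arg := by simp (disch := decide) only [u₂.mem, u₁.mem]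
  refine Ends.cons rfl (ends_fill (N := N) bag c
    (fun j => if s.mem arg 0 j = 1 ∧ s₂.mem cnt 0 j = 1 then 1 else 0) rfl (by decide)
    (by decide) hN₂ fun m hm s' h u h' i j => ?_) fun s₃ h₃ u₃ => ?_
  · have e₁ : s'.reg count = c := by simp (disch := decide) only [u.reg, hc₂]
    have e₂ : s'.mem arg = s.mem arg := by simp (disch := decide) only [u.mem, ha₂]
    have e₃ : s'.mem cnt = s₂.mem cnt := by simp (disch := decide) only [u.mem]
    simp only [Stmt.eff, Cond.Holds, Expr.eval, h, e₁, e₂, e₃]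
    by_cases g₁ : s.mem arg 0 m = 1 ∧ s₂.mem cnt 0 m = 1 <;>
    by_cases g₂ : i = c ∧ j = m <;> simp [State.setMem, g₁, g₂]
  have hR₃ : IsSet s₃ bag c (reduct S f) := fun p => by
    simp only [h₃, p.2, and_self, if_true, hcnt p, hS p, reduct, Finset.mem_filter]
    by_cases hp : p ∈ S <;> simp [hp]
  have hB₃ : ∀ i < c, IsSet s₃ bag i (B i) := fun i hi p => by
    rw [h₃, if_neg fun h => hi.ne h.1, hb₂]
    exact hB i hi p
  have hc₃ : s₃.reg count = c := by simp (disch := decide) only [u₃.reg, hc₂]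
  have hN₃ : s₃.reg n = N := by simp (disch := decide) only [u₃.reg, hN₂]
  clear h₁ h₂ h₃ u₁ u₂ u₃ hcnt
  refine Ends.cons rfl (ends_card (N := N) (T := reduct S f) c₁ bag c _ (by decide) (by decide)
    hN₃ hR₃ fun s' u => ?_) fun s₄ h₄ u₄ => ?_
  · simp (disch := decide) only [Expr.eval, u.reg, hc₃]
  refine Ends.cons rfl (Ends.set_reg _ _) fun s₅ h₅ u₅ => ?_
  have hm₅ : s₅.mem = s₃.mem := by
    funext b
    rw [u₅.mem b List.not_mem_nil, u₄.mem b List.not_mem_nil]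
  refine Ends.cons rfl (Ends.for_var (T := N * 18 + 20) c (fun m s' =>
    (s'.reg dup = 0 ∧ ∀ i < m, B i ≠ reduct S f) ∨
    (s'.reg dup = 1 ∧ ∃ i < c, B i = reduct S f)) rfl
    (by decide) (by decide) (by decide) ?_ ?_ fun m hm s' h u g => ?_) fun s₆ h₆ u₆ => ?_
  · simp (disch := decide) only [u₅.reg, u₄.reg, hc₃]
  · exact .inl ⟨h₅, by simp⟩
  · have hm' : s'.mem = s₃.mem := by
      funext b
      rw [u.mem b List.not_mem_nil, hm₅]
    refine Ends.cons rfl (ends_compare (N := N) (T := B m) (T' := reduct S f) flag bag m c _ _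
      (by decide) (by decide) ?_ (fun p => ?_) (fun p => ?_) (fun s'' v => ?_) fun s'' v => ?_)
      fun s₆ h₆ u₆ => ?_
    · simp (disch := decide) only [u.reg, u₅.reg, u₄.reg, hN₃]
    · rw [hm']
      exact hB₃ m hm p
    · rw [hm']
      exact hR₃ p
    · simp (disch := decide) only [Expr.eval, v.reg, h]
    · simp (disch := decide) only [Expr.eval, v.reg, u.reg, u₅.reg, u₄.reg, hc₃]
    have hd₆ : s₆.reg dup = s'.reg dup := by simp (disch := decide) only [u₆.reg]
    refine (Ends.ite (T := 2) (fun hb => ?_) fun hb => ?_).le ?_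
    · have hb' : s₆.reg flag = 1 := by simpa [Cond.Holds, Expr.eval] using hb
      refine (Ends.set_reg _ _).mono (by simp [Expr.cost]) fun s₇ h₇ => .inr ⟨h₇, m, hm, ?_⟩
      rcases h₆ with h₆ | h₆
      · exact h₆.1
      · rw [h₆.2] at hb'
        exact absurd hb' (by simp)
    · have hb' : s₆.reg flag ≠ 1 := by simpa [Cond.Holds, Expr.eval] using hb
      refine (Ends.skip ?_).le (by omega)
      change (s₆.reg dup = 0 ∧ _) ∨ (s₆.reg dup = 1 ∧ _)
      rw [hd₆]
      refine g.imp_left fun g => ⟨g.1, fun i hi => ?_⟩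
      rcases Nat.lt_succ_iff_lt_or_eq.1 hi with hi | rfl
      · exact g.2 i hi
      · exact (h₆.resolve_left fun h => hb' h.2).1
    · simp only [Cond.cost, Expr.cost]
      omega
  have hm₆ : s₆.mem = s₃.mem := by
    funext b
    rw [u₆.mem b List.not_mem_nil, hm₅]
  have hc₆ : s₆.reg count = c := by simp (disch := decide) only [u₆.reg, u₅.reg, u₄.reg, hc₃]
  have h₄' : s₆.reg c₁ = (reduct S f).card := by simp (disch := decide) only [u₆.reg, u₅.reg, h₄]
  refine (Ends.ite (T := 3) (fun hb => ?_) fun hb => ?_).le ?_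
  · have hb' : 0 < (reduct S f).card ∧ s₆.reg dup = 0 := by
      simpa [Cond.Holds, Expr.eval, h₄'] using hb
    refine ((Ends.set_reg _ _).frame rfl).mono (by simp [Expr.cost]) fun s₇ ⟨h₇, u₇⟩ => ?_
    have hm₇ : s₇.mem = s₃.mem := by
      funext b
      rw [u₇.mem b List.not_mem_nil, hm₆]
    refine ⟨fun i hi p => ?_, .inl ⟨?_, Finset.card_pos.1 hb'.1, fun p => ?_⟩⟩
    · rw [hm₇]
      exact hB₃ i hi p
    · simp only [h₇, Expr.eval, hc₆]
    · rw [hm₇]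
      exact hR₃ p
  · have hb' : 0 < (reduct S f).card → s₆.reg dup ≠ 0 := by
      simpa [Cond.Holds, Expr.eval, h₄'] using hb
    refine (Ends.skip ?_).le (by omega)
    refine ⟨fun i hi p => ?_, .inr ⟨hc₆, ?_⟩⟩
    · rw [hm₆]
      exact hB₃ i hi p
    · by_cases h0 : reduct S f = ∅
      · exact .inl h0
      · right
        exact (h₆.resolve_left fun h =>
          hb' (Finset.card_pos.2 (Finset.nonempty_iff_ne_empty.2 h0)) h.1).2
  · simp [Stmt.bound, Cond.cost, Expr.cost]
    have : c * (N * 18 + 20 + 7) ≤ N * (N * 20 + 50) := Nat.mul_le_mul hcN (by omega)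
    generalize c * _ = x at *
    generalize N * (N * 20 + 50) = y at *
    omega

/-! ### The main loop -/

/-- The invariant of the main loop of the algorithm: every set without a properly extending word
is contained in one of the `c` sets of the priority queue. -/
structure MainInv (M : SemiAutomaton (Fin N) (Fin K)) (B : ℕ → Finset (Fin N)) (c : ℕ)
    (s : State) : Prop where
  context : Context M s
  done : s.reg done = 0
  result : s.reg result = 0
  count : s.reg count = c
  le : c ≤ N
  sets : ∀ i < c, IsSet s bag i (B i)
  nonempty : ∀ i < c, (B i).Nonempty
  ne_univ : ∀ i < c, B i ≠ Finset.univ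
  cover : ∀ T : Finset (Fin N), T.Nonempty → T ≠ Finset.univ → ¬ Extendable M T →
    ∃ i < c, T ⊆ B i

/-- The answer of the algorithm is correct. -/
def Answered (M : SemiAutomaton (Fin N) (Fin K)) (s : State) : Prop :=
  (s.reg result = 0 ∧ ∀ S : Finset (Fin N), S.Nonempty → S ≠ Finset.univ → Extendable M S) ∨
  (s.reg result = 1 ∧ ∃ S : Finset (Fin N), IsSet s out 0 S ∧ S.Nonempty ∧ S ≠ Finset.univ ∧
    ¬ Extendable M S ∧ ∀ T : Finset (Fin N), S.card < T.card → T ≠ Finset.univ → Extendable M T)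

/-- The body of the main loop of the algorithm. -/
abbrev mainBody : Stmt :=
  block [
    popLargest,
    .set depth (.lit 0),
    .call 0,
    .ite (.eq (.var status) (.lit 1))
      reduceAndPush
      (block [
        .set done (.lit 1),
        .ite (.eq (.var status) (.lit 2))
          (block [
            copy out (.lit 0) arg (.lit 0),
            .set result (.lit 1)])
          (.set result (.lit 2))])]

/-- A bound for the running time of one round of the main loop, in which the search concerns a
non-empty set. -/
def roundTime (N K : ℕ) : ℕ :=
  N * (N * 40 + 80) + N * 140 + 300 + searchTime N K (N - 1)

/-- The effect of popping the set `B b` on the sum of the sizes. -/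
theorem sum_card_pop {B : ℕ → Finset (Fin N)} {b c : ℕ} (hb : b < c) :
    ∑ i ∈ Finset.range (c - 1), (if i = b then B (c - 1) else B i).card + (B b).card =
      ∑ i ∈ Finset.range c, (B i).card := by
  obtain ⟨c, rfl⟩ := Nat.exists_eq_succ_of_ne_zero (by omega : c ≠ 0)
  simp only [Nat.succ_eq_add_one, Nat.add_sub_cancel]
  rw [Finset.sum_range_succ]
  rcases Nat.lt_succ_iff_lt_or_eq.1 hb with hb | rfl
  · have hb' := Finset.mem_range.2 hb
    rw [← Finset.add_sum_erase _ _ hb', ← Finset.add_sum_erase _ (fun i => (B i).card) hb',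
      Finset.sum_congr rfl fun i hi => by rw [if_neg (Finset.ne_of_mem_erase hi)]]
    simp only [if_true]
    omega
  · rw [Finset.sum_congr rfl fun i hi => by rw [if_neg (Finset.mem_range.1 hi).ne]]

/-- One round of the main loop decreases the sum of the sizes of the sets in the queue, or ends the
loop with a correct answer. -/
theorem ends_mainBody {M : SemiAutomaton (Fin N) (Fin K)} {B : ℕ → Finset (Fin N)} {c : ℕ}
    (hp : procs[0]? = some findExtending) (H : MainInv M B c s) (hc : 0 < c) :
    Ends procs mainBody s (roundTime N K) fun s' =>
      (∃ B' c', MainInv M B' c' s' ∧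
        ∑ i ∈ Finset.range c', (B' i).card < ∑ i ∈ Finset.range c, (B i).card) ∨
      (s'.reg done = 1 ∧ Answered M s') := by
  refine Ends.cons rfl (ends_popLargest H.context.n H.count hc H.le H.sets) fun s₁ h₁ u₁ => ?_
  obtain ⟨b, hb, hmax, hc₁, hS₁, hB₁⟩ := h₁
  refine Ends.cons rfl (Ends.set_reg _ _) fun s₂ h₂ u₂ => ?_
  have hM₂ : Context M s₂ := (H.context.of_unchanged u₁ (by decide) (by decide)
    (by decide)).of_unchanged u₂ (by decide) (by decide) (by decide)
  -- A larger set without properly extending word would lie in a set larger than `B b`.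
  have hlarge : ∀ T : Finset (Fin N), (B b).card < T.card → T ≠ Finset.univ →
      Extendable M T := by
    intro T hT hT'
    by_contra hn
    obtain ⟨j, hj, hjj⟩ := H.cover T (Finset.card_pos.1 (by omega)) hT' hn
    have := Finset.card_le_card hjj
    have := hmax j hj
    omega
  have hsum := sum_card_pop (B := B) hb
  refine Ends.cons_call (Ends.call hp (ends_findExtending hp hM₂ (d := 0) (S := B b) h₂ ?_
    (H.ne_univ b hb) hlarge)) fun s₃ h₃ => ?_
  · intro p
    simp (disch := decide) only [u₂.mem]
    exact hS₁ p
  have fr : Frame 0 s₂ s₃ := h₃.elim (fun h => h.1) fun h => h.1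
  have hc₃ : s₃.reg count = c - 1 := by
    rw [fr.reg _ (by decide)]
    simp (disch := decide) only [u₂.reg, hc₁]
  have hM₃ := hM₂.of_frame fr
  have hdone₃ : s₃.reg done = 0 := by
    rw [fr.reg _ (by decide)]
    simp (disch := decide) only [u₂.reg, u₁.reg, H.done]
  have hres₃ : s₃.reg result = 0 := by
    rw [fr.reg _ (by decide)]
    simp (disch := decide) only [u₂.reg, u₁.reg, H.result]
  have hB₃ : ∀ i < c - 1, IsSet s₃ bag i (if i = b then B (c - 1) else B i) := fun i hi p => by
    rw [fr.mem _ (by decide)]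
    simp (disch := decide) only [u₂.mem]
    exact hB₁ i hi p
  have hS₃ : IsSet s₃ arg 0 (B b) := fun p => by
    rw [fr.arg _ le_rfl]
    simp (disch := decide) only [u₂.mem]
    exact hS₁ p
  refine (Ends.ite (T := N * (N * 20 + 50) + N * 100 + 100) (fun hst => ?_) fun hst => ?_).le ?_
  · have hst' : s₃.reg status = 1 := by simpa [Cond.Holds, Expr.eval] using hst
    obtain ⟨-, -, f, hf, hE⟩ := h₃.resolve_right fun h => by simp [h.2.1] at hst'
    refine ((ends_reduceAndPush hM₃.n hc₃ (by have := H.le; omega) hB₃ hS₃ hf).frame rfl).mono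
      le_rfl fun s₄ ⟨⟨h₄, h₅⟩, u₄⟩ => .inl ?_
    have hR := hE.card_reduct_lt
    have hne : ∀ i < c - 1, (if i = b then B (c - 1) else B i).Nonempty := fun i hi => by
      split_ifs
      · exact H.nonempty _ (by omega)
      · exact H.nonempty _ (by omega)
    have hnu : ∀ i < c - 1, (if i = b then B (c - 1) else B i) ≠ Finset.univ := fun i hi => by
      split_ifs
      · exact H.ne_univ _ (by omega)
      · exact H.ne_univ _ (by omega)
    have hcov : ∀ T : Finset (Fin N), T.Nonempty → T ≠ Finset.univ → ¬ Extendable M T →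
        (∃ i < c - 1, T ⊆ if i = b then B (c - 1) else B i) ∨ T ⊆ reduct (B b) f := by
      intro T h₁ h₂ h₃
      obtain ⟨i, hi, hT⟩ := H.cover T h₁ h₂ h₃
      by_cases hib : i = b
      · exact .inr (hE.subset_reduct (hib ▸ hT) h₃)
      · left
        by_cases hic : i = c - 1
        · exact ⟨b, by omega, by rwa [if_pos rfl, ← hic]⟩
        · exact ⟨i, by omega, by rwa [if_neg hib]⟩
    have hM₄ := hM₃.of_unchanged u₄ (by decide) (by decide) (by decide)
    have hdone₄ : s₄.reg done = 0 := by simp (disch := decide) only [u₄.reg, hdone₃]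
    have hres₄ : s₄.reg result = 0 := by simp (disch := decide) only [u₄.reg, hres₃]
    rcases h₅ with ⟨hc₄, hRne, hR₄⟩ | ⟨hc₄, hdup⟩
    · refine ⟨fun i => if i < c - 1 then if i = b then B (c - 1) else B i else reduct (B b) f,
        c - 1 + 1, ⟨hM₄, hdone₄, hres₄, hc₄, by have := H.le; omega, fun i hi => ?_, fun i hi => ?_,
        fun i hi => ?_, fun T h₁ h₂ h₃ => ?_⟩, ?_⟩
      · by_cases hic : i < c - 1
        · simp only [if_pos hic]
          exact h₄ i hic
        · simp only [if_neg hic]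
          obtain rfl : i = c - 1 := by omega
          exact hR₄
      · by_cases hic : i < c - 1
        · simp only [if_pos hic]
          exact hne i hic
        · simp only [if_neg hic]
          exact hRne
      · by_cases hic : i < c - 1
        · simp only [if_pos hic]
          exact hnu i hic
        · simp only [if_neg hic]
          intro hEq
          rw [hEq] at hR
          exact absurd (Finset.card_le_univ (B b)) (not_le.2 hR)
      · rcases hcov T h₁ h₂ h₃ with ⟨i, hi, hT⟩ | hT
        · exact ⟨i, by omega, by simpa only [if_pos hi] using hT⟩
        · exact ⟨c - 1, by omega, by simpa only [if_neg (lt_irrefl _)] using hT⟩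
      · beta_reduce
        rw [Finset.sum_range_succ, if_neg (lt_irrefl _),
          Finset.sum_congr rfl fun i hi => by rw [if_pos (Finset.mem_range.1 hi)]]
        omega
    · refine ⟨fun i => if i = b then B (c - 1) else B i, c - 1, ⟨hM₄, hdone₄, hres₄, hc₄,
        by have := H.le; omega, h₄, hne, hnu, fun T h₁ h₂ h₃ => ?_⟩, ?_⟩
      · rcases hcov T h₁ h₂ h₃ with hT | hT
        · exact hT
        · rcases hdup with h0 | ⟨i, hi, hiR⟩
          · rw [h0, Finset.subset_empty] at hT
            exact absurd h₁ (by simp [hT])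
          · exact ⟨i, hi, by rwa [hiR]⟩
      · have := Finset.card_pos.2 (H.nonempty b hb)
        beta_reduce
        omega
  · have hst' : s₃.reg status ≠ 1 := by simpa [Cond.Holds, Expr.eval] using hst
    obtain ⟨-, hst₂, hn⟩ := h₃.resolve_left fun h => hst' h.2.1
    refine Ends.cons rfl (Ends.set_reg _ _) fun s₄ h₄ u₄ => ?_
    have hst₄ : s₄.reg status = 2 := by simp (disch := decide) only [u₄.reg, hst₂]
    refine (Ends.ite (T := N * 20 + 20) (fun _ => ?_) fun hn => ?_).le ?_
    · refine Ends.cons rfl (ends_copy (N := N) out 0 arg 0 _ _ ?_ (fun _ _ => rfl)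
        fun _ _ => rfl) fun s₅ h₅ u₅ => ?_
      · simp (disch := decide) only [u₄.reg, hM₃.n]
      refine ((Ends.set_reg _ _).frame rfl).mono ?_ fun s₆ ⟨h₆, u₆⟩ =>
        .inr ⟨?_, .inr ⟨h₆, B b, fun p => ?_, H.nonempty b hb, H.ne_univ b hb, hn, hlarge⟩⟩
      · simp only [Expr.cost]
        omega
      · simp (disch := decide) only [u₆.reg, u₅.reg, h₄, Expr.eval]
      · simp (disch := decide) only [u₆.mem, h₅, u₄.mem]
        simpa using hS₃ p
    · exact absurd hst₄ hn
    · simp only [Cond.cost, Expr.cost]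
      have : N * 20 ≤ N * (N * 20 + 50) := by nlinarith
      omega
  · have h1 : searchTime N K (N - (B b).card) ≤ searchTime N K (N - 1) :=
      searchTime_mono (by have := Finset.card_pos.2 (H.nonempty b hb); omega)
    simp only [Cond.cost, Expr.cost, roundTime]
    rw [show N * (N * 40 + 80) = N * (N * 20 + 30) + N * (N * 20 + 50) by ring]
    omega

/-- A bound for the running time of the algorithm. -/
def mainTime (N K : ℕ) : ℕ :=
  N * (N * 20 + 20) + 50 + N * N * (roundTime N K + 10)

/-- The main loop; the sum of the sizes of the sets in the queue bounds the number of rounds. -/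
theorem ends_mainLoop {M : SemiAutomaton (Fin N) (Fin K)} (hp : procs[0]? = some findExtending)
    (l : ℕ) {B : ℕ → Finset (Fin N)} {c : ℕ} (H : MainInv M B c s)
    (hl : ∑ i ∈ Finset.range c, (B i).card ≤ l) :
    Ends procs (.while (.and (.eq (.var done) (.lit 0)) (.lt (.lit 0) (.var count))) mainBody) s
      (l * (roundTime N K + 8) + 8) (Answered M) := by
  induction l using Nat.strong_induction_on generalizing B c s with
  | _ l ih =>
  rcases Nat.eq_zero_or_pos c with hc | hc
  · refine (Ends.while_false ?_ (.inl ⟨H.result, fun S h₁ h₂ => ?_⟩)).le ?_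
    · simp [Cond.Holds, Expr.eval, H.count, hc]
    · simp [Cond.cost, Expr.cost]
    · by_contra hn
      obtain ⟨i, hi, -⟩ := H.cover S h₁ h₂ hn
      omega
  · have hb : (Cond.and (.eq (.var done) (.lit 0)) (.lt (.lit 0) (.var count))).Holds s := by
      simp [Cond.Holds, Expr.eval, H.done, H.count, hc]
    obtain ⟨t, s₁, x, ht, ⟨B', c', H', hlt⟩ | ⟨hd, ha⟩⟩ := ends_mainBody hp H hc
    · obtain ⟨t', s₂, x', ht', h₂⟩ := ih (l - 1) (by omega) H' (by omega)
      refine ⟨_, s₂, .while_true hb x x', ?_, h₂⟩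
      obtain ⟨l, rfl⟩ := Nat.exists_eq_succ_of_ne_zero (by omega : l ≠ 0)
      simp only [Nat.succ_sub_one] at ht'
      simp only [Cond.cost, Expr.cost, Nat.succ_mul]
      omega
    · refine ⟨_, s₁, .while_true hb x (.while_false ?_), ?_, ha⟩
      · simp [Cond.Holds, Expr.eval, hd]
      · have h0 := Finset.single_le_sum (f := fun i => (B i).card) (fun _ _ => Nat.zero_le _)
          (Finset.mem_range.2 hc)
        have h1 := Finset.card_pos.2 (H.nonempty 0 hc)
        obtain ⟨l, rfl⟩ := Nat.exists_eq_succ_of_ne_zero (by omega : l ≠ 0)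
        simp only [Cond.cost, Expr.cost, Nat.succ_mul]
        omega

/-- Correctness of the algorithm, started in a memory that holds its input. -/
theorem ends_main {M : SemiAutomaton (Fin N) (Fin K)} (hp : procs[0]? = some findExtending)
    (hN : 2 ≤ N) (hM : Context M s) : Ends procs main s (mainTime N K) (Answered M) := by
  refine Ends.cons rfl (ends_fillBag hM.n) fun s₁ ⟨h₁, h₁'⟩ u₁ => ?_
  refine Ends.cons rfl (Ends.set_reg _ _) fun s₂ h₂ u₂ => ?_
  refine Ends.cons rfl (Ends.set_reg _ _) fun s₃ h₃ u₃ => ?_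
  have hcard : ∀ p : Fin N, (Finset.univ.erase p).card = N - 1 := fun p => by
    rw [Finset.card_erase_of_mem (Finset.mem_univ p), Finset.card_univ, Fintype.card_fin]
  refine (ends_mainLoop hp (N * N) (c := N)
    (B := fun i => if h : i < N then Finset.univ.erase ⟨i, h⟩ else ∅)
    ⟨?_, h₃, ?_, ?_, le_rfl, fun i hi p => ?_, fun i hi => ?_, fun i hi => ?_,
      fun T _ hT _ => ?_⟩ ?_).le ?_
  · exact ((hM.of_unchanged u₁ (by decide) (by decide) (by decide)).of_unchanged u₂ (by decide)
      (by decide) (by decide)).of_unchanged u₃ (by decide) (by decide) (by decide)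
  · simp (disch := decide) only [u₃.reg, h₂, Expr.eval]
  · simp (disch := decide) only [u₃.reg, u₂.reg, h₁]
  · simp (disch := decide) only [u₃.mem, u₂.mem, dif_pos hi]
    exact h₁' ⟨i, hi⟩ p
  · simp only [dif_pos hi]
    rw [← Finset.card_pos, hcard]
    omega
  · simp only [dif_pos hi]
    exact fun h => by simpa using h.ge (Finset.mem_univ (⟨i, hi⟩ : Fin N))
  · obtain ⟨p, hp⟩ : ∃ p, p ∉ T := by
      by_contra! h
      exact hT (Finset.eq_univ_of_forall h)
    refine ⟨p, p.2, ?_⟩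
    rw [dif_pos p.2]
    exact Finset.subset_erase.2 ⟨Finset.subset_univ _, hp⟩
  · refine (Finset.sum_le_card_nsmul _ _ N fun i hi => ?_).trans_eq (by simp)
    exact (Finset.card_le_univ _).trans_eq (Fintype.card_fin N)
  · simp only [Expr.cost, mainTime]
    have h4 : 4 ≤ N * N := Nat.mul_le_mul hN hN
    rw [show N * N * (roundTime N K + 10) = N * N * (roundTime N K + 8) + N * N * 2 by ring]
    generalize N * N * (roundTime N K + 8) = x at *
    generalize N * (N * 20 + 20) = y at *
    omega

/-! ### The answer and the running time -/

theorem Answered.correct {M : SemiAutomaton (Fin N) (Fin K)} (h : Answered M s) :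
    (ReturnsNone s ∧ (¬ ∃ S, M.IsWitness S) ∧ M.CompletelyReachable) ∨
      ∃ S, Returns s S ∧ M.IsWitness S := by
  rcases h with ⟨h₁, h₂⟩ | ⟨h₁, S, h₂, h₃, h₄, h₅, h₆⟩
  · have hc : M.CompletelyReachable := fun S hS => reachable_of_extendable fun T hT hST =>
      h₂ T (Finset.card_pos.1 ((Finset.card_pos.2 hS).trans_le hST)) hT
    exact .inl ⟨h₁, fun ⟨S, hS⟩ => hS.2.2.1 (hc S hS.1), hc⟩
  · refine .inr ⟨S, ⟨h₁, fun p => by simp [h₂ p]⟩, h₃, Finset.ssubset_univ_iff.2 h₄,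
      not_reachable_of_not_extendable h₅ h₄, fun T hT => ?_⟩
    by_contra! hST
    exact hT (reachable_of_extendable fun U hU hTU => h₆ U (hST.trans_le hTU) hU)

theorem searchTime_le (m : ℕ) : (searchTime N K m : ℝ) ≤
    4000 * N ^ 2 * (K + 1) * ∑ j ∈ Finset.Icc 1 m, (j : ℝ)⁻¹ := by
  rw [searchTime, Nat.cast_sum, Finset.mul_sum]
  refine Finset.sum_le_sum fun j _ => ?_
  push_cast
  have : ((N / j : ℕ) : ℝ) ≤ N * (j : ℝ)⁻¹ := Nat.cast_div_le
  calc 4000 * (N : ℝ) * (K + 1) * ((N / j : ℕ) : ℝ)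
      ≤ 4000 * (N : ℝ) * (K + 1) * (N * (j : ℝ)⁻¹) := by gcongr
    _ = _ := by ring

/-- The harmonic sum in the time of the search is at most `1 + log N`, and `1 ≤ 2 log N`. -/
theorem mainTime_le (hN : 2 ≤ N) (hK : 1 ≤ K) :
    (mainTime N K : ℝ) ≤ 30000 * ((N : ℝ) ^ 4 * Real.log N * K) := by
  have h2 : (2 : ℝ) ≤ N := by exact_mod_cast hN
  have h1 : (1 : ℝ) ≤ K := by exact_mod_cast hK
  have hL : 1 ≤ 2 * Real.log N := by
    have h3 := Real.log_two_gt_d9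
    have h4 := Real.log_le_log (by norm_num) h2
    linarith
  have hH : ∑ j ∈ Finset.Icc 1 (N - 1), (j : ℝ)⁻¹ ≤ 3 * Real.log N := by
    have h5 : ∑ j ∈ Finset.Icc 1 (N - 1), (j : ℝ)⁻¹ ≤ ∑ j ∈ Finset.Icc 1 N, (j : ℝ)⁻¹ :=
      Finset.sum_le_sum_of_subset_of_nonneg (Finset.Icc_subset_Icc_right (Nat.sub_le _ _))
        fun _ _ _ => by positivity
    have h6 := harmonic_le_one_add_log N
    rw [harmonic_eq_sum_Icc] at h6
    push_cast at h6
    linarith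
  have hs : (searchTime N K (N - 1) : ℝ) ≤ 24000 * N ^ 2 * K * Real.log N := by
    refine (searchTime_le _).trans ?_
    calc 4000 * (N : ℝ) ^ 2 * (K + 1) * ∑ j ∈ Finset.Icc 1 (N - 1), (j : ℝ)⁻¹
        ≤ 4000 * (N : ℝ) ^ 2 * (K + K) * (3 * Real.log N) := by gcongr
      _ = _ := by ring
  have hKL : 1 ≤ 2 * (K * Real.log N) := by nlinarith
  generalize Real.log N = L at *
  have hr : (roundTime N K : ℝ) + 10 ≤ 25000 * N ^ 2 * (K * L) := by
    rw [roundTime]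
    push_cast
    have e₁ : (N : ℝ) * (N * 40 + 80) + N * 140 + 310 ≤ 300 * N ^ 2 * 1 := by nlinarith
    have e₂ : 300 * (N : ℝ) ^ 2 * 1 ≤ 300 * N ^ 2 * (2 * (K * L)) := by gcongr
    nlinarith [sq_nonneg (N : ℝ)]
  rw [mainTime]
  push_cast
  have e₃ : (N : ℝ) * (N * 20 + 20) + 50 ≤ 50 * N ^ 4 * 1 := by
    have g₁ : (2 : ℝ) ^ 2 ≤ N ^ 2 := pow_le_pow_left₀ (by norm_num) h2 2
    have g₂ : (2 : ℝ) ^ 4 ≤ N ^ 4 := pow_le_pow_left₀ (by norm_num) h2 4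
    have g₃ : (2 : ℝ) * 2 ≤ N * N := mul_le_mul h2 h2 (by norm_num) (by linarith)
    nlinarith [sq_nonneg ((N : ℝ) ^ 2)]
  have e₄ : 50 * (N : ℝ) ^ 4 * 1 ≤ 50 * N ^ 4 * (2 * (K * L)) := by gcongr
  have e₅ : (N : ℝ) * N * (roundTime N K + 10) ≤ N * N * (25000 * N ^ 2 * (K * L)) := by gcongr
  have e₆ : 0 ≤ (N : ℝ) ^ 4 * (K * L) := by
    have : 0 ≤ K * L := by linarith
    positivity
  nlinarith

/-- A polynomial bound for the running time of the algorithm. -/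
theorem mainTime_le_pow {l : ℕ} (hN : N ≤ l) (hK : K ≤ l) (hl : 1 ≤ l) :
    mainTime N K ≤ 10000 * l ^ 6 := by
  have h₁ : searchTime N K (N - 1) ≤ 8000 * l ^ 4 := by
    have : searchTime N K (N - 1) ≤ (N - 1) * (4000 * N * (K + 1) * N) := by
      refine (Finset.sum_le_card_nsmul _ _ (4000 * N * (K + 1) * N) fun j _ => ?_).trans_eq
        (by simp)
      exact Nat.mul_le_mul_left _ (Nat.div_le_self _ _)
    refine this.trans ?_
    calc (N - 1) * (4000 * N * (K + 1) * N) ≤ l * (4000 * l * (l + l) * l) := by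
          gcongr
          omega
      _ = _ := by ring
  have h₂ : roundTime N K + 10 ≤ 9000 * l ^ 4 := by
    have e₁ : N * (N * 40 + 80) + N * 140 + 310 ≤ l * (l * 40 + 80) + l * 140 + 310 := by gcongr
    have e₂ : l ≤ l ^ 4 := Nat.le_self_pow (by norm_num) l
    have e₃ : l * l ≤ l ^ 4 := by
      calc l * l = l ^ 2 := by ring
        _ ≤ l ^ 4 := Nat.pow_le_pow_right hl (by norm_num)
    rw [roundTime]
    nlinarith
  have h₃ : N * N * (roundTime N K + 10) ≤ l * l * (9000 * l ^ 4) := by gcongr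
  have h₄ : N * (N * 20 + 20) + 50 ≤ l * (l * 20 + 20) + 50 := by gcongr
  have e₁ : l ≤ l ^ 6 := Nat.le_self_pow (by norm_num) l
  have e₂ : l * l ≤ l ^ 6 := by
    calc l * l = l ^ 2 := by ring
      _ ≤ l ^ 6 := Nat.pow_le_pow_right hl (by norm_num)
  rw [mainTime]
  nlinarith

theorem context_input (M : SemiAutomaton (Fin N) (Fin K)) : Context M (input M) :=
  ⟨rfl, rfl, fun p l => by simp [input]⟩

end FindWitness

/-! ### Codes of automata -/

theorem unary_succ_append (m : ℕ) (r : List Bool) :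
    unary (m + 1) ++ r = true :: (unary m ++ r) := by
  simp [unary, List.replicate_succ]

theorem unary_append_inj {m m' : ℕ} {r r' : List Bool} (h : unary m ++ r = unary m' ++ r') :
    m = m' ∧ r = r' := by
  induction m generalizing m' with
  | zero =>
    cases m' with
    | zero => exact ⟨rfl, by simpa [unary] using h⟩
    | succ m' => simp [unary, List.replicate_succ] at h
  | succ m ih =>
    cases m' with
    | zero => simp [unary, List.replicate_succ] at h
    | succ m' =>
      rw [unary_succ_append, unary_succ_append] at h
      obtain ⟨rfl, rfl⟩ := ih (List.cons.inj h).2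
      exact ⟨rfl, rfl⟩

theorem replicate_true_ne_unary_append (m m' : ℕ) (r : List Bool) :
    List.replicate m true ≠ unary m' ++ r := fun h => by
  have : false ∈ List.replicate m true := h ▸ by simp [unary]
  simp at this

section Code

variable {N K : ℕ} (M : SemiAutomaton (Fin N) (Fin K))

/-- The code of row `p` of the transition table, from column `j` on. -/
def rowCode (p : Fin N) (j : ℕ) : List Bool :=
  ((List.finRange K).drop j).flatMap fun l => unary (M.step p l)

/-- The code of the transition table, from row `i` on. -/
def tableCode (i : ℕ) : List Bool :=
  ((List.finRange N).drop i).flatMap fun p => rowCode M p 0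

theorem encode_eq : encode M = unary N ++ (unary K ++ tableCode M 0) := by
  simp [encode, tableCode, rowCode]

theorem rowCode_of_lt (p : Fin N) {j : ℕ} (hj : j < K) :
    rowCode M p j = unary (M.step p ⟨j, hj⟩) ++ rowCode M p (j + 1) := by
  rw [rowCode, List.drop_eq_getElem_cons (by simpa using hj)]
  simp [rowCode]

theorem rowCode_self (p : Fin N) : rowCode M p K = [] := by
  rw [rowCode, List.drop_eq_nil_of_le (by simp)]
  rfl

theorem tableCode_of_lt {i : ℕ} (hi : i < N) :
    tableCode M i = rowCode M ⟨i, hi⟩ 0 ++ tableCode M (i + 1) := by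
  rw [tableCode, List.drop_eq_getElem_cons (by simpa using hi)]
  simp [tableCode]

theorem tableCode_self : tableCode M N = [] := by
  rw [tableCode, List.drop_eq_nil_of_le (by simp)]
  rfl

end Code

namespace FindWitness

variable {procs : List Stmt} {N K : ℕ} {s : State}

/-! ### Reading the code of an automaton -/

/-- the length of the input string -/
abbrev len : ℕ := 20
/-- the position of the next bit to be read -/
abbrev pos : ℕ := 21
/-- whether the input string has turned out not to be the code of an automaton -/
abbrev bad : ℕ := 22
/-- the number that was read last -/
abbrev val : ℕ := 23
/-- the state whose row of the transition table is being read -/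
abbrev row : ℕ := 24
/-- the letter whose column of the transition table is being read -/
abbrev col : ℕ := 25
/-- row `0` is the input string -/
abbrev bits : ℕ := 13

/-- Read a number in unary code; `bad` is set if the input string ends before the number does. -/
def readUnary : Stmt :=
  block [
    .set val (.lit 0),
    .while (.and (.lt (.var pos) (.var len))
        (.eq (.get bits (.lit 0) (.var pos)) (.lit 1))) (block [
      .set val (.succ (.var val)),
      .set pos (.succ (.var pos))]),
    .ite (.lt (.var pos) (.var len)) (.set pos (.succ (.var pos))) (.set bad (.lit 1))]

/-- Read the transition table; `bad` is set if an entry is not a state. -/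
def readTable : Stmt :=
  for_ row (.var n) (for_ col (.var k) (block [
    readUnary,
    .put delta (.var row) (.var col) (.var val),
    when (.not (.lt (.var val) (.var n))) (.set bad (.lit 1))]))

/-- The program that decides whether a bit string is the code of a completely reachable
automaton.  The input string is copied first, because its length is given in register `n` and its
bits in the array `delta`.  Bits that remain there outside the transition table are harmless. -/
def decider : Program where
  main := block [
    .set len (.var 0),
    for_ pos (.var len) (.put bits (.lit 0) (.var pos) (.get delta (.lit 0) (.var pos))),
    .set pos (.lit 0),
    .set bad (.lit 0),
    readUnary,
    .set n (.var val),
    readUnary,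
    .set k (.var val),
    readTable,
    .ite (.and (.eq (.var bad) (.lit 0)) (.eq (.var pos) (.var len)))
      (.ite (.lt (.var n) (.lit 2))
        (.set 0 (.lit 1))
        (block [main, .ite (.eq (.var result) (.lit 0)) (.set 0 (.lit 1)) (.set 0 (.lit 0))]))
      (.set 0 (.lit 0))]
  procs := [findExtending]

/-- The bit string `x` is stored, and the rest `r` of it has not been read yet. -/
structure Reading (x r : List Bool) (s : State) : Prop where
  len : s.reg len = x.length
  bits : ∀ i < x.length, s.mem bits 0 i = if x[i]? = some true then 1 else 0
  pos : s.reg pos ≤ x.length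
  rest : x.drop (s.reg FindWitness.pos) = r

theorem Reading.of_unchanged {x r : List Bool} {c : Stmt} {s' : State} (h : Reading x r s)
    (u : Unchanged c s s') (hl : FindWitness.len ∉ c.regs) (hp : FindWitness.pos ∉ c.regs)
    (hb : FindWitness.bits ∉ c.arrays) : Reading x r s' :=
  ⟨by rw [u.reg _ hl, h.len], fun i hi => by rw [u.mem _ hb, h.bits i hi],
    by rw [u.reg _ hp]; exact h.pos, by rw [u.reg _ hp, h.rest]⟩

theorem Reading.cons {x r : List Bool} {b : Bool} (h : Reading x (b :: r) s) :
    s.reg FindWitness.pos < x.length ∧ x[s.reg FindWitness.pos]? = some b ∧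
      x.drop (s.reg FindWitness.pos + 1) = r := by
  have h₁ : s.reg FindWitness.pos < x.length := by
    have h₂ := congrArg List.length h.rest
    simp at h₂
    omega
  have h₃ := h.rest
  rw [List.drop_eq_getElem_cons h₁] at h₃
  refine ⟨h₁, ?_, (List.cons.inj h₃).2⟩
  rw [List.getElem?_eq_getElem h₁, (List.cons.inj h₃).1]

theorem Reading.length_le {x r : List Bool} (h : Reading x r s) : r.length ≤ x.length := by
  rw [← h.rest, List.length_drop]
  omega

/-- The loop of `readUnary` reads the leading ones. -/
theorem ends_readOnes {x r : List Bool} {v : ℕ} (h : Reading x r s) (hv : s.reg val = v) :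
    Ends procs (.while (.and (.lt (.var pos) (.var len))
        (.eq (.get bits (.lit 0) (.var pos)) (.lit 1))) (block [
      .set val (.succ (.var val)),
      .set pos (.succ (.var pos))])) s (r.length * 16 + 10) fun s' => ∃ m r', Reading x r' s' ∧
        s'.reg val = v + m ∧ r = List.replicate m true ++ r' ∧ r'.head? ≠ some true := by
  induction r generalizing s v with
  | nil =>
    refine (Ends.while_false ?_ ⟨0, [], h, hv, rfl, by simp⟩).le (by simp [Cond.cost, Expr.cost])
    have : x.length ≤ s.reg pos := by simpa using h.rest
    simp [Cond.Holds, Expr.eval, h.len, this]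
  | cons b r ih =>
    obtain ⟨h₁, h₂, h₃⟩ := h.cons
    cases b with
    | false =>
      refine (Ends.while_false ?_ ⟨0, _, h, hv, rfl, by simp⟩).le (by simp [Cond.cost, Expr.cost])
      simp [Cond.Holds, Expr.eval, h.bits _ h₁, h₂]
    | true =>
      refine (Ends.while_true (T₁ := 6) (T₂ := r.length * 16 + 10)
        (Q := fun s' => Reading x r s' ∧ s'.reg val = v + 1) ?_ ?_ ?_).le ?_
      · simp only [Cond.Holds, Expr.eval, h.len, h.bits _ h₁, h₂, if_true]
        exact ⟨h₁, trivial⟩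
      · refine Ends.cons rfl (Ends.set_reg _ _) fun s₁ k₁ u₁ => ?_
        refine ((Ends.set_reg _ _).frame rfl).mono (by simp [Expr.cost]) fun s₂ ⟨k₂, u₂⟩ => ?_
        have hp : s₂.reg pos = s.reg pos + 1 := by
          simp (disch := decide) only [k₂, Expr.eval, u₁.reg]
        have hm : s₂.mem = s.mem := by
          funext b
          rw [u₂.mem b List.not_mem_nil, u₁.mem b List.not_mem_nil]
        refine ⟨⟨?_, fun i hi => ?_, ?_, ?_⟩, ?_⟩
        · simp (disch := decide) only [u₂.reg, u₁.reg, h.len]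
        · rw [hm, h.bits i hi]
        · omega
        · rw [hp, h₃]
        · simp (disch := decide) only [u₂.reg, k₁, Expr.eval, hv]
      · rintro s₂ ⟨k₁, k₂⟩
        refine (ih k₁ k₂).mono le_rfl ?_
        rintro s₃ ⟨m, r', g₁, g₂, rfl, g₄⟩
        exact ⟨m + 1, r', g₁, by omega, by simp [List.replicate_succ], g₄⟩
      · simp only [Cond.cost, Expr.cost, List.length_cons]
        omega

/-- Either a number is read, or no code of a number is an initial segment of the rest of the
string. -/
theorem ends_readUnary {x r : List Bool} (h : Reading x r s) :
    Ends procs readUnary s (x.length * 16 + 30) fun s' =>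
      s'.reg val ≤ x.length ∧ ((∃ r', Reading x r' s' ∧ r = unary (s'.reg val) ++ r' ∧
        s'.reg bad = s.reg bad) ∨
      (Reading x [] s' ∧ (∀ m r', r ≠ unary m ++ r') ∧ s'.reg bad = 1)) := by
  have hlen := h.length_le
  refine Ends.cons rfl (Ends.set_reg _ _) fun s₁ h₁ u₁ => ?_
  refine Ends.cons rfl (ends_readOnes (h.of_unchanged u₁ (by decide) (by decide) (by decide)) h₁)
    fun s₂ h₂ u₂ => ?_
  obtain ⟨m, r', g₁, g₂, rfl, g₄⟩ := h₂
  have hm : m ≤ x.length := by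
    simp only [List.length_append, List.length_replicate] at hlen
    omega
  simp only [Expr.eval, zero_add] at g₂
  have hbad : s₂.reg bad = s.reg bad := by simp (disch := decide) only [u₂.reg, u₁.reg]
  refine (Ends.ite (T := 3) (fun hb => ?_) fun hb => ?_).le ?_
  · have hb' : s₂.reg pos < x.length := by simpa [Cond.Holds, Expr.eval, g₁.len] using hb
    refine ((Ends.set_reg _ _).frame rfl).mono (by simp [Expr.cost]) fun s₃ ⟨h₃, u₃⟩ => ?_
    have hv : s₃.reg val = m := by simp (disch := decide) only [u₃.reg, g₂]
    rw [hv]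
    refine ⟨hm, .inl ?_⟩
    cases r' with
    | nil =>
      have := g₁.rest
      rw [List.drop_eq_nil_iff] at this
      omega
    | cons b r' =>
      obtain rfl : b = false := by simpa using g₄
      obtain ⟨-, -, k₃⟩ := g₁.cons
      have hp : s₃.reg pos = s₂.reg pos + 1 := h₃
      refine ⟨r', ⟨?_, fun i hi => ?_, by omega, by rw [hp, k₃]⟩, by simp [unary], ?_⟩
      · simp (disch := decide) only [u₃.reg, g₁.len]
      · simp (disch := decide) only [u₃.mem, g₁.bits i hi]
      · simp (disch := decide) only [u₃.reg, hbad]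
  · have hb' : x.length ≤ s₂.reg pos := by simpa [Cond.Holds, Expr.eval, g₁.len] using hb
    refine ((Ends.set_reg _ _).frame rfl).mono (by simp [Expr.cost]) fun s₃ ⟨h₃, u₃⟩ => ?_
    have hr : r' = [] := by rw [← g₁.rest, List.drop_eq_nil_of_le hb']
    subst hr
    refine ⟨?_, .inr ⟨g₁.of_unchanged u₃ (by decide) (by decide) (by decide), fun l r' => ?_, h₃⟩⟩
    · simp (disch := decide) only [u₃.reg, g₂]
      exact hm
    · rw [List.append_nil]
      exact replicate_true_ne_unary_append m l r'
  · simp only [Cond.cost, Expr.cost, List.length_append, List.length_replicate] at hlen ⊢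
    omega

/-! ### Deciding complete reachability -/

/-- What is known about the automata with the code `x` when the rows `< i` and the columns `< j` of
row `i` of the transition table have been read, and their code from there on is given by `code`:
either there are none, or they are those that agree with the entries read so far and have the rest
of the string as the code of the other entries. -/
def TableInv (N K : ℕ) (x : List Bool) (i j : ℕ)
    (code : SemiAutomaton (Fin N) (Fin K) → List Bool) (s : State) : Prop :=
  s.reg n = N ∧ s.reg k = K ∧ ∃ r, Reading x r s ∧
    ((s.reg bad = 1 ∧ ∀ M : SemiAutomaton (Fin N) (Fin K), x ≠ encode M) ∨
    (s.reg bad = 0 ∧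
      (∀ (p : Fin N) (l : Fin K), p.1 < i ∨ (p.1 = i ∧ l.1 < j) → s.mem delta p l < N) ∧
      ∀ M : SemiAutomaton (Fin N) (Fin K), x = encode M ↔
        (∀ (p : Fin N) (l : Fin K), p.1 < i ∨ (p.1 = i ∧ l.1 < j) →
          s.mem delta p l = M.step p l) ∧ r = code M))

theorem TableInv.setReg {x : List Bool} {i j : ℕ}
    {code : SemiAutomaton (Fin N) (Fin K) → List Bool} {y v : ℕ}
    (h : TableInv N K x i j code s) (hy : y ∉ [n, k, len, pos, bad]) :
    TableInv N K x i j code (s.setReg y v) := by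
  simp only [List.mem_cons, List.not_mem_nil, or_false, not_or] at hy
  obtain ⟨h₁, h₂, h₃, h₄, h₅⟩ := hy
  have e : ∀ z, y ≠ z → (s.setReg y v).reg z = s.reg z := fun z hz => by
    simp [State.setReg, hz.symm]
  obtain ⟨g₁, g₂, r, g₃, g₄⟩ := h
  refine ⟨by rwa [e _ h₁], by rwa [e _ h₂], r, ⟨by rw [e _ h₃, g₃.len], g₃.bits,
    by rw [e _ h₄]; exact g₃.pos, by rw [e _ h₄, g₃.rest]⟩, ?_⟩
  rw [e _ h₅]
  exact g₄

theorem TableInv.congr {x : List Bool} {i j i' j' : ℕ}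
    {code code' : SemiAutomaton (Fin N) (Fin K) → List Bool} (h : TableInv N K x i j code s)
    (hc : code = code') (hij : ∀ (p : Fin N) (l : Fin K),
      (p.1 < i ∨ (p.1 = i ∧ l.1 < j)) ↔ (p.1 < i' ∨ (p.1 = i' ∧ l.1 < j'))) :
    TableInv N K x i' j' code' s := by
  subst hc
  simpa only [TableInv, hij] using h

/-- Reading one entry of the transition table. -/
theorem ends_readEntry {x : List Bool} {i j : ℕ} (hi : i < N) (hj : j < K)
    (h : TableInv N K x i j (fun M => rowCode M ⟨i, hi⟩ j ++ tableCode M (i + 1)) s)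
    (hr : s.reg row = i) (hc : s.reg col = j) :
    Ends procs (block [
      readUnary,
      .put delta (.var row) (.var col) (.var val),
      when (.not (.lt (.var val) (.var n))) (.set bad (.lit 1))]) s (x.length * 16 + 50)
      (TableInv N K x i (j + 1) fun M => rowCode M ⟨i, hi⟩ (j + 1) ++ tableCode M (i + 1)) := by
  obtain ⟨hN, hK, r, hR, hinv⟩ := h
  refine Ends.cons rfl (ends_readUnary hR) fun s₁ ⟨_, h₁⟩ u₁ => ?_
  refine Ends.cons rfl (d := when _ _) ⟨_, _, .put delta _ _ _ s₁, le_rfl, rfl⟩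
    (Q := fun s' => s' = s₁.setMem delta (s₁.reg row) (s₁.reg col) (s₁.reg val))
    fun s₂ h₂ u₂ => ?_
  have hN₂ : s₂.reg n = N := by simp (disch := decide) only [u₂.reg, u₁.reg, hN]
  have hK₂ : s₂.reg k = K := by simp (disch := decide) only [u₂.reg, u₁.reg, hK]
  have hr₁ : s₁.reg row = i := by simp (disch := decide) only [u₁.reg, hr]
  have hc₁ : s₁.reg col = j := by simp (disch := decide) only [u₁.reg, hc]
  have hv₂ : s₂.reg val = s₁.reg val := by simp (disch := decide) only [u₂.reg]
  have hbad₂ : s₂.reg bad = s₁.reg bad := by simp (disch := decide) only [u₂.reg]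
  rw [hr₁, hc₁] at h₂
  have hd₂ : ∀ p l : ℕ, s₂.mem delta p l = if p = i ∧ l = j then s₁.reg val else s.mem delta p l :=
    fun p l => by
      rw [h₂]
      simp only [State.setMem, true_and, u₁.mem delta (by decide)]
  -- An automaton with code `x` has the number that was just read as its next entry.
  have hkey : ∀ M : SemiAutomaton (Fin N) (Fin K), s.reg bad = 0 → x = encode M →
      r = unary (M.step ⟨i, hi⟩ ⟨j, hj⟩) ++ (rowCode M ⟨i, hi⟩ (j + 1) ++ tableCode M (i + 1)) := by
    intro M hb hM
    rcases hinv with hinv | hinv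
    · omega
    · rw [((hinv.2.2 M).1 hM).2]
      beta_reduce
      rw [rowCode_of_lt _ _ hj, List.append_assoc]
  refine (Ends.ite (T := 2) (fun hb => ?_) fun hb => ?_).le ?_
  · have hb' : N ≤ s₁.reg val := by simpa [Cond.Holds, Expr.eval, hv₂, hN₂] using hb
    refine ((Ends.set_reg _ _).frame rfl).mono (by simp [Expr.cost]) fun s₃ ⟨h₃, u₃⟩ => ?_
    refine ⟨?_, ?_, ?_⟩
    · simp (disch := decide) only [u₃.reg, hN₂]
    · simp (disch := decide) only [u₃.reg, hK₂]
    obtain ⟨r', hR'⟩ : ∃ r', Reading x r' s₁ := by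
      rcases h₁ with ⟨r', h₁, -⟩ | ⟨h₁, -⟩
      · exact ⟨_, h₁⟩
      · exact ⟨_, h₁⟩
    refine ⟨r', (hR'.of_unchanged u₂ (by decide) (by decide) (by decide)).of_unchanged u₃
      (by decide) (by decide) (by decide), .inl ⟨h₃, fun M hM => ?_⟩⟩
    rcases hinv with hinv | hinv
    · exact hinv.2 M hM
    · have hr := hkey M hinv.1 hM
      rcases h₁ with ⟨r'', -, h₁, -⟩ | ⟨-, h₁, -⟩
      · have := (unary_append_inj (h₁.symm.trans hr)).1
        have := (M.step ⟨i, hi⟩ ⟨j, hj⟩).2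
        omega
      · exact h₁ _ _ hr
  · have hb' : s₁.reg val < N := by simpa [Cond.Holds, Expr.eval, hv₂, hN₂] using hb
    refine (Ends.skip ?_).le (by omega)
    refine ⟨hN₂, hK₂, ?_⟩
    rw [hbad₂]
    rcases h₁ with ⟨r', hR', hr', hbad⟩ | ⟨hR', hr', hbad⟩
    · refine ⟨r', hR'.of_unchanged u₂ (by decide) (by decide) (by decide), ?_⟩
      rw [hbad]
      refine hinv.imp_right fun hinv => ⟨hinv.1, fun p l hpl => ?_, fun M => ?_⟩
      · rw [hd₂]
        split_ifs with hij
        · exact hb'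
        · exact hinv.2.1 p l (by omega)
      · rw [hinv.2.2 M]
        beta_reduce
        rw [rowCode_of_lt _ _ hj, hr', List.append_assoc]
        constructor
        · rintro ⟨k₁, k₂⟩
          obtain ⟨k₃, k₄⟩ := unary_append_inj k₂
          refine ⟨fun p l hpl => ?_, k₄⟩
          rw [hd₂]
          split_ifs with hij
          · obtain ⟨rfl, rfl⟩ : p = ⟨i, hi⟩ ∧ l = ⟨j, hj⟩ := ⟨Fin.ext hij.1, Fin.ext hij.2⟩
            exact k₃
          · exact k₁ p l (by omega)
        · rintro ⟨k₁, k₂⟩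
          refine ⟨fun p l hpl => ?_, ?_⟩
          · rw [← k₁ p l (by omega), hd₂, if_neg (by omega)]
          · rw [← k₁ ⟨i, hi⟩ ⟨j, hj⟩ (by simp), hd₂, if_pos ⟨rfl, rfl⟩, k₂]
    · refine ⟨[], hR'.of_unchanged u₂ (by decide) (by decide) (by decide), .inl ⟨hbad, ?_⟩⟩
      intro M hM
      rcases hinv with hinv | hinv
      · exact hinv.2 M hM
      · exact hr' _ _ (hkey M hinv.1 hM)
  · simp only [Cond.cost, Expr.cost]
    omega

theorem ends_readTable {x : List Bool}
    (h : TableInv N K x 0 0 (fun M => tableCode M 0) s) :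
    Ends procs readTable s (N * (K * (x.length * 16 + 57) + 13) + 6)
      (TableInv N K x N 0 fun _ => []) := by
  refine (Ends.for_var (T := K * (x.length * 16 + 57) + 6) N
    (fun m => TableInv N K x m 0 fun M => tableCode M m) rfl (by decide) (by decide) (by decide)
    h.1 (h.setReg (by decide)) fun m hm s₁ g₁ u₁ h₁ => ?_).mono le_rfl
    fun s' h' => h'.congr (funext fun M => tableCode_self M) fun _ _ => Iff.rfl
  refine (Ends.for_var (T := x.length * 16 + 50) K
    (fun l => TableInv N K x m l fun M => rowCode M ⟨m, hm⟩ l ++ tableCode M (m + 1)) rfl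
    (by decide) (by decide) (by decide) h₁.2.1 ?_ fun l hl s₂ g₂ u₂ h₂ => ?_).mono le_rfl ?_
  · exact TableInv.setReg (h₁.congr (funext fun M => tableCode_of_lt M hm) fun _ _ => Iff.rfl)
      (by decide)
  · refine (ends_readEntry hm hl h₂ ?_ g₂).mono le_rfl fun s' h' => h'.setReg (by decide)
    simp (disch := decide) only [u₂.reg, g₁]
  · intro s' h'
    refine TableInv.setReg (h'.congr (funext fun M => by rw [rowCode_self]; rfl)
      fun p l => ?_) (by decide)
    have := l.2
    omega

theorem completelyReachable_of_lt_two (M : SemiAutomaton (Fin N) (Fin K)) (hN : N < 2) :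
    M.CompletelyReachable := by
  rintro S ⟨p, hp⟩
  refine ⟨[], ?_⟩
  ext q
  have : q = p := Fin.ext (by have := q.2; have := p.2; omega)
  subst this
  simp [SemiAutomaton.image, SemiAutomaton.run, hp]

theorem Answered.result_iff {M : SemiAutomaton (Fin N) (Fin K)} (h : Answered M s) :
    s.reg result = 0 ↔ M.CompletelyReachable := by
  rcases h.correct with ⟨h₁, -, h₂⟩ | ⟨S, h₁, h₂⟩
  · exact ⟨fun _ => h₂, fun _ => h₁⟩
  · refine ⟨fun h => ?_, fun h => absurd (h S h₂.1) h₂.2.2.1⟩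
    have := h₁.1
    omega

theorem ends_decider (x : List Bool) : Ends decider.procs decider.main (bitInput x)
    (20000 * (x.length + 1) ^ 6) fun s => s.reg 0 = 1 ↔ x ∈ completelyReachableProblem := by
  refine Ends.cons rfl (Ends.set_reg _ _) fun s₁ h₁ u₁ => ?_
  have hlen₁ : s₁.reg len = x.length := h₁
  refine Ends.cons rfl (Ends.for_simple x.length (fun m s' => ∀ i < m, s'.mem bits 0 i =
    if x[i]? = some true then 1 else 0) rfl (by decide) (by decide) (by decide) hlen₁ (by simp)
    fun m hm s' h u h' i hi => ?_) fun s₂ h₂ u₂ => ?_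
  · have hd : s'.mem delta = (bitInput x).mem delta := by
      simp (disch := decide) only [u.mem, u₁.mem]
    simp only [Stmt.eff, Expr.eval, State.setReg, State.setMem, h, hd, true_and]
    rcases Nat.lt_succ_iff_lt_or_eq.1 hi with hi | rfl
    · rw [if_neg hi.ne, h' i hi]
    · simp [bitInput]
  refine Ends.cons rfl (Ends.set_reg _ _) fun s₃ h₃ u₃ => ?_
  refine Ends.cons rfl (Ends.set_reg _ _) fun s₄ h₄ u₄ => ?_
  have hpos₄ : s₄.reg pos = 0 := by simp (disch := decide) only [u₄.reg, h₃, Expr.eval]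
  have R₄ : Reading x x s₄ := by
    refine ⟨?_, fun i hi => ?_, by omega, by rw [hpos₄]; rfl⟩
    · simp (disch := decide) only [u₄.reg, u₃.reg, u₂.reg, hlen₁]
    · simp (disch := decide) only [u₄.mem, u₃.mem, h₂ i hi]
  refine Ends.cons rfl (ends_readUnary R₄) fun s₅ ⟨hN, h₅⟩ u₅ => ?_
  generalize hN' : s₅.reg val = N at *
  refine Ends.cons rfl (Ends.set_reg _ _) fun s₆ h₆ u₆ => ?_
  have hN₆ : s₆.reg n = N := h₆.trans hN'
  obtain ⟨r₆, R₆⟩ : ∃ r, Reading x r s₆ := by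
    rcases h₅ with ⟨r, h, -⟩ | ⟨h, -⟩ <;>
    exact ⟨_, h.of_unchanged u₆ (by decide) (by decide) (by decide)⟩
  refine Ends.cons rfl (ends_readUnary R₆) fun s₇ ⟨hK, h₇⟩ u₇ => ?_
  generalize hK' : s₇.reg val = K at *
  refine Ends.cons rfl (Ends.set_reg _ _) fun s₈ h₈ u₈ => ?_
  have hN₈ : s₈.reg n = N := by simp (disch := decide) only [u₈.reg, u₇.reg, hN₆]
  have hK₈ : s₈.reg k = K := h₈.trans hK'
  have hbad₆ : s₆.reg bad = s₅.reg bad := by simp (disch := decide) only [u₆.reg]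
  have hbad₈ : s₈.reg bad = s₇.reg bad := by simp (disch := decide) only [u₈.reg]
  obtain ⟨r₈, R₇⟩ : ∃ r, Reading x r s₇ := by
    rcases h₇ with ⟨r, h, -⟩ | ⟨h, -⟩ <;> exact ⟨_, h⟩
  have R₈ : Reading x r₈ s₈ := R₇.of_unchanged u₈ (by decide) (by decide) (by decide)
  have hhead : (s₈.reg bad = 1 ∧ ∀ (n k : ℕ) (M : SemiAutomaton (Fin n) (Fin k)), x ≠ encode M) ∨
      (s₈.reg bad = 0 ∧ x = unary N ++ (unary K ++ r₈)) := by
    rw [hbad₈]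
    rcases h₅ with ⟨r, h, hx, hb⟩ | ⟨-, hx, hb⟩
    · have hr : r₆ = r := by
        rw [← R₆.rest, ← h.rest, u₆.reg pos (by decide)]
      subst hr
      rcases h₇ with ⟨r', h', hr, hb'⟩ | ⟨-, hr, hb'⟩
      · have hr' : r₈ = r' := by rw [← R₇.rest, ← h'.rest]
        subst hr'
        refine .inr ⟨?_, by rw [hx, hr]⟩
        rw [hb', hbad₆, hb, h₄]
        rfl
      · refine .inl ⟨hb', fun n k M hM => hr k (tableCode M 0) ?_⟩
        rw [encode_eq] at hM
        exact (unary_append_inj (hx.symm.trans hM)).2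
    · refine .inl ⟨?_, fun n k M hM => hx n (unary k ++ tableCode M 0) (hM.trans (encode_eq M))⟩
      rcases h₇ with ⟨-, -, -, hb'⟩ | ⟨-, -, hb'⟩
      · rw [hb', hbad₆, hb]
      · exact hb'
  have hinv : TableInv N K x 0 0 (fun M => tableCode M 0) s₈ := by
    refine ⟨hN₈, hK₈, r₈, R₈, ?_⟩
    refine hhead.imp (fun h => ⟨h.1, h.2 N K⟩) fun h => ⟨h.1, by simp, fun M => ?_⟩
    rw [encode_eq, h.2]
    simp
  refine Ends.cons rfl (ends_readTable hinv) fun s₉ ⟨hN₉, hK₉, r₉, R₉, h₉⟩ u₉ => ?_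
  -- All codes of automata equal to `x` have the numbers of states and letters that were read.
  have hsize : ∀ (n k : ℕ) (M : SemiAutomaton (Fin n) (Fin k)), x = encode M → n = N ∧ k = K := by
    intro n k M hM
    rcases hhead with hh | hh
    · exact absurd hM (hh.2 n k M)
    · have := hM.symm.trans hh.2
      rw [encode_eq] at this
      obtain ⟨rfl, h⟩ := unary_append_inj this
      exact ⟨rfl, (unary_append_inj h).1⟩
  refine (Ends.ite (T := 10000 * (x.length + 1) ^ 6 + 100) (fun hb => ?_) fun hb => ?_).le ?_
  · obtain ⟨hbad, hpos⟩ : s₉.reg bad = 0 ∧ s₉.reg pos = x.length := by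
      simpa [Cond.Holds, Expr.eval, R₉.len] using hb
    obtain ⟨-, ht, ht'⟩ := h₉.resolve_left fun h => by omega
    have hr₉ : r₉ = [] := by rw [← R₉.rest, hpos, List.drop_length]
    let M : SemiAutomaton (Fin N) (Fin K) :=
      ⟨fun p l => ⟨s₉.mem delta p l, ht p l (.inl p.2)⟩⟩
    have hx : x = encode M := (ht' M).2 ⟨fun p l _ => rfl, hr₉⟩
    have hiff : x ∈ completelyReachableProblem ↔ M.CompletelyReachable := by
      refine ⟨?_, fun h => ⟨N, K, M, h, hx⟩⟩
      rintro ⟨n', k', M', h, hx'⟩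
      obtain ⟨rfl, rfl⟩ := hsize _ _ M' hx'
      have hM : M = M' := by
        obtain ⟨f⟩ := M'
        exact congrArg SemiAutomaton.mk (funext fun p => funext fun l =>
          Fin.ext (((ht' _).1 hx').1 p l (.inl p.2)))
      rwa [hM]
    rw [hiff]
    refine (Ends.ite (T := 10000 * (x.length + 1) ^ 6 + 50) (fun hb => ?_) fun hb => ?_).le ?_
    · have hN2 : N < 2 := by simpa [Cond.Holds, Expr.eval, hN₉] using hb
      refine (Ends.set_reg _ _).mono (by simp only [Expr.cost]; omega) fun s' h' => ?_
      exact iff_of_true h' (completelyReachable_of_lt_two M hN2)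
    · have hN2 : 1 < N := by simpa [Cond.Holds, Expr.eval, hN₉] using hb
      refine Ends.cons_call (ends_main (M := M) rfl hN2 ⟨hN₉, hK₉, fun _ _ => rfl⟩) fun s' hs' => ?_
      refine (Ends.ite (T := 2) (fun hb => ?_) fun hb => ?_).le ?_
      · have hb' : s'.reg result = 0 := by simpa [Cond.Holds, Expr.eval] using hb
        exact (Ends.set_reg _ _).mono (by simp [Expr.cost]) fun s'' h'' =>
          iff_of_true h'' (hs'.result_iff.1 hb')
      · have hb' : ¬ s'.reg result = 0 := by simpa [Cond.Holds, Expr.eval] using hb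
        refine (Ends.set_reg _ _).mono (by simp [Expr.cost]) fun s'' h'' =>
          iff_of_false ?_ fun h => hb' (hs'.result_iff.2 h)
        rw [h'']
        simp [Expr.eval]
      · have := mainTime_le_pow (N := N) (K := K) (l := x.length + 1) (by omega) (by omega)
          (by omega)
        simp only [Cond.cost, Expr.cost]
        omega
    · simp only [Cond.cost, Expr.cost]
      omega
  · refine (Ends.set_reg _ _).mono (by simp only [Expr.cost]; omega) fun s' h' => ?_
    refine iff_of_false (by rw [h']; simp [Expr.eval]) ?_
    rintro ⟨n', k', M, -, hM⟩
    obtain ⟨rfl, rfl⟩ := hsize _ _ M hM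
    rcases h₉ with h₉ | h₉
    · exact h₉.2 M hM
    · have hr := ((h₉.2.2 M).1 hM).2
      have hlen : x.length ≤ s₉.reg pos := by
        rw [← List.drop_eq_nil_iff, R₉.rest, hr]
      exact hb ⟨h₉.1, (le_antisymm R₉.pos hlen).trans R₉.len.symm⟩
  · simp only [Stmt.bound, Cond.cost, Expr.cost]
    generalize hl : x.length = l at *
    have e₁ : N * (K * (l * 16 + 57) + 13) ≤ l * (l * (l * 16 + 57) + 13) := by gcongr
    have e₂ : l * (l * (l * 16 + 57) + 13) + 100 * l + 500 ≤ 9000 * (l + 1) ^ 6 := by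
      have : (l + 1) ^ 3 ≤ (l + 1) ^ 6 := Nat.pow_le_pow_right (by omega) (by norm_num)
      have h₃ : l * (l * (l * 16 + 57) + 13) + 100 * l + 500 ≤ 600 * (l + 1) ^ 3 := by
        ring_nf
        nlinarith
      omega
    generalize (l + 1) ^ 6 = y at *
    omega

end FindWitness

theorem inP_completelyReachableProblem : InP completelyReachableProblem := by
  refine ⟨FindWitness.decider, 20000 * (Polynomial.X + 1) ^ 6, fun x => ?_⟩
  obtain ⟨t, s, h₁, h₂, h₃⟩ := FindWitness.ends_decider x
  exact ⟨t, s, h₁, by simpa using h₂, h₃⟩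

end CompReach

theorem mainTheorem3 :
    (∃ C : ℝ, ∀ (n k : ℕ) (M : CompReach.SemiAutomaton (Fin n) (Fin k)), 2 ≤ n →
      ∃ (t : ℕ) (s : CompReach.State),
        CompReach.FindWitness.program.Runs (CompReach.FindWitness.input M) t s ∧
        ((CompReach.FindWitness.ReturnsNone s ∧ (¬ ∃ S, M.IsWitness S) ∧
            M.CompletelyReachable) ∨
          ∃ S, CompReach.FindWitness.Returns s S ∧ M.IsWitness S) ∧
        (1 ≤ k → (t : ℝ) ≤ C * ((n : ℝ) ^ 4 * Real.log n * k))) ∧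
    CompReach.InP CompReach.completelyReachableProblem := by
  refine ⟨⟨30000, fun n k M hn => ?_⟩, CompReach.inP_completelyReachableProblem⟩
  obtain ⟨t, s, h₁, h₂, h₃⟩ := CompReach.FindWitness.ends_main
    (procs := CompReach.FindWitness.program.procs) rfl hn (CompReach.FindWitness.context_input M)
  exact ⟨t, s, h₁, h₃.correct, fun hk =>
    (Nat.cast_le.2 h₂).trans (CompReach.FindWitness.mainTime_le hn hk)⟩
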